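/- **Setting.** Let $J^{\mu\nu}$ be the generators of $\mathfrak{so}(4)$ acting on $\mathbb R^4$ by $J^{\mu\nu}P^\sigma=\eta^{\mu\sigma}P^\nu-\eta^{\nu\sigma}P^\mu$; identify $\mathfrak{so}(4)^*$ with skew matrices by $\langle b,X\rangle=\frac12\mathrm{tr}(b^TX)$ and $\mathbb R^{4*}$ with $\mathbb R^4$ by the dot product. For $u\in\mathbb R^4$, $w\in\mathbb R^{4*}$ let $[u,w]=-[w,u]\in\mathfrak{so}(4)^*$ be defined by $\langle[u,w],X\rangle=\langle w,Xu\rangle$. Elements $h\in SO(4)$ act on all these spaces; the action is written $v\mapsto hvh^{-1}$. Let $M$ be a finite triangulated closed oriented 3-dimensional space in which the tetrahedra around each edge $e$ form a single cycle. Write $c$ for nodes (centres of the tetrahedra $c^*$), $(cc')$ for the links, with arbitrary chosen orientations, $(cc')^*$ for the dual triangles, oriented as part of $\partial c^*$, and $e^*$ for the polygon dual to an oriented edge $e$; let $\epsilon^e_{(cc')}\in\{0,\pm1\}$ be the coefficient of $e$ in $\partial(cc')^*$. An *on-shell configuration* consists, for each $c$, of $g_c$ (values in $SO(4)$), $c_c$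 (values in $\mathbb R^4$), 1-forms $\sigma_c$ (values in $\mathbb R^{4*}$) and $b_c$ (values in $\mathfrak{so}(4)^*$) on $c^*$, and, for each link, of constants $h_{cc'}=h_{c'c}^{-1}\in SO(4)$, $x_c^{c'}\in\mathbb R^4$ and functions $\varsigma_c^{c'}$ (values in $\mathbb R^{4*}$), $y_c^{c'}$ (values in $\mathfrak{so}(4)^*$), with the continuity relations on $(cc')^*$ (forms pulled back) $$g_c=h_{cc'}g_{c'},\quad c_{c'}=h_{c'c}(c_c+x_c^{c'})h_{cc'},\quad \sigma_{c'}=h_{c'c}(\sigma_c+d\varsigma_c^{c'})h_{cc'},\quad b_{c'}=h_{c'c}(b_c-[\sigma_c,x_c^{c'}]+dy_c^{c'})h_{cc'}.$$ All data are smooth up to the boundary, except that $g_c$ need only be smooth away from the edges and its relation is imposed in the interior of triangles only, so that curvature on the edges is allowed. The fields are $A_c=g_c^{-1}dg_c$, $C_c=g_c^{-1}dc_c\,g_c$, $\Sigma_c=g_c^{-1}d\sigma_c\,g_c$, $B_c=g_c^{-1}(db_c+[d\sigma_c,c_c])g_c$. For a variation $\delta$ (velocity of a smooth family of configurations, with $\delta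 g_cg_c^{-1}$ bounded and $\delta A_c$ integrable) the potential is $$\Theta_{BFCG}=\sum_c\int_{c^*}\big(\langle B_c\wedge\delta A_c\rangle-\langle C_c\wedge\delta\Sigma_c\rangle\big).$$ *Assumption:* on each edge $e$, $\sigma_c$ (pulled back to $e$) is invariant under the holonomy $h_e=\prod_{\partial e^*}h_{c_ic_{i+1}}$ based at $c$, for every node $c$ around $e$; for a variation, this is assumed for every member of the family. *Discrete variables.* Choose for each $e$ a node $c_e$ around $e$, and for each link $(cc')$ around $e$ a path around $e$ from $c_e$ to $c$, with holonomy $h_{c_ec}$. Put $$\ell_e=\int_e dc_{c_e},\qquad V_{e^*}=\sum_{(cc')\in\partial e^*}\epsilon^e_{(cc')}\,h_{c_ec}\,\varsigma_c^{c'}\,h_{cc_e},$$ $$b_{(cc')^*}=\int_{(cc')^*}\big(db_c-d[c_c,\sigma_c]-[dc_c\wedge d\varsigma_c^{c'}]\big)+\sum_{e}\sum_{(aa')\in\partial e^*}\epsilon^e_{(aa')}\sum\pm\int_e[dc_c,\,h_{ca}\varsigma_a^{a'}h_{ac}],$$ the last sum being over the passages of the chosen path from $c_e$ to $a$ through $(cc')$,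 with sign $+$ if it goes from $c$ to $c'$ and $-$ otherwise, $h_{ca}$ being the holonomy of the part of the path from $c$ to $a$. **Statement.** 1. For every on-shell configuration satisfying the assumption, $V_{e^*}$ is constant along $e$; $h_{cc'}\in SO(4)$ (links), $b_{(cc')^*}\in\mathfrak{so}(4)^*$ (triangles), $\ell_e\in\mathbb R^4$ (edges), $V_{e^*}\in\mathbb R^{4*}$ (dual faces); and edge simplicity holds: for each node $c$ around $e$, $\ell_c^e:=\int_edc_c$ satisfies $\ell_c^e-h_e^{-1}\ell_c^eh_e=0$. 2. For every variation, the integrand of $\Theta_{BFCG}$ is integrable on each tetrahedron and, with $\Delta h_c^{c'}=\delta h_{cc'}\,h_{cc'}^{-1}$, $$\Theta_{BFCG}=\sum_{(cc')}\big\langle b_{(cc')^*},\Delta h_c^{c'}\big\rangle+\sum_e\big\langle\ell_e,\delta V_{e^*}\big\rangle .$$ 3. On the space of all $(h,b,\ell,V)\in(SO(4)\times\mathfrak{so}(4)^*)^{\rm links}\times(\mathbb R^4\times\mathbb R^{4*})^{\rm edges}$ let $\Theta$ be this discrete potential. Then $\omega=\delta\Theta$ is nondegenerate, and (with the sign convention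 in which $\Theta=p\,\delta q$ gives $\{q,p\}=1$) the brackets of the G-network phase space hold: on each edge $\{\ell_\alpha,V^\beta\}=-\delta_\alpha^\beta$; on each link $\{h^\alpha{}_\beta,b^{\sigma\rho}\}=(J^{\sigma\rho}h)^\alpha{}_\beta$ and $\{b^{\sigma\rho},b^{\alpha\beta}\}=\eta^{\sigma\alpha}b^{\rho\beta}+\eta^{\rho\beta}b^{\sigma\alpha}-\eta^{\sigma\beta}b^{\rho\alpha}-\eta^{\rho\alpha}b^{\sigma\beta}$, where $b^{\sigma\rho}=\langle b,J^{\sigma\rho}\rangle$; all other brackets of these coordinates vanish. 4. Let $M$ be the boundary of the 4-simplex with vertices $\bar1,\dots,\bar5$, let $i^*$ be the tetrahedron without $\bar i$, and take links $(ij)$ and edges $[\bar i\bar j]$ with $ij\in\{12,23,34,45,51,14,42,25,53,31\}$; the dual triangles are $(12)^*=[\bar3\bar4\bar5]$, $(23)^*=[\bar1\bar4\bar5]$, $(34)^*=[\bar1\bar2\bar5]$, $(45)^*=[\bar1\bar2\bar3]$, $(51)^*=[\bar2\bar3\bar4]$, $(14)^*=[\bar2\bar3\bar5]$, $(42)^*=[\bar1\bar3\bar5]$,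 $(25)^*=[\bar1\bar3\bar4]$, $(53)^*=[\bar1\bar2\bar4]$, $(31)^*=[\bar2\bar4\bar5]$. Base the edges $12,42$ at node $3$, the edges $31,14,51$ at node $2$, the others at node $1$, and transport along direct links. Write $hv$ for $hvh^{-1}$ and drop bars on edge labels. For every on-shell configuration satisfying the assumption, the following hold. (a) $V^{12}=\varsigma_3^4+h_{34}\varsigma_4^5+h_{35}\varsigma_5^3$, $V^{31}=-h_{24}\varsigma_4^2+h_{24}\varsigma_4^5-\varsigma_2^5$, $V^{14}=\varsigma_2^3-\varsigma_2^5-h_{25}\varsigma_5^3$, $V^{51}=h_{24}\varsigma_4^2+h_{23}\varsigma_3^4+\varsigma_2^3$, $V^{23}=h_{14}\varsigma_4^5+h_{15}\varsigma_5^1+\varsigma_1^4$, $V^{42}=-h_{35}\varsigma_5^3-\varsigma_3^1+h_{35}\varsigma_5^1$, $V^{25}=h_{13}\varsigma_3^4-h_{13}\varsigma_3^1-\varsigma_1^4$, $V^{34}=\varsigma_1^2+h_{15}\varsigma_5^1+h_{12}\varsigma_2^5$, $V^{53}=-h_{14}\varsigma_4^2-\varsigma_1^4+\varsigma_1^2$,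 $V^{45}=\varsigma_1^2+h_{12}\varsigma_2^3+h_{13}\varsigma_3^1$, at every point of the edge. (b) With $\beta_{ij}=\int_{(ij)^*}(db_i-d[c_i,\sigma_i]-[dc_i\wedge d\varsigma_i^j])$: $b_{12}=\beta_{12}+\int_{45}[dc_1,h_{12}\varsigma_2^3]+\int_{34}[dc_1,h_{12}\varsigma_2^5]$; $b_{23}=\beta_{23}+\int_{51}[dc_2,h_{23}\varsigma_3^4]$; $b_{34}=\beta_{34}+\int_{12}[dc_3,h_{34}\varsigma_4^5]$; $b_{45}=\beta_{45}$; $b_{51}=\beta_{51}-\int_{34}[dc_5,\varsigma_5^1]-\int_{23}[dc_5,\varsigma_5^1]$; $b_{14}=\beta_{14}+\int_{23}[dc_1,h_{14}\varsigma_4^5]-\int_{53}[dc_1,h_{14}\varsigma_4^2]$; $b_{25}=\beta_{25}-\int_{14}[dc_2,h_{25}\varsigma_5^3]$; $b_{31}=\beta_{31}+\int_{25}[dc_3,\varsigma_3^1]-\int_{25}[dc_3,\varsigma_3^4]-\int_{45}[dc_3,\varsigma_3^1]$; $b_{42}=\beta_{42}-\int_{51}[dc_4,\varsigma_4^2]-\int_{31}[dc_4,\varsigma_4^5]+\int_{31}[dc_4,\varsigma_4^2]$;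 $b_{53}=\beta_{53}-\int_{42}[dc_5,\varsigma_5^1]+\int_{42}[dc_5,\varsigma_5^3]-\int_{12}[dc_5,\varsigma_5^3]$. (c) 2-Gauss: $h_{43}\ell^{12}+h_{41}\ell^{23}+h_{42}\ell^{31}=0$, $h_{53}\ell^{12}-h_{53}\ell^{42}-h_{52}\ell^{14}=0$, $\ell^{12}+h_{31}\ell^{25}+h_{32}\ell^{51}=0$, $-\ell^{31}-\ell^{14}+h_{21}\ell^{34}=0$, $-h_{42}\ell^{31}-h_{41}\ell^{53}+h_{42}\ell^{51}=0$, $\ell^{14}+h_{21}\ell^{45}+\ell^{51}=0$, $h_{51}\ell^{23}+h_{53}\ell^{42}+h_{51}\ell^{34}=0$, $\ell^{23}-\ell^{53}-\ell^{25}=0$, $-h_{31}\ell^{25}-\ell^{42}+h_{31}\ell^{45}=0$, $\ell^{34}+\ell^{45}+\ell^{53}=0$. (d) 2-flatness: if $h_e=1$ for all edges $e$ containing $\bar v$, then the polyhedron dual to $\bar v$ closes: $v=1$: $h_{23}V^{12}+V^{14}-V^{31}-V^{51}=0$; $v=2$: $V^{23}+V^{25}-h_{13}V^{12}-h_{13}V^{42}=0$;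 $v=3$: $h_{12}V^{31}+V^{34}-V^{53}-V^{23}=0$; $v=4$: $V^{45}+h_{13}V^{42}-h_{12}V^{14}-V^{34}=0$; $v=5$: $V^{53}+h_{12}V^{51}-V^{45}-V^{25}=0$. (e) Modified 1-Gauss: for each $c$, $\sum_{(cc')}b_{cc'}-\sum_{(c'c)}h_{cc'}b_{c'c}-\sum_{e}[\ell^e,V^e]=0$, the sums being over the links with source $c$, the links with target $c$, and the edges based at $c$. 5. The variable $b_{(12)^*}$ of part 4 depends on each of the fields $b,c,\sigma,\varsigma$: for each of the four there are two on-shell configurations, satisfying the assumption, that differ in that field only and have different $b_{(12)^*}$. -/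

import Mathlib

open scoped ContDiff Matrix
open MeasureTheory

attribute [local instance] Matrix.normedAddCommGroup Matrix.normedSpace

noncomputable section

namespace BFCG

/-! ## Algebra: `SO(4)`, `so(4)`, `so(4)*`, `ℝ⁴`, `ℝ⁴*` -/

/-- `4 × 4` real matrices. `SO(4)`, `so(4)` and `so(4)*` are realised inside them. -/
abbrev Mat : Type := Matrix (Fin 4) (Fin 4) ℝ

/-- `ℝ⁴`; also `ℝ⁴*`, through the dual basis, the pairing being the dot product. -/
abbrev R4 : Type := Fin 4 → ℝ

/-- The group `SO(4)`. -/
def IsSO (h : Mat) : Prop := h ∈ Matrix.specialOrthogonalGroup (Fin 4) ℝ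

/-- Skew-symmetric matrices: the Lie algebra `so(4)`, and, through `pairing`, its dual `so(4)*`. -/
def IsSkew (a : Mat) : Prop := aᵀ = -a

/-- The generator `J^{μν}` of `so(4)`, in its action on `ℝ⁴`:
`J^{μν} P^σ = η^{μσ} P^ν - η^{νσ} P^μ`. -/
def J (μ ν : Fin 4) : Mat := Matrix.single ν μ 1 - Matrix.single μ ν 1

/-- The pairing of `so(4)*` and `so(4)`. It is normalised so that `J*_{μν}`, realised as the matrix
`J μ ν`, satisfies `⟨J*_{μν}, J^{σρ}⟩ = δ_μ^σ δ_ν^ρ - δ_ν^σ δ_μ^ρ`. -/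
def pairing (b X : Mat) : ℝ := (1 / 2) * (bᵀ * X).trace

/-- The bracket `[u, w] ∈ so(4)*` of a translation `u ∈ ℝ⁴` and `w ∈ ℝ⁴*` in the double, given by
`[P^μ, P*_ν] = η^{μσ} J*_{σν}`; it is characterised by `⟨[u, w], X⟩ = ⟨w, X u⟩`.
The opposite bracket is `[w, u] = -[u, w]`. -/
def brk (u w : R4) : Mat := Matrix.vecMulVec w u - Matrix.vecMulVec u w

lemma brk_single (μ ν : Fin 4) : brk (Pi.single μ 1) (Pi.single ν 1) = J μ ν := by
  ext i j
  simp only [brk, J, Matrix.sub_apply, Matrix.vecMulVec_apply, Matrix.single_apply, Pi.single_apply]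
  fin_cases μ <;> fin_cases ν <;> fin_cases i <;> fin_cases j <;> simp

lemma pairing_brk (u w : R4) (X : Mat) (hX : IsSkew X) :
    pairing (brk u w) X = w ⬝ᵥ (X *ᵥ u) := by
  have h : ∀ i j, X j i = -X i j := fun i j => by
    have := congrFun (congrFun hX i) j
    simpa using this
  have h' : ∀ i, X i i = 0 := fun i => by have := h i i; linarith
  simp only [pairing, brk, Matrix.trace, Matrix.mul_apply, Fin.sum_univ_four, Matrix.diag_apply,
    Matrix.transpose_apply, Matrix.sub_apply, Matrix.vecMulVec_apply, dotProduct, Matrix.mulVec,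
    h']
  rw [h 0 1, h 0 2, h 0 3, h 1 2, h 1 3, h 2 3]
  ring

/-! ## Differential forms and integrals over simplices -/

section Forms

variable {E F : Type*} [NormedAddCommGroup E] [NormedSpace ℝ E]
  [NormedAddCommGroup F] [NormedSpace ℝ F]

/-- The differential of a function `f`: `(df)ₓ(u) = ∂ᵤ f`. -/
def D (f : E → F) (x u : E) : F := fderiv ℝ f x u

/-- The exterior derivative of a `1`-form `θ`: `(dθ)ₓ(u, v) = ∂ᵤ(θ(v)) - ∂ᵥ(θ(u))`. -/
def extD (θ : E → E → F) (x u v : E) : F := D (fun y => θ y v) x u - D (fun y => θ y u) x v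

/-- The variation `δ`: the derivative at parameter `0`. -/
def vary (f : ℝ → F) : F := deriv f 0

/-- The standard `n`-simplex `{s | 0 ≤ sᵢ, ∑ sᵢ ≤ 1}` in `ℝⁿ`. -/
def stdDomain (n : ℕ) : Set (Fin n → ℝ) := {s | (∀ i, 0 ≤ s i) ∧ ∑ i, s i ≤ 1}

/-- The affine parametrisation of the simplex with vertices `p 0, …, p n`. -/
def simplexMap {n : ℕ} (p : Fin (n + 1) → E) (s : Fin n → ℝ) : E :=
  p 0 + ∑ i, s i • (p i.succ - p 0)

/-- The integral of the `n`-form `θ` over the oriented affine simplex `[p 0, …, p n]`. -/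
def simplexIntegral {n : ℕ} (p : Fin (n + 1) → E) (θ : E → (Fin n → E) → F) : F :=
  ∫ s in stdDomain n, θ (simplexMap p s) (fun i => p i.succ - p 0)

end Forms

/-! ## Triangulations -/

/-- The set of vertices of an ordered simplex. -/
def verts {V : Type*} [DecidableEq V] {k : ℕ} (s : Fin k → V) : Finset V :=
  Finset.univ.image s

/-- The relative orientation of two ordered simplices without repeated vertices: the sign of the
permutation relating them if they have the same vertices, and `0` otherwise. -/
def orient {V : Type*} [DecidableEq V] {k : ℕ} (s s' : Fin k → V) : ℤ :=
  Matrix.det (Matrix.of fun i j => if s i = s' j then (1 : ℤ) else 0)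

/-- The coefficient of the oriented simplex `s` in the boundary `∑ᵢ (-1)ⁱ [t₀ … t̂ᵢ … tₖ]` of the
oriented simplex `t`. -/
def incidence {V : Type*} [DecidableEq V] {k : ℕ} (t : Fin (k + 1) → V) (s : Fin k → V) : ℤ :=
  ∑ i : Fin (k + 1), (-1) ^ (i : ℕ) * orient s (fun j => t (i.succAbove j))

/-- Paths in the dual complex are lists of links, each traversed from source to target (`true`) or
from target to source (`false`). `IsPathWith src tgt ok a p b` says that `p` leads from the node `a`
to the node `b` and uses only links satisfying `ok`. -/
def IsPathWith {C L : Type*} (src tgt : L → C) (ok : L → Prop) : C → List (L × Bool) → C → Prop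
  | a, [], b => a = b
  | a, (l, true) :: p, b => ok l ∧ src l = a ∧ IsPathWith src tgt ok (tgt l) p b
  | a, (l, false) :: p, b => ok l ∧ tgt l = a ∧ IsPathWith src tgt ok (src l) p b

/-- A finite triangulated closed oriented `3`-dimensional space `M`, with its dual complex.
`C` indexes the tetrahedra `c*` (and their centres, the nodes `c`), `L` the links `(cc')` (and the
dual triangles `(cc')*`), `Ed` the edges `e` (and the dual polygons `e*`). Tetrahedra are given by
positively ordered vertices, the links and edges have arbitrary orientations, and the triangle
`(cc')*` is oriented as part of the boundary of `c*`. -/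
structure Triangulation (V C L Ed : Type*) [DecidableEq V] [DecidableEq C] where
  tet : C → Fin 4 → V
  tri : L → Fin 3 → V
  edge : Ed → Fin 2 → V
  src : L → C
  tgt : L → C
  tet_injective : ∀ c, Function.Injective (tet c)
  tri_injective : ∀ l, Function.Injective (tri l)
  edge_injective : ∀ e, Function.Injective (edge e)
  tet_ext : ∀ c c', verts (tet c) = verts (tet c') → c = c'
  tri_ext : ∀ l l', verts (tri l) = verts (tri l') → l = l'
  edge_ext : ∀ e e', verts (edge e) = verts (edge e') → e = e'
  /-- Every face of a tetrahedron is one of the triangles. -/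
  face_mem : ∀ c (i : Fin 4), ∃ l, verts (tri l) = verts (fun j => tet c (i.succAbove j))
  /-- Every side of a triangle is one of the edges. -/
  side_mem : ∀ l (i : Fin 3), ∃ e, verts (edge e) = verts (fun j => tri l (i.succAbove j))
  /-- Every edge is a side of some triangle. -/
  edge_mem : ∀ e, ∃ l, verts (edge e) ⊆ verts (tri l)
  src_ne_tgt : ∀ l, src l ≠ tgt l
  /-- The triangle dual to `(cc')` is a face of exactly `c*` and `c'*`, with opposite induced
  orientations. -/
  incidence_eq : ∀ c l, incidence (tet c) (tri l) =
    (if src l = c then 1 else 0) - (if tgt l = c then 1 else 0)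
  /-- The tetrahedra around an edge form a single cycle: each of them has two faces that contain the
  edge, and they are connected through such faces. -/
  dual_connected : ∀ e c c', verts (edge e) ⊆ verts (tet c) → verts (edge e) ⊆ verts (tet c') →
    ∃ p, IsPathWith src tgt (fun l => verts (edge e) ⊆ verts (tri l)) c p c'

section Geometry

variable {V : Type*} [Fintype V] [DecidableEq V]

/-- The positions of the vertices of an ordered simplex in the geometric realisation
`|K| ⊆ ℝ^V`, whose points are given by their barycentric coordinates. -/
def pts {k : ℕ} (s : Fin k → V) (i : Fin k) : V → ℝ := Pi.single (s i) 1

/-- The closed simplex with vertices `s`. -/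
def cell {k : ℕ} (s : Fin k → V) : Set (V → ℝ) :=
  {x | (∀ v, 0 ≤ x v) ∧ ∑ v, x v = 1 ∧ ∀ v ∉ verts s, x v = 0}

/-- The relative interior of the simplex with vertices `s`. -/
def openCell {k : ℕ} (s : Fin k → V) : Set (V → ℝ) :=
  {x | x ∈ cell s ∧ ∀ v ∈ verts s, 0 < x v}

/-- The closed simplex without its edges and vertices. -/
def regCell {k : ℕ} (s : Fin k → V) : Set (V → ℝ) :=
  {x | x ∈ cell s ∧ 3 ≤ (Finset.univ.filter fun v => x v ≠ 0).card}

/-- The vectors tangent to the simplex with vertices `s`. -/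
def IsTangent {k : ℕ} (s : Fin k → V) (u : V → ℝ) : Prop :=
  ∑ v, u v = 0 ∧ ∀ v ∉ verts s, u v = 0

end Geometry

section Discretization

variable {V C L Ed : Type*} [Fintype V] [DecidableEq V] [Fintype C] [DecidableEq C]
  [Fintype L] [DecidableEq L] [Fintype Ed]

namespace Triangulation

/-- The link `l` is one of the sides of the polygon `e*` dual to the edge `e`. -/
def Around (T : Triangulation V C L Ed) (e : Ed) (l : L) : Prop :=
  verts (T.edge e) ⊆ verts (T.tri l)

/-- `p` is a path from `a` to `b` along the boundary of the dual polygon `e*`. -/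
def IsPath (T : Triangulation V C L Ed) (e : Ed) : C → List (L × Bool) → C → Prop :=
  IsPathWith T.src T.tgt (T.Around e)

/-- The vector from the initial to the final vertex of the edge `e`. -/
def edgeVec (T : Triangulation V C L Ed) (e : Ed) : V → ℝ := pts (T.edge e) 1 - pts (T.edge e) 0

/-- `∫_e θ`. -/
def edgeInt {F : Type*} [NormedAddCommGroup F] [NormedSpace ℝ F] (T : Triangulation V C L Ed)
    (e : Ed) (θ : (V → ℝ) → (V → ℝ) → F) : F :=
  simplexIntegral (pts (T.edge e)) fun x u => θ x (u 0)

/-- `∫_{(cc')*} θ`. -/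
def triInt {F : Type*} [NormedAddCommGroup F] [NormedSpace ℝ F] (T : Triangulation V C L Ed)
    (l : L) (θ : (V → ℝ) → (V → ℝ) → (V → ℝ) → F) : F :=
  simplexIntegral (pts (T.tri l)) fun x u => θ x (u 0) (u 1)

/-- `∫_{c*} θ`. -/
def tetInt {F : Type*} [NormedAddCommGroup F] [NormedSpace ℝ F] (T : Triangulation V C L Ed)
    (c : C) (θ : (V → ℝ) → (V → ℝ) → (V → ℝ) → (V → ℝ) → F) : F :=
  simplexIntegral (pts (T.tet c)) fun x u => θ x (u 0) (u 1) (u 2)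

end Triangulation

/-! ## On-shell field configurations -/

variable (V C L) in
/-- The fields that parametrise an on-shell configuration in each tetrahedron `c*`, and the
transition data of the links `(cc')`. -/
structure Fields where
  /-- `g_c`, with values in `SO(4)` -/
  g : C → (V → ℝ) → Mat
  /-- `c_c`, with values in `ℝ⁴` -/
  c : C → (V → ℝ) → R4
  /-- the `1`-form `σ_c`, with values in `ℝ⁴*` -/
  σ : C → (V → ℝ) → (V → ℝ) →ₗ[ℝ] R4
  /-- the `1`-form `b_c`, with values in `so(4)*` -/
  b : C → (V → ℝ) → (V → ℝ) →ₗ[ℝ] Mat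
  /-- the constant `h_{cc'} ∈ SO(4)`; its inverse `h_{c'c}` is the transpose -/
  h : L → Mat
  /-- the constant `x_c^{c'} ∈ ℝ⁴` -/
  x : L → R4
  /-- the function `ς_c^{c'}`, with values in `ℝ⁴*` -/
  ς : L → (V → ℝ) → R4
  /-- the function `y_c^{c'}`, with values in `so(4)*` -/
  y : L → (V → ℝ) → Mat

namespace Fields

/-- `A_c = g_c⁻¹ dg_c`, with `g_c⁻¹ = g_cᵀ`. -/
def A (Φ : Fields V C L) (c : C) (x u : V → ℝ) : Mat := (Φ.g c x)ᵀ * D (Φ.g c) x u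

/-- `C_c = g_c⁻¹ dc_c g_c`. -/
def Ctr (Φ : Fields V C L) (c : C) (x u : V → ℝ) : R4 := (Φ.g c x)ᵀ *ᵥ D (Φ.c c) x u

/-- `dσ_c`. -/
def dσ (Φ : Fields V C L) (c : C) (x u v : V → ℝ) : R4 := extD (fun y w => Φ.σ c y w) x u v

/-- `db_c`. -/
def db (Φ : Fields V C L) (c : C) (x u v : V → ℝ) : Mat := extD (fun y w => Φ.b c y w) x u v

/-- `Σ_c = g_c⁻¹ dσ_c g_c`. -/
def Sig (Φ : Fields V C L) (c : C) (x u v : V → ℝ) : R4 := (Φ.g c x)ᵀ *ᵥ Φ.dσ c x u v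

/-- `B_c = g_c⁻¹ (db_c + [dσ_c, c_c]) g_c`. -/
def B (Φ : Fields V C L) (c : C) (x u v : V → ℝ) : Mat :=
  (Φ.g c x)ᵀ * (Φ.db c x u v - brk (Φ.c c x) (Φ.dσ c x u v)) * Φ.g c x

end Fields

/-- An on-shell configuration: the fields are smooth and satisfy the continuity relations
`g_c = h_{cc'} g_{c'}`, `c_{c'} = h_{c'c} (c_c + x_c^{c'}) h_{cc'}`,
`σ_{c'} = h_{c'c} (σ_c + dς_c^{c'}) h_{cc'}`,
`b_{c'} = h_{c'c} (b_c - [σ_c, x_c^{c'}] + dy_c^{c'}) h_{cc'}`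
(forms being pulled back to the triangle). Curvature may sit on the edges: `g_c` need only be smooth
away from the edges, and its continuity relation is imposed in the interior of the triangle only.
A function that is smooth on a closed simplex is represented by a smooth function on `ℝ^V`. -/
structure IsConfig (T : Triangulation V C L Ed) (Φ : Fields V C L) : Prop where
  g_mem : ∀ c, ∀ x ∈ regCell (T.tet c), IsSO (Φ.g c x)
  h_mem : ∀ l, IsSO (Φ.h l)
  b_skew : ∀ c x u, IsSkew (Φ.b c x u)
  y_skew : ∀ l x, IsSkew (Φ.y l x)
  g_smooth : ∀ c, ∀ x ∈ regCell (T.tet c), ContDiffAt ℝ ∞ (Φ.g c) x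
  c_smooth : ∀ c, ContDiff ℝ ∞ (Φ.c c)
  σ_smooth : ∀ c u, ContDiff ℝ ∞ (fun x => Φ.σ c x u)
  b_smooth : ∀ c u, ContDiff ℝ ∞ (fun x => Φ.b c x u)
  ς_smooth : ∀ l, ContDiff ℝ ∞ (Φ.ς l)
  y_smooth : ∀ l, ContDiff ℝ ∞ (Φ.y l)
  g_cont : ∀ l, ∀ x ∈ openCell (T.tri l), Φ.g (T.src l) x = Φ.h l * Φ.g (T.tgt l) x
  c_cont : ∀ l, ∀ x ∈ cell (T.tri l), Φ.c (T.tgt l) x = (Φ.h l)ᵀ *ᵥ (Φ.c (T.src l) x + Φ.x l)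
  σ_cont : ∀ l, ∀ x ∈ cell (T.tri l), ∀ u, IsTangent (T.tri l) u →
    Φ.σ (T.tgt l) x u = (Φ.h l)ᵀ *ᵥ (Φ.σ (T.src l) x u + D (Φ.ς l) x u)
  b_cont : ∀ l, ∀ x ∈ cell (T.tri l), ∀ u, IsTangent (T.tri l) u →
    Φ.b (T.tgt l) x u = (Φ.h l)ᵀ * (Φ.b (T.src l) x u + brk (Φ.x l) (Φ.σ (T.src l) x u)
      + D (Φ.y l) x u) * Φ.h l

/-- The holonomy `h_{c₁c₂} h_{c₂c₃} ⋯` of a path, with `h_{c'c} = h_{cc'}⁻¹ = h_{cc'}ᵀ`. -/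
def hol (h : L → Mat) : List (L × Bool) → Mat
  | [] => 1
  | (l, true) :: p => h l * hol h p
  | (l, false) :: p => (h l)ᵀ * hol h p

/-- Invariance of `σ` under the edge holonomies: along each edge `e`, the (pulled back) `σ_c` is
invariant under the holonomy of every closed path around `e` based at `c` (equivalently, of the loop
`∂e*` based at `c`, as these are its powers up to backtracking). -/
def SigmaInvariant (T : Triangulation V C L Ed) (Φ : Fields V C L) : Prop :=
  ∀ e c p, T.IsPath e c p c → ∀ x ∈ cell (T.edge e),
    hol Φ.h p *ᵥ Φ.σ c x (T.edgeVec e) = Φ.σ c x (T.edgeVec e)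

/-- The choices in the discretization: for each edge `e` a node `c_e` around `e`, and for each link
`(cc')` around `e` a path around `e` from `c_e` to `c`, along which `ς_c^{c'}` is transported to
`c_e`. -/
structure Choice (T : Triangulation V C L Ed) where
  base : Ed → C
  path : Ed → L → List (L × Bool)
  base_mem : ∀ e, verts (T.edge e) ⊆ verts (T.tet (base e))
  isPath : ∀ e l, T.Around e l → T.IsPath e (base e) (path e l) (T.src l)

/-! ## Discrete variables -/

/-- `ε^e_{(cc')}`: the coefficient of `e` in the boundary of the triangle dual to the link. It is
zero if the link does not belong to `e*`. -/
def eps (T : Triangulation V C L Ed) (e : Ed) (l : L) : ℝ := incidence (T.tri l) (T.edge e)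

/-- `∫_e dc_c`. -/
def ellAt (T : Triangulation V C L Ed) (Φ : Fields V C L) (e : Ed) (c : C) : R4 :=
  T.edgeInt e fun x u => D (Φ.c c) x u

/-- The edge variable `ℓ_e = ∫_e dc_{c_e}`. -/
def ellVar (T : Triangulation V C L Ed) (K : Choice T) (Φ : Fields V C L) (e : Ed) : R4 :=
  ellAt T Φ e (K.base e)

/-- The combination `∑_{(cc') ∈ ∂e*} ε^e_{(cc')} h_{c_e c} ς_c^{c'} h_{c c_e}` of the `ς`'s. -/
def faceSum (T : Triangulation V C L Ed) (K : Choice T) (Φ : Fields V C L) (e : Ed)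
    (x : V → ℝ) : R4 :=
  ∑ l, eps T e l • (hol Φ.h (K.path e l) *ᵥ Φ.ς l x)

/-- The dual face variable `V_{e*}`: the value of `faceSum` on `e` (taken at the first vertex). -/
def faceVar (T : Triangulation V C L Ed) (K : Choice T) (Φ : Fields V C L) (e : Ed) : R4 :=
  faceSum T K Φ e (pts (T.edge e) 0)

/-- `∫_{(cc')*} (db_c - d[c_c, σ_c] - [dc_c ∧ dς_c^{c'}])`. -/
def bulk (T : Triangulation V C L Ed) (Φ : Fields V C L) (l : L) : Mat :=
  T.triInt l fun x u v =>
    Φ.db (T.src l) x u v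
      - extD (fun y w => brk (Φ.c (T.src l) y) (Φ.σ (T.src l) y w)) x u v
      - (brk (D (Φ.c (T.src l)) x u) (D (Φ.ς l) x v)
          - brk (D (Φ.c (T.src l)) x v) (D (Φ.ς l) x u))

/-- `∫_e [dc_c, w]`. -/
def edgeBrk (T : Triangulation V C L Ed) (Φ : Fields V C L) (e : Ed) (c : C)
    (w : (V → ℝ) → R4) : Mat :=
  T.edgeInt e fun x u => brk (D (Φ.c c) x u) (w x)

/-- The contribution to the link `(cc')` of a vector `w` transported backwards along a path: for
each time the path runs through the link, `±` the vector `w` transported to `c`, the sign telling in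
which direction the link is traversed. -/
def linkTerm (h : L → Mat) (l : L) : List (L × Bool) → R4 → R4
  | [], _ => 0
  | (m, true) :: p, w => (if m = l then h m *ᵥ (hol h p *ᵥ w) else 0) + linkTerm h l p w
  | (m, false) :: p, w => (if m = l then -(hol h p *ᵥ w) else 0) + linkTerm h l p w

/-- The triangle variable `b_{(cc')*} = ∫_{(cc')*} b̃_c^{c'}`: the integral over the triangle, and
the integrals over edges that come from the transport of the `ς`'s through the link `(cc')`. -/
def bVar (T : Triangulation V C L Ed) (K : Choice T) (Φ : Fields V C L) (l : L) : Mat :=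
  bulk T Φ l + ∑ e, ∑ m, eps T e m •
    edgeBrk T Φ e (T.src l) fun x => linkTerm Φ.h l (K.path e m) (Φ.ς m x)

/-! ## Variations and the symplectic potential -/

/-- A smooth one-parameter family of on-shell configurations. Its velocity at parameter `0` is the
variation `δ`. At the edges, where `g_c` may be singular, `Δg_c = δg_c g_c⁻¹` has to stay bounded
and `δA_c` has to be integrable. -/
structure IsVariation (T : Triangulation V C L Ed) (Φ : ℝ → Fields V C L) : Prop where
  config : ∀ t, IsConfig T (Φ t)
  g_smooth : ∀ c t, ∀ x ∈ regCell (T.tet c),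
    ContDiffAt ℝ ∞ (fun q : ℝ × (V → ℝ) => (Φ q.1).g c q.2) (t, x)
  c_smooth : ∀ c, ContDiff ℝ ∞ (fun q : ℝ × (V → ℝ) => (Φ q.1).c c q.2)
  σ_smooth : ∀ c u, ContDiff ℝ ∞ (fun q : ℝ × (V → ℝ) => (Φ q.1).σ c q.2 u)
  b_smooth : ∀ c u, ContDiff ℝ ∞ (fun q : ℝ × (V → ℝ) => (Φ q.1).b c q.2 u)
  h_smooth : ∀ l, ContDiff ℝ ∞ (fun t => (Φ t).h l)
  x_smooth : ∀ l, ContDiff ℝ ∞ (fun t => (Φ t).x l)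
  ς_smooth : ∀ l, ContDiff ℝ ∞ (fun q : ℝ × (V → ℝ) => (Φ q.1).ς l q.2)
  y_smooth : ∀ l, ContDiff ℝ ∞ (fun q : ℝ × (V → ℝ) => (Φ q.1).y l q.2)
  Δg_bounded : ∀ c, ∃ R : ℝ, ∀ x ∈ regCell (T.tet c),
    ‖vary (fun t => (Φ t).g c x) * ((Φ 0).g c x)ᵀ‖ ≤ R
  δA_integrable : ∀ c u, IsTangent (T.tet c) u → ∀ i j, IntegrableOn
    (fun s => vary (fun t => (Φ t).A c (simplexMap (pts (T.tet c)) s) u) i j) (stdDomain 3)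

/-- `δA_c`. -/
def δA (Φ : ℝ → Fields V C L) (c : C) (x u : V → ℝ) : Mat := vary (fun t => (Φ t).A c x u)

/-- `δΣ_c`. -/
def δSig (Φ : ℝ → Fields V C L) (c : C) (x u v : V → ℝ) : R4 :=
  vary (fun t => (Φ t).Sig c x u v)

/-- The `3`-form `⟨B_c ∧ δA_c⟩ - ⟨C_c ∧ δΣ_c⟩`. -/
def potentialForm (Φ : ℝ → Fields V C L) (c : C) (x u v w : V → ℝ) : ℝ :=
  (pairing ((Φ 0).B c x u v) (δA Φ c x w) + pairing ((Φ 0).B c x v w) (δA Φ c x u)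
      + pairing ((Φ 0).B c x w u) (δA Φ c x v))
    - ((Φ 0).Ctr c x u ⬝ᵥ δSig Φ c x v w + (Φ 0).Ctr c x v ⬝ᵥ δSig Φ c x w u
      + (Φ 0).Ctr c x w ⬝ᵥ δSig Φ c x u v)

/-- The on-shell symplectic potential `Θ_BFCG = ∫_M (⟨B ∧ δA⟩ - ⟨C ∧ δΣ⟩)`, evaluated on `δ`. -/
def ThetaBFCG (T : Triangulation V C L Ed) (Φ : ℝ → Fields V C L) : ℝ :=
  ∑ c, T.tetInt c (potentialForm Φ c)

/-- The discrete potential `∑_{(cc')} ⟨b_{(cc')*}, Δh⟩ + ∑_e ⟨ℓ_e, δV_{e*}⟩`, `Δh = δh h⁻¹`. -/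
def discretePotential (h b : L → Mat) (ℓ : Ed → R4) (δh : L → Mat) (δV : Ed → R4) : ℝ :=
  ∑ l, pairing (b l) (δh l * (h l)ᵀ) + ∑ e, ℓ e ⬝ᵥ δV e

end Discretization

/-! ## The discrete phase space (the phase space of `G`-networks) -/

section PhaseSpace

variable {L Ed : Type*} [Fintype L] [Fintype Ed]

variable (L Ed) in
/-- The ambient vector space of the variables `(h, b, ℓ, V)`. -/
abbrev Ambient : Type _ := (L → Mat) × (L → Mat) × (Ed → R4) × (Ed → R4)

/-- The points of the phase space: `h_l ∈ SO(4)` on links, `b_l ∈ so(4)*` on triangles, `ℓ_e ∈ ℝ⁴`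
on edges, `V_e ∈ ℝ⁴*` on dual faces. -/
def InPhase (z : Ambient L Ed) : Prop := (∀ l, IsSO (z.1 l)) ∧ ∀ l, IsSkew (z.2.1 l)

/-- The tangent vectors of the phase space at `z`. -/
def IsTangentPhase (z w : Ambient L Ed) : Prop :=
  (∀ l, IsSkew (w.1 l * (z.1 l)ᵀ)) ∧ ∀ l, IsSkew (w.2.1 l)

/-- The symplectic form `ω = δΘ` of the discrete potential `Θ`. -/
def omega (z w w' : Ambient L Ed) : ℝ :=
  extD (fun y v => discretePotential y.1 y.2.1 y.2.2.1 v.1 v.2.2.2) z w w'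

/-- `X` is the Hamiltonian vector of `f` at `z`: `ω(X, ·) = df`. -/
def IsHamiltonian (z : Ambient L Ed) (f : Ambient L Ed → ℝ) (X : Ambient L Ed) : Prop :=
  IsTangentPhase z X ∧ ∀ w, IsTangentPhase z w → omega z X w = D f z w

/-- `{f, f'} = r` at `z`, where `{f, f'} = df'(X_f)`, so that `{q, p} = 1` for `Θ = p δq`. -/
def HasPoisson (z : Ambient L Ed) (f f' : Ambient L Ed → ℝ) (r : ℝ) : Prop :=
  ∃ X, IsHamiltonian z f X ∧ (∀ X', IsHamiltonian z f X' → X' = X) ∧ D f' z X = r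

/-- The coordinate `h^α_β` of the link `l`. -/
def hFun (l : L) (α β : Fin 4) (z : Ambient L Ed) : ℝ := z.1 l α β

/-- The coordinate `b^{σρ} = ⟨b, J^{σρ}⟩` of the triangle dual to `l`. -/
def bFun (l : L) (σ ρ : Fin 4) (z : Ambient L Ed) : ℝ := pairing (z.2.1 l) (J σ ρ)

/-- The coordinate `ℓ_α` of the edge `e`. -/
def ellFun (e : Ed) (α : Fin 4) (z : Ambient L Ed) : ℝ := z.2.2.1 e α

/-- The coordinate `V^β` of the dual face `e*`. -/
def VFun (e : Ed) (β : Fin 4) (z : Ambient L Ed) : ℝ := z.2.2.2 e β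

end PhaseSpace

/-! ## The boundary of the `4`-simplex -/

/-- The ten ordered pairs that label the links `(ij)` and also the edges `[i̅j̅]` of the boundary of
the `4`-simplex. Nodes and vertices are labelled by `1, 2, 3, 4, 5`, as elements of `Fin 5` (where
`5 = 0`); the tetrahedron dual to the node `i` has all vertices except `i`. -/
inductive Arc : Type
  | a12 | a23 | a34 | a45 | a51 | a14 | a42 | a25 | a53 | a31
  deriving DecidableEq

namespace Arc

instance : Fintype Arc where
  elems := {a12, a23, a34, a45, a51, a14, a42, a25, a53, a31}
  complete := by intro a; cases a <;> decide

def fst : Arc → Fin 5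
  | a12 => 1 | a23 => 2 | a34 => 3 | a45 => 4 | a51 => 5
  | a14 => 1 | a42 => 4 | a25 => 2 | a53 => 5 | a31 => 3

def snd : Arc → Fin 5
  | a12 => 2 | a23 => 3 | a34 => 4 | a45 => 5 | a51 => 1
  | a14 => 4 | a42 => 2 | a25 => 5 | a53 => 3 | a31 => 1

/-- The oriented triangle dual to the link. -/
def tri : Arc → Fin 3 → Fin 5
  | a12 => ![3, 4, 5] | a23 => ![1, 4, 5] | a34 => ![1, 2, 5] | a45 => ![1, 2, 3]
  | a51 => ![2, 3, 4] | a14 => ![2, 3, 5] | a42 => ![1, 3, 5] | a25 => ![1, 3, 4]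
  | a53 => ![1, 2, 4] | a31 => ![2, 4, 5]

/-- The node at which the variables of the edge are based. -/
def base : Arc → Fin 5
  | a12 => 3 | a23 => 1 | a34 => 1 | a45 => 1 | a51 => 2
  | a14 => 2 | a42 => 3 | a25 => 1 | a53 => 1 | a31 => 2

/-- The path that consists of the link joining two nodes (empty if they coincide). -/
def direct (i j : Fin 5) : List (Arc × Bool) :=
  [a12, a23, a34, a45, a51, a14, a42, a25, a53, a31].filterMap fun a =>
    if a.fst = i ∧ a.snd = j then some (a, true)
    else if a.snd = i ∧ a.fst = j then some (a, false) else none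

end Arc

instance decidableIsPathWith {C L : Type*} [DecidableEq C] (src tgt : L → C) (ok : L → Prop)
    [DecidablePred ok] : ∀ (a : C) (p : List (L × Bool)) (b : C),
    Decidable (IsPathWith src tgt ok a p b)
  | a, [], b => inferInstanceAs (Decidable (a = b))
  | a, (l, true) :: p, b =>
    haveI := decidableIsPathWith src tgt ok (tgt l) p b
    inferInstanceAs (Decidable (ok l ∧ src l = a ∧ IsPathWith src tgt ok (tgt l) p b))
  | a, (l, false) :: p, b =>
    haveI := decidableIsPathWith src tgt ok (src l) p b
    inferInstanceAs (Decidable (ok l ∧ tgt l = a ∧ IsPathWith src tgt ok (src l) p b))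

lemma det_three_eq (M : Matrix (Fin 3) (Fin 3) ℤ) : M.det =
    M 0 0 * M 1 1 * M 2 2 - M 0 0 * M 1 2 * M 2 1 - M 0 1 * M 1 0 * M 2 2
      + M 0 1 * M 1 2 * M 2 0 + M 0 2 * M 1 0 * M 2 1 - M 0 2 * M 1 1 * M 2 0 :=
  Matrix.det_fin_three M

/-- The boundary of the `4`-simplex, the tetrahedron `i*` being `[i+1, i+2, i+3, i+4]` (mod `5`). -/
def simplexBdry : Triangulation (Fin 5) (Fin 5) Arc Arc where
  tet i := ![i + 1, i + 2, i + 3, i + 4]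
  tri := Arc.tri
  edge a := ![a.fst, a.snd]
  src := Arc.fst
  tgt := Arc.snd
  tet_injective := by decide
  tri_injective := by decide
  edge_injective := by decide
  tet_ext := by decide
  tri_ext := by decide
  edge_ext := by decide
  face_mem := by decide
  side_mem := by decide
  edge_mem := by decide
  src_ne_tgt := by decide
  incidence_eq := by
    simp only [incidence, orient, det_three_eq]
    decide
  dual_connected := by
    have h : ∀ (e : Arc) (c c' : Fin 5), verts ![e.fst, e.snd] ⊆ verts ![c + 1, c + 2, c + 3, c + 4]
        → verts ![e.fst, e.snd] ⊆ verts ![c' + 1, c' + 2, c' + 3, c' + 4] →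
        IsPathWith Arc.fst Arc.snd (fun l => verts ![e.fst, e.snd] ⊆ verts (Arc.tri l)) c
          (Arc.direct c c') c' := by
      decide
    exact fun e c c' h₁ h₂ => ⟨_, h e c c' h₁ h₂⟩

/-- The base points `Arc.base`, and transport along the direct links. -/
def simplexChoice : Choice simplexBdry where
  base := Arc.base
  path e l := Arc.direct e.base l.fst
  base_mem := by decide
  isPath := by
    have h : ∀ (e l : Arc), verts ![e.fst, e.snd] ⊆ verts (Arc.tri l) →
        IsPathWith Arc.fst Arc.snd (fun l => verts ![e.fst, e.snd] ⊆ verts (Arc.tri l)) e.base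
          (Arc.direct e.base l.fst) l.fst := by
      decide
    exact h

/-! ## Explicit formulas and constraints for the boundary of the `4`-simplex -/

namespace Simplex

open Arc

/-- Configurations on the boundary of the `4`-simplex. -/
abbrev Conf : Type := Fields (Fin 5) (Fin 5) Arc

/-- The holonomy `h_{ij}` of the link joining the nodes `i` and `j`. -/
def H (Φ : Conf) (i j : Fin 5) : Mat := hol Φ.h (direct i j)

/-- `ℓ_e`, based at the node `e.base`. -/
def ell (Φ : Conf) (e : Arc) : R4 := ellVar simplexBdry simplexChoice Φ e

/-- `V_{e*}`, based at the node `e.base`. -/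
def Vf (Φ : Conf) (e : Arc) : R4 := faceVar simplexBdry simplexChoice Φ e

/-- `b_{(cc')*}`. -/
def bt (Φ : Conf) (l : Arc) : Mat := bVar simplexBdry simplexChoice Φ l

/-- `h_{ij} b h_{ji}`, for `b ∈ so(4)*`. -/
def conj (Φ : Conf) (i j : Fin 5) (b : Mat) : Mat := H Φ i j * b * (H Φ i j)ᵀ

/-- `∫_e [dc_i, w]`. -/
def eInt (Φ : Conf) (e : Arc) (i : Fin 5) (w : (Fin 5 → ℝ) → R4) : Mat :=
  edgeBrk simplexBdry Φ e i w

/-- The dual face variables as combinations of the `ς`'s, at every point of the edge. -/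
structure FaceFormulas (Φ : Conf) : Prop where
  V12 : ∀ x ∈ cell (simplexBdry.edge a12), Vf Φ a12 =
    Φ.ς a34 x + (H Φ 3 4 *ᵥ Φ.ς a45 x) + (H Φ 3 5 *ᵥ Φ.ς a53 x)
  V31 : ∀ x ∈ cell (simplexBdry.edge a31), Vf Φ a31 =
    -(H Φ 2 4 *ᵥ Φ.ς a42 x) + (H Φ 2 4 *ᵥ Φ.ς a45 x) - Φ.ς a25 x
  V14 : ∀ x ∈ cell (simplexBdry.edge a14), Vf Φ a14 =
    Φ.ς a23 x - Φ.ς a25 x - (H Φ 2 5 *ᵥ Φ.ς a53 x)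
  V51 : ∀ x ∈ cell (simplexBdry.edge a51), Vf Φ a51 =
    (H Φ 2 4 *ᵥ Φ.ς a42 x) + (H Φ 2 3 *ᵥ Φ.ς a34 x) + Φ.ς a23 x
  V23 : ∀ x ∈ cell (simplexBdry.edge a23), Vf Φ a23 =
    (H Φ 1 4 *ᵥ Φ.ς a45 x) + (H Φ 1 5 *ᵥ Φ.ς a51 x) + Φ.ς a14 x
  V42 : ∀ x ∈ cell (simplexBdry.edge a42), Vf Φ a42 =
    -(H Φ 3 5 *ᵥ Φ.ς a53 x) - Φ.ς a31 x + (H Φ 3 5 *ᵥ Φ.ς a51 x)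
  V25 : ∀ x ∈ cell (simplexBdry.edge a25), Vf Φ a25 =
    (H Φ 1 3 *ᵥ Φ.ς a34 x) - (H Φ 1 3 *ᵥ Φ.ς a31 x) - Φ.ς a14 x
  V34 : ∀ x ∈ cell (simplexBdry.edge a34), Vf Φ a34 =
    Φ.ς a12 x + (H Φ 1 5 *ᵥ Φ.ς a51 x) + (H Φ 1 2 *ᵥ Φ.ς a25 x)
  V53 : ∀ x ∈ cell (simplexBdry.edge a53), Vf Φ a53 =
    -(H Φ 1 4 *ᵥ Φ.ς a42 x) - Φ.ς a14 x + Φ.ς a12 x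
  V45 : ∀ x ∈ cell (simplexBdry.edge a45), Vf Φ a45 =
    Φ.ς a12 x + (H Φ 1 2 *ᵥ Φ.ς a23 x) + (H Φ 1 3 *ᵥ Φ.ς a31 x)

/-- The triangle variables; `bulk` is `∫_{(ij)*} (db_i - d[c_i, σ_i] - [dc_i ∧ dς_i^j])`. -/
structure TriangleFormulas (Φ : Conf) : Prop where
  b12 : bt Φ a12 = bulk simplexBdry Φ a12
      + eInt Φ a45 1 (fun x => H Φ 1 2 *ᵥ Φ.ς a23 x)
      + eInt Φ a34 1 (fun x => H Φ 1 2 *ᵥ Φ.ς a25 x)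
  b23 : bt Φ a23 = bulk simplexBdry Φ a23
      + eInt Φ a51 2 (fun x => H Φ 2 3 *ᵥ Φ.ς a34 x)
  b34 : bt Φ a34 = bulk simplexBdry Φ a34
      + eInt Φ a12 3 (fun x => H Φ 3 4 *ᵥ Φ.ς a45 x)
  b45 : bt Φ a45 = bulk simplexBdry Φ a45
  b51 : bt Φ a51 = bulk simplexBdry Φ a51
      - eInt Φ a34 5 (fun x => Φ.ς a51 x)
      - eInt Φ a23 5 (fun x => Φ.ς a51 x)
  b14 : bt Φ a14 = bulk simplexBdry Φ a14
      + eInt Φ a23 1 (fun x => H Φ 1 4 *ᵥ Φ.ς a45 x)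
      - eInt Φ a53 1 (fun x => H Φ 1 4 *ᵥ Φ.ς a42 x)
  b25 : bt Φ a25 = bulk simplexBdry Φ a25
      - eInt Φ a14 2 (fun x => H Φ 2 5 *ᵥ Φ.ς a53 x)
  b31 : bt Φ a31 = bulk simplexBdry Φ a31
      + eInt Φ a25 3 (fun x => Φ.ς a31 x)
      - eInt Φ a25 3 (fun x => Φ.ς a34 x)
      - eInt Φ a45 3 (fun x => Φ.ς a31 x)
  b42 : bt Φ a42 = bulk simplexBdry Φ a42
      - eInt Φ a51 4 (fun x => Φ.ς a42 x)
      - eInt Φ a31 4 (fun x => Φ.ς a45 x)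
      + eInt Φ a31 4 (fun x => Φ.ς a42 x)
  b53 : bt Φ a53 = bulk simplexBdry Φ a53
      - eInt Φ a42 5 (fun x => Φ.ς a51 x)
      + eInt Φ a42 5 (fun x => Φ.ς a53 x)
      - eInt Φ a12 5 (fun x => Φ.ς a53 x)

/-- The `2`-Gauss constraints: triangles close. -/
structure TwoGauss (Φ : Conf) : Prop where
  G123 : (H Φ 4 3 *ᵥ ell Φ a12) + (H Φ 4 1 *ᵥ ell Φ a23) + (H Φ 4 2 *ᵥ ell Φ a31) = 0
  G124 : (H Φ 5 3 *ᵥ ell Φ a12) - (H Φ 5 3 *ᵥ ell Φ a42) - (H Φ 5 2 *ᵥ ell Φ a14) = 0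
  G125 : ell Φ a12 + (H Φ 3 1 *ᵥ ell Φ a25) + (H Φ 3 2 *ᵥ ell Φ a51) = 0
  G134 : -ell Φ a31 - ell Φ a14 + (H Φ 2 1 *ᵥ ell Φ a34) = 0
  G135 : -(H Φ 4 2 *ᵥ ell Φ a31) - (H Φ 4 1 *ᵥ ell Φ a53) + (H Φ 4 2 *ᵥ ell Φ a51) = 0
  G145 : ell Φ a14 + (H Φ 2 1 *ᵥ ell Φ a45) + ell Φ a51 = 0
  G234 : (H Φ 5 1 *ᵥ ell Φ a23) + (H Φ 5 3 *ᵥ ell Φ a42) + (H Φ 5 1 *ᵥ ell Φ a34) = 0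
  G235 : ell Φ a23 - ell Φ a53 - ell Φ a25 = 0
  G245 : -(H Φ 3 1 *ᵥ ell Φ a25) - ell Φ a42 + (H Φ 3 1 *ᵥ ell Φ a45) = 0
  G345 : ell Φ a34 + ell Φ a45 + ell Φ a53 = 0

/-- `1`-flatness around the edge `e`: closed paths around `e` have trivial holonomy. -/
def Flat (Φ : Conf) (e : Arc) : Prop :=
  ∀ c p, simplexBdry.IsPath e c p c → hol Φ.h p = 1

/-- The `2`-flatness constraints: the polyhedron dual to the vertex `v` closes if there is no
curvature on the edges that meet at `v`. -/
structure TwoFlatness (Φ : Conf) : Prop where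
  P1 : (∀ e : Arc, e.fst = 1 ∨ e.snd = 1 → Flat Φ e) →
    (H Φ 2 3 *ᵥ Vf Φ a12) + Vf Φ a14 - Vf Φ a31 - Vf Φ a51 = 0
  P2 : (∀ e : Arc, e.fst = 2 ∨ e.snd = 2 → Flat Φ e) →
    Vf Φ a23 + Vf Φ a25 - (H Φ 1 3 *ᵥ Vf Φ a12) - (H Φ 1 3 *ᵥ Vf Φ a42) = 0
  P3 : (∀ e : Arc, e.fst = 3 ∨ e.snd = 3 → Flat Φ e) →
    (H Φ 1 2 *ᵥ Vf Φ a31) + Vf Φ a34 - Vf Φ a53 - Vf Φ a23 = 0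
  P4 : (∀ e : Arc, e.fst = 4 ∨ e.snd = 4 → Flat Φ e) →
    Vf Φ a45 + (H Φ 1 3 *ᵥ Vf Φ a42) - (H Φ 1 2 *ᵥ Vf Φ a14) - Vf Φ a34 = 0
  P5 : (∀ e : Arc, e.fst = 5 ∨ e.snd = 5 → Flat Φ e) →
    Vf Φ a53 + (H Φ 1 2 *ᵥ Vf Φ a51) - Vf Φ a45 - Vf Φ a25 = 0

/-- The modified `1`-Gauss constraints of the tetrahedra. -/
structure OneGauss (Φ : Conf) : Prop where
  T1 : bt Φ a12 + bt Φ a14 - conj Φ 1 3 (bt Φ a31) - conj Φ 1 5 (bt Φ a51)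
      - brk (ell Φ a45) (Vf Φ a45)
      - brk (ell Φ a23) (Vf Φ a23)
      - brk (ell Φ a53) (Vf Φ a53)
      - brk (ell Φ a34) (Vf Φ a34)
      - brk (ell Φ a25) (Vf Φ a25) = 0
  T2 : bt Φ a23 + bt Φ a25 - conj Φ 2 4 (bt Φ a42) - conj Φ 2 1 (bt Φ a12)
      - brk (ell Φ a14) (Vf Φ a14)
      - brk (ell Φ a31) (Vf Φ a31)
      - brk (ell Φ a51) (Vf Φ a51) = 0
  T3 : bt Φ a34 + bt Φ a31 - conj Φ 3 2 (bt Φ a23) - conj Φ 3 5 (bt Φ a53)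
      - brk (ell Φ a12) (Vf Φ a12)
      - brk (ell Φ a42) (Vf Φ a42) = 0
  T4 : bt Φ a45 + bt Φ a42 - conj Φ 4 1 (bt Φ a14) - conj Φ 4 3 (bt Φ a34) = 0
  T5 : bt Φ a51 + bt Φ a53 - conj Φ 5 4 (bt Φ a45) - conj Φ 5 2 (bt Φ a25) = 0

end Simplex

end BFCG

/-! The potential. Inside each tetrahedron the integrand is exact. Write Δg = δg g⁻¹.
Differentiating g gᵀ = 1 gives g δA g⁻¹ = dΔg, and rotating δΣ by g gives dδσ - Δg·dσ. Since ddb =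
ddσ = 0, the integrand is the exterior derivative of ⟨db - [c, dσ], Δg⟩ + dc ∧ δσ (`primitive`,
`potentialForm_eq`).

Stokes' theorem for the tetrahedron (`simplexIntegral_extD2`) tolerates the singularity of g on the
edges. It is proved by Fubini along segments parallel to a side, almost all of which miss the edges;
the primitive stays bounded there, and its derivatives are integrable because δA is. After summation
over the tetrahedra every triangle carries the jump of the primitive (`sum_tetInt_eq`). By the
continuity relations this jump is ⟨db - d[c, σ] - [dc ∧ dς], Δh⟩ + d(dc·δς) (`primitive_sub`): the
first term is the bulk part of the triangle variable, and the second moves to the edges by Stokes'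
theorem.

Along an edge the terms dc·δς are collected at the base node. As dc is transported by the holonomy h
of the path, dc·δς = dc_base·(δ(hς) - δh ς). The terms δ(hς) add up to ⟨ℓ, δV⟩ because V is constant
along the edge. The Leibniz rule expands δh into one Δh for each link of the path, and these are
exactly the edge corrections in the triangle variables (`sum_pairing_linkTerm`, `sum_edgeInt`).

Constancy of V (`D_faceSum`). The continuity of σ turns each dς into a difference of σ at two
neighbouring nodes. Invariance under the holonomy makes the transport of σ to the base independent
of the path, so the sum can be regrouped by nodes, where the coefficient is that of e in the
boundary of the boundary of a tetrahedron, which is zero.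

The 1-Gauss constraint (`sum_nodeMap_bVar`). Seen from the target, a bulk term is the integral of
d(b - [c, σ]); seen from the source, it has the additional term d[dc, ς]. The closed surface of the
tetrahedron kills the common part, the additional terms become edge integrals, and the transport
corrections telescope along their paths. Only the edges based at the node survive, each with [ℓ, V].

The remaining parts are algebraic. The brackets follow from explicit Hamiltonian vectors, which are
unique by `omega_nondegenerate`. On the boundary of the 4-simplex the incidence numbers are
computed, and the constraints reduce to evaluation at a common node or vertex. The dependence of the
triangle variable on the fields is shown on configurations with trivial holonomies, where it is
computed in closed form. -/

set_option linter.unusedSectionVars false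

namespace BFCG

/-! ## Integrals over simplices -/

section Simplices

variable {E F : Type*} [NormedAddCommGroup E] [NormedSpace ℝ E]
  [NormedAddCommGroup F] [NormedSpace ℝ F]

/-- The barycentric coordinates of a point of the standard simplex. -/
def bary {n : ℕ} (s : Fin n → ℝ) : Fin (n + 1) → ℝ := Fin.cons (1 - ∑ i, s i) s

@[simp] lemma bary_zero {n : ℕ} (s : Fin n → ℝ) : bary s 0 = 1 - ∑ i, s i := rfl

@[simp] lemma bary_succ {n : ℕ} (s : Fin n → ℝ) (i : Fin n) : bary s i.succ = s i := rfl

lemma sum_bary {n : ℕ} (s : Fin n → ℝ) : ∑ i, bary s i = 1 := by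
  simp [Fin.sum_univ_succ]

lemma simplexMap_eq_sum_bary {n : ℕ} (p : Fin (n + 1) → E) (s : Fin n → ℝ) :
    simplexMap p s = ∑ i, bary s i • p i := by
  simp only [simplexMap, Fin.sum_univ_succ, bary_zero, bary_succ, smul_sub, Finset.sum_sub_distrib,
    sub_smul, one_smul, Finset.sum_smul]
  abel

lemma mem_stdDomain_iff {n : ℕ} (s : Fin n → ℝ) : s ∈ stdDomain n ↔ ∀ i, 0 ≤ bary s i := by
  simp [stdDomain, Fin.forall_fin_succ, and_comm]

/-- The interior of the standard simplex. -/
def openDomain (n : ℕ) : Set (Fin n → ℝ) := {s | (∀ i, 0 < s i) ∧ ∑ i, s i < 1}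

lemma mem_openDomain_iff {n : ℕ} (s : Fin n → ℝ) : s ∈ openDomain n ↔ ∀ i, 0 < bary s i := by
  simp [openDomain, Fin.forall_fin_succ, and_comm]

lemma isOpen_openDomain (n : ℕ) : IsOpen (openDomain n) := by
  simp only [openDomain, Set.ofPred_and, Set.ofPred_forall]
  refine (isOpen_iInter_of_finite fun i => ?_).inter ?_
  · exact isOpen_lt continuous_const (continuous_apply i)
  · exact isOpen_lt (by fun_prop) continuous_const

lemma isClosed_stdDomain (n : ℕ) : IsClosed (stdDomain n) := by
  simp only [stdDomain, Set.ofPred_and, Set.ofPred_forall]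
  refine (isClosed_iInter fun i => ?_).inter ?_
  · exact isClosed_le continuous_const (continuous_apply i)
  · exact isClosed_le (by fun_prop) continuous_const

lemma openDomain_subset (n : ℕ) : openDomain n ⊆ stdDomain n :=
  fun _ hs => ⟨fun i => (hs.1 i).le, hs.2.le⟩

lemma isBounded_stdDomain (n : ℕ) : Bornology.IsBounded (stdDomain n) := by
  refine (Metric.isBounded_Icc (0 : Fin n → ℝ) 1).subset fun s hs => ⟨fun i => hs.1 i, fun i => ?_⟩
  exact (Finset.single_le_sum (fun j _ => hs.1 j) (Finset.mem_univ i)).trans hs.2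

lemma isCompact_stdDomain (n : ℕ) : IsCompact (stdDomain n) :=
  Metric.isCompact_of_isClosed_isBounded (isClosed_stdDomain n) (isBounded_stdDomain n)

lemma convex_openDomain (n : ℕ) : Convex ℝ (openDomain n) := by
  intro s hs t ht a b ha hb hab
  rw [mem_openDomain_iff] at *
  intro i
  have h : bary (a • s + b • t) i = a * bary s i + b * bary t i := by
    refine Fin.cases ?_ (fun j => ?_) i
    · simp only [bary_zero, Pi.add_apply, Pi.smul_apply, smul_eq_mul, Finset.sum_add_distrib,
        ← Finset.mul_sum]
      linear_combination (-1 : ℝ) * hab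
    · simp
  rw [h]
  rcases ha.eq_or_lt with rfl | ha
  · have : b = 1 := by linarith
    simpa [this] using ht i
  · have := mul_pos ha (hs i)
    have := mul_nonneg hb (ht i).le
    linarith

/-- Moving any point of the simplex slightly towards the barycentre makes all barycentric
coordinates positive. -/
lemma stdDomain_subset_closure (n : ℕ) : stdDomain n ⊆ closure (openDomain n) := by
  intro s hs
  let f : ℝ → Fin n → ℝ := fun r i => (1 - r) * s i + r * (1 / (n + 1))
  have hf : Continuous f := by fun_prop
  have h0 : f 0 = s := by ext; simp [f]
  have hev : ∀ᶠ r in nhdsWithin (0 : ℝ) (Set.Ioi 0), f r ∈ openDomain n := by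
    filter_upwards [Ioo_mem_nhdsGT (show (0 : ℝ) < 1 by norm_num)] with r hr
    have hn : (0 : ℝ) < n + 1 := by positivity
    refine ⟨fun i => ?_, ?_⟩
    · have h1 := mul_nonneg (sub_nonneg.2 hr.2.le) (hs.1 i)
      have h2 : 0 < r * (1 / ((n : ℝ) + 1)) := mul_pos hr.1 (by positivity)
      simp only [f]; linarith
    · simp only [f, Finset.sum_add_distrib, ← Finset.mul_sum, Finset.sum_const, Finset.card_univ,
        Fintype.card_fin, nsmul_eq_mul]
      have h1 := mul_le_mul_of_nonneg_left hs.2 (sub_nonneg.2 hr.2.le)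
      have h2 : (n : ℝ) * (r * (1 / (n + 1))) < r := by
        rw [mul_left_comm]
        have : (n : ℝ) * (1 / (n + 1)) < 1 := by
          rw [mul_one_div, div_lt_one hn]; linarith
        nlinarith [hr.1]
      have h3 : ∀ x : ℝ, (n : ℝ) * (r * x) = r * (n * x) := fun x => by ring
      linarith
  have ht : Filter.Tendsto f (nhdsWithin 0 (Set.Ioi 0)) (nhds s) := by
    have := hf.tendsto 0
    rw [h0] at this
    exact this.mono_left nhdsWithin_le_nhds
  exact mem_closure_of_tendsto ht hev

/-- The frontier of a convex set is Lebesgue null. Hence all later integrals see only interior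
points, where the hypotheses on open cells apply. -/
lemma openDomain_ae_eq (n : ℕ) : openDomain n =ᵐ[volume] stdDomain n := by
  refine (openDomain_subset n).eventuallyLE.antisymm ?_
  rw [ae_le_set]
  refine measure_mono_null ?_ ((convex_openDomain n).addHaar_frontier volume)
  intro s hs
  rw [frontier, (isOpen_openDomain n).interior_eq]
  exact ⟨stdDomain_subset_closure n hs.1, hs.2⟩

lemma measurableSet_stdDomain (n : ℕ) : MeasurableSet (stdDomain n) :=
  (isClosed_stdDomain n).measurableSet

lemma measurableSet_openDomain (n : ℕ) : MeasurableSet (openDomain n) :=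
  (isOpen_openDomain n).measurableSet

lemma volume_stdDomain_lt_top (n : ℕ) : volume (stdDomain n) < ⊤ :=
  (isBounded_stdDomain n).measure_lt_top

lemma restrict_openDomain (n : ℕ) :
    (volume.restrict (openDomain n) : Measure (Fin n → ℝ)) = volume.restrict (stdDomain n) :=
  Measure.restrict_congr_set (openDomain_ae_eq n)

lemma ae_stdDomain_of_openDomain {n : ℕ} {P : (Fin n → ℝ) → Prop} (h : ∀ s ∈ openDomain n, P s) :
    ∀ᵐ s ∂volume.restrict (stdDomain n), P s := by
  rw [← restrict_openDomain]
  exact (ae_restrict_iff' (measurableSet_openDomain n)).2 (.of_forall h)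

lemma setIntegral_stdDomain_congr {n : ℕ} {f f' : (Fin n → ℝ) → F}
    (h : ∀ s ∈ openDomain n, f s = f' s) : ∫ s in stdDomain n, f s = ∫ s in stdDomain n, f' s :=
  integral_congr_ae (ae_stdDomain_of_openDomain h)

/-- A bounded function that is continuous in the interior of the simplex is integrable. -/
lemma integrableOn_stdDomain_of_bounded {n : ℕ} {f : (Fin n → ℝ) → F}
    (hf : ContinuousOn f (openDomain n)) {R : ℝ} (hR : ∀ s ∈ openDomain n, ‖f s‖ ≤ R) :
    IntegrableOn f (stdDomain n) := by
  have hm : AEStronglyMeasurable f (volume.restrict (stdDomain n)) := by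
    rw [← restrict_openDomain]
    exact hf.aestronglyMeasurable (measurableSet_openDomain n)
  have : IsFiniteMeasure (volume.restrict (stdDomain n)) :=
    ⟨by simpa using volume_stdDomain_lt_top n⟩
  exact Integrable.of_bound hm R (ae_stdDomain_of_openDomain hR)

lemma integrableOn_stdDomain_of_continuous {n : ℕ} {f : (Fin n → ℝ) → F} (hf : Continuous f) :
    IntegrableOn f (stdDomain n) :=
  hf.continuousOn.integrableOn_compact (isCompact_stdDomain n)

/-! ### Permutations of the vertices -/

/-- The linear map of `ℝⁿ` that permutes the barycentric coordinates of vectors. -/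
def permLin {n : ℕ} (π : Equiv.Perm (Fin (n + 1))) : (Fin n → ℝ) →ₗ[ℝ] (Fin n → ℝ) where
  toFun v i := (Fin.cons (-∑ j, v j) v : Fin (n + 1) → ℝ) (π i.succ)
  map_add' v w := by
    ext i
    simp only [Pi.add_apply]
    refine Fin.cases ?_ (fun j => ?_) (π i.succ)
    · simp [Finset.sum_add_distrib, add_comm]
    · simp
  map_smul' a v := by
    ext i
    simp only [Pi.smul_apply, smul_eq_mul, RingHom.id_apply]
    refine Fin.cases ?_ (fun j => ?_) (π i.succ)
    · simp [Finset.mul_sum]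
    · simp

lemma cons_permLin {n : ℕ} (π : Equiv.Perm (Fin (n + 1))) (v : Fin n → ℝ) (j : Fin (n + 1)) :
    (Fin.cons (-∑ i, permLin π v i) (permLin π v) : Fin (n + 1) → ℝ) j =
      (Fin.cons (-∑ i, v i) v : Fin (n + 1) → ℝ) (π j) := by
  refine Fin.cases ?_ (fun j => rfl) j
  have h := Equiv.sum_comp π (Fin.cons (-∑ i, v i) v : Fin (n + 1) → ℝ)
  rw [Fin.sum_univ_succ, Fin.sum_univ_succ] at h
  simp only [Fin.cons_zero, Fin.cons_succ, neg_add_cancel] at h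
  simp only [Fin.cons_zero]
  have : ∑ i, permLin π v i = ∑ i : Fin n, (Fin.cons (-∑ i, v i) v : Fin (n + 1) → ℝ) (π i.succ) :=
    rfl
  rw [this]; linarith

/-- The order is reversed because permutations act on coordinates by precomposition. -/
lemma permLin_mul {n : ℕ} (π τ : Equiv.Perm (Fin (n + 1))) :
    permLin (τ * π) = permLin π * permLin τ := by
  ext1 v
  ext i
  exact (cons_permLin τ _ (π i.succ)).symm

lemma permLin_one {n : ℕ} : permLin (1 : Equiv.Perm (Fin (n + 1))) = 1 := by
  refine LinearMap.ext fun v => ?_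
  ext i
  rfl

/-- A permutation has finite order, so the determinant is a real root of unity. -/
lemma abs_det_permLin {n : ℕ} (π : Equiv.Perm (Fin (n + 1))) : |LinearMap.det (permLin π)| = 1 := by
  have hpow : ∀ k : ℕ, permLin π ^ k = permLin (π ^ k) := by
    intro k
    induction k with
    | zero => rw [pow_zero, pow_zero, permLin_one]
    | succ k ih => rw [pow_succ, ih, pow_succ', permLin_mul]
  have h : LinearMap.det (permLin π) ^ orderOf π = 1 := by
    rw [← map_pow, hpow, pow_orderOf_eq_one, permLin_one, map_one]
  have h' : |LinearMap.det (permLin π)| ^ orderOf π = 1 := by rw [← abs_pow, h, abs_one]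
  exact (pow_eq_one_iff_of_nonneg (abs_nonneg _) (orderOf_pos π).ne').1 h'

/-- The affine map of the standard simplex that permutes the vertices. -/
def permAff {n : ℕ} (π : Equiv.Perm (Fin (n + 1))) (s : Fin n → ℝ) : Fin n → ℝ :=
  fun i => bary s (π i.succ)

lemma bary_permAff {n : ℕ} (π : Equiv.Perm (Fin (n + 1))) (s : Fin n → ℝ) (j : Fin (n + 1)) :
    bary (permAff π s) j = bary s (π j) := by
  refine Fin.cases ?_ (fun j => rfl) j
  have h := (Equiv.sum_comp π (bary s)).trans (sum_bary s)
  rw [Fin.sum_univ_succ] at h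
  simp only [bary_zero, permAff]
  linarith

lemma permAff_eq {n : ℕ} (π : Equiv.Perm (Fin (n + 1))) (s : Fin n → ℝ) :
    permAff π s = permLin π s + permAff π 0 := by
  ext i
  simp only [permAff, permLin, LinearMap.coe_mk, AddHom.coe_mk, Pi.add_apply]
  refine Fin.cases ?_ (fun j => ?_) (π i.succ)
  · simp; ring
  · simp

lemma permAff_permAff {n : ℕ} (π τ : Equiv.Perm (Fin (n + 1))) (s : Fin n → ℝ) :
    permAff π (permAff τ s) = permAff (τ * π) s := by
  ext i
  exact bary_permAff τ s (π i.succ)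

lemma permAff_one {n : ℕ} (s : Fin n → ℝ) : permAff 1 s = s := rfl

lemma measurePreserving_permAff {n : ℕ} (π : Equiv.Perm (Fin (n + 1))) :
    MeasurePreserving (permAff π : (Fin n → ℝ) → Fin n → ℝ) := by
  have h1 : MeasurePreserving (permLin π : (Fin n → ℝ) → Fin n → ℝ) := by
    refine ⟨(LinearMap.continuous_of_finiteDimensional _).measurable, ?_⟩
    have hd := abs_det_permLin π
    rw [Measure.map_linearMap_addHaar_eq_smul_addHaar _ (fun h0 => by simp [h0] at hd), abs_inv, hd]
    simp
  have h2 := (measurePreserving_add_right (volume : Measure (Fin n → ℝ)) (permAff π 0)).comp h1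
  have h3 : permAff π = (fun s => s + permAff π 0) ∘ permLin π := funext fun s => permAff_eq π s
  rw [h3]
  exact h2

/-- `permAff` as a measurable equivalence. -/
def permEquiv {n : ℕ} (π : Equiv.Perm (Fin (n + 1))) : (Fin n → ℝ) ≃ᵐ (Fin n → ℝ) where
  toFun := permAff π
  invFun := permAff π⁻¹
  left_inv s := by rw [permAff_permAff, mul_inv_cancel, permAff_one]
  right_inv s := by rw [permAff_permAff, inv_mul_cancel, permAff_one]
  measurable_toFun := (measurePreserving_permAff π).measurable
  measurable_invFun := (measurePreserving_permAff π⁻¹).measurable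

/-- The integral of a function over a simplex, in the affine parametrisation. -/
def avg {n : ℕ} (p : Fin (n + 1) → E) (f : E → F) : F := ∫ s in stdDomain n, f (simplexMap p s)

lemma simplexMap_permAff {n : ℕ} (π : Equiv.Perm (Fin (n + 1))) (p : Fin (n + 1) → E)
    (s : Fin n → ℝ) : simplexMap (p ∘ π) (permAff π s) = simplexMap p s := by
  simp only [simplexMap_eq_sum_bary, bary_permAff, Function.comp]
  exact Equiv.sum_comp π fun i => bary s i • p i

/-- The affine map that permutes the vertices preserves both the measure and the simplex. The
orientation sign of an integral of a form therefore comes only from the tangent vectors fed into the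
form. -/
lemma avg_perm {n : ℕ} (π : Equiv.Perm (Fin (n + 1))) (p : Fin (n + 1) → E) (f : E → F) :
    avg (p ∘ π) f = avg p f := by
  have hpre : permAff π ⁻¹' stdDomain n = stdDomain n := by
    ext s
    rw [Set.mem_preimage, mem_stdDomain_iff, mem_stdDomain_iff]
    simp only [bary_permAff]
    exact ⟨fun h i => by simpa using h (π⁻¹ i), fun h i => h _⟩
  have h := (measurePreserving_permAff π).setIntegral_preimage_emb
    (permEquiv π).measurableEmbedding (fun s => f (simplexMap (p ∘ π) s)) (stdDomain n)
  rw [hpre] at h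
  simp only [simplexMap_permAff] at h
  exact h.symm

/-! ### Integration of a partial derivative -/

lemma sum_insertNth {n : ℕ} (i : Fin (n + 1)) (r : ℝ) (t : Fin n → ℝ) :
    ∑ j, (i.insertNth r t : Fin (n + 1) → ℝ) j = r + ∑ j, t j := by
  rw [Fin.sum_univ_succAbove _ i]; simp

lemma insertNth_mem_stdDomain {n : ℕ} (i : Fin (n + 1)) (r : ℝ) (t : Fin n → ℝ) :
    (i.insertNth r t : Fin (n + 1) → ℝ) ∈ stdDomain (n + 1) ↔
      t ∈ stdDomain n ∧ r ∈ Set.Icc 0 (1 - ∑ j, t j) := by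
  simp only [stdDomain, Set.mem_ofPred_eq, sum_insertNth, Fin.forall_iff_succAbove i,
    Fin.insertNth_apply_same, Fin.insertNth_apply_succAbove, Set.mem_Icc]
  constructor
  · rintro ⟨⟨h1, h2⟩, h3⟩
    exact ⟨⟨h2, by linarith⟩, h1, by linarith⟩
  · rintro ⟨⟨h1, h2⟩, h3, h4⟩
    exact ⟨⟨h3, h1⟩, by linarith⟩

variable [CompleteSpace F]

/-- Fubini with the coordinate `i` split off, then the fundamental theorem of calculus on the fibre
`[0, 1 - ∑ t]`. Differentiability is required only on fibres over the open simplex, so `f` may be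
singular on faces of codimension two. -/
theorem setIntegral_partialDeriv {n : ℕ} (i : Fin (n + 1)) {f f' : (Fin (n + 1) → ℝ) → F}
    (hd : ∀ t ∈ openDomain n, ∀ r ∈ Set.Icc 0 (1 - ∑ j, t j),
      HasDerivAt (fun r => f (i.insertNth r t)) (f' (i.insertNth r t)) r)
    (hi : IntegrableOn f' (stdDomain (n + 1))) :
    ∫ s in stdDomain (n + 1), f' s =
      ∫ t in stdDomain n, (f (i.insertNth (1 - ∑ j, t j) t) - f (i.insertNth 0 t)) := by
  have hmp := (volume_preserving_piFinSuccAbove (fun _ : Fin (n + 1) => ℝ) i).symm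
  set S := stdDomain (n + 1) with hS
  have hsymm : ∀ z : ℝ × (Fin n → ℝ),
      (MeasurableEquiv.piFinSuccAbove (fun _ : Fin (n + 1) => ℝ) i).symm z = i.insertNth z.1 z.2 :=
    fun z => rfl
  have hi' : Integrable (fun z : ℝ × (Fin n → ℝ) => S.indicator f' (i.insertNth z.1 z.2))
      (volume.prod volume) := by
    have := (hmp.integrable_comp_emb (MeasurableEquiv.measurableEmbedding _)).2
      ((integrable_indicator_iff (measurableSet_stdDomain _)).2 hi)
    exact this
  have key : ∀ t, S.indicator f' ∘ (fun r => i.insertNth r t) =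
      fun r => (stdDomain n).indicator
        (fun t => (Set.Icc 0 (1 - ∑ j, t j)).indicator (fun r => f' (i.insertNth r t)) r) t := by
    intro t
    ext r
    have hm : i.insertNth r t ∈ S ↔ _ := insertNth_mem_stdDomain i r t
    simp only [Function.comp]
    by_cases h : i.insertNth r t ∈ S
    · rw [Set.indicator_of_mem h, Set.indicator_of_mem (hm.1 h).1, Set.indicator_of_mem (hm.1 h).2]
    · rw [Set.indicator_of_notMem h]
      by_cases h1 : t ∈ stdDomain n
      · rw [Set.indicator_of_mem h1, Set.indicator_of_notMem fun h2 => h (hm.2 ⟨h1, h2⟩)]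
      · rw [Set.indicator_of_notMem h1]
  calc ∫ s in S, f' s = ∫ s, S.indicator f' s := (integral_indicator (measurableSet_stdDomain _)).symm
    _ = ∫ z : ℝ × (Fin n → ℝ), S.indicator f' (i.insertNth z.1 z.2) ∂(volume.prod volume) :=
      (hmp.integral_comp (MeasurableEquiv.measurableEmbedding _) _).symm
    _ = ∫ t, ∫ r, S.indicator f' (i.insertNth r t) := integral_prod_symm _ hi'
    _ = ∫ t in stdDomain n, (f (i.insertNth (1 - ∑ j, t j) t) - f (i.insertNth 0 t)) := by
      rw [← integral_indicator (measurableSet_stdDomain n)]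
      refine integral_congr_ae ?_
      -- The fibres over the boundary of the base simplex form a null set and can be discarded.
      have hne : ∀ᵐ t : Fin n → ℝ, t ∈ stdDomain n → t ∈ openDomain n := by
        filter_upwards [(openDomain_ae_eq n).mem_iff] with t ht using ht.2
      filter_upwards [hi'.prod_left_ae, hne] with t ht hto
      have hk := key t
      simp only [Function.comp_def] at hk
      simp only [hk]
      by_cases h1 : t ∈ stdDomain n
      · have h2 := hto h1
        have hle : (0 : ℝ) ≤ 1 - ∑ j, t j := by linarith [h1.2]
        simp only [Set.indicator_of_mem h1]
        rw [integral_indicator measurableSet_Icc, integral_Icc_eq_integral_Ioc,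
          ← intervalIntegral.integral_of_le hle]
        refine intervalIntegral.integral_eq_sub_of_hasDerivAt (fun r hr => hd t h2 r ?_) ?_
        · rwa [Set.uIcc_of_le hle] at hr
        · rw [intervalIntegrable_iff_integrableOn_Icc_of_le hle,
            ← integrable_indicator_iff measurableSet_Icc]
          have h3 := ht
          change Integrable (fun r => S.indicator f' (i.insertNth r t)) volume at h3
          rw [hk] at h3
          simpa only [Set.indicator_of_mem h1] using h3
      · simp [h1]

lemma simplexMap_insertNth {n : ℕ} (p : Fin (n + 2) → E) (i : Fin (n + 1)) (r : ℝ)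
    (t : Fin n → ℝ) : simplexMap p (i.insertNth r t) =
      p 0 + (r • (p i.succ - p 0) + ∑ j, t j • (p (i.succAbove j).succ - p 0)) := by
  simp [simplexMap, Fin.sum_univ_succAbove _ i]

lemma simplexMap_insertNth_zero {n : ℕ} (p : Fin (n + 2) → E) (i : Fin (n + 1))
    (t : Fin n → ℝ) : simplexMap p (i.insertNth 0 t) = simplexMap (fun j => p (i.succ.succAbove j)) t := by
  rw [simplexMap_insertNth]
  simp [simplexMap]

/-- The permutation that moves `i` to the front. -/
def frontPerm {n : ℕ} (i : Fin (n + 1)) : Equiv.Perm (Fin (n + 1)) :=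
  Equiv.ofBijective (Fin.cons i i.succAbove) (Finite.injective_iff_bijective.1 (by
    rw [Fin.cons_injective_iff]
    exact ⟨fun ⟨j, hj⟩ => Fin.succAbove_ne i j hj, Fin.succAbove_right_injective⟩))

/-- The far end of a fibre lies on the face opposite the vertex `p 0`. The parametrisation obtained
there starts at the vertex `p i.succ`, so it differs from the standard one by `frontPerm i`. -/
lemma simplexMap_insertNth_one {n : ℕ} (p : Fin (n + 2) → E) (i : Fin (n + 1))
    (t : Fin n → ℝ) : simplexMap p (i.insertNth (1 - ∑ j, t j) t) =
      simplexMap ((fun j => p (Fin.succAbove 0 j)) ∘ frontPerm i) t := by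
  rw [simplexMap_insertNth]
  have h0 : frontPerm i 0 = i := rfl
  have h1 : ∀ j : Fin n, frontPerm i j.succ = i.succAbove j := fun j => rfl
  simp only [simplexMap, Function.comp, h0, h1, Fin.succAbove_zero, sub_smul, one_smul, smul_sub,
    Finset.sum_sub_distrib, Finset.sum_smul]
  abel

/-- Integral of a derivative along a side of a simplex. It is sufficient that the function is
differentiable off the faces of codimension `2`. -/
theorem avg_deriv {n : ℕ} (p : Fin (n + 2) → E) (i : Fin (n + 1)) {f : E → F}
    (hd : ∀ t ∈ openDomain n, ∀ r ∈ Set.Icc 0 (1 - ∑ j, t j),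
      DifferentiableAt ℝ f (simplexMap p (i.insertNth r t)))
    (hi : IntegrableOn (fun s => D f (simplexMap p s) (p i.succ - p 0)) (stdDomain (n + 1)))
    (h0 : IntegrableOn (fun t => f (simplexMap (fun j => p (Fin.succAbove 0 j)) t)) (stdDomain n))
    (h1 : IntegrableOn (fun t => f (simplexMap (fun j => p (i.succ.succAbove j)) t)) (stdDomain n)) :
    avg p (fun x => D f x (p i.succ - p 0)) =
      avg (fun j => p (Fin.succAbove 0 j)) f - avg (fun j => p (i.succ.succAbove j)) f := by
  rw [avg, setIntegral_partialDeriv i (f := fun s => f (simplexMap p s)) _ hi]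
  · simp only [simplexMap_insertNth_zero, simplexMap_insertNth_one]
    rw [integral_sub _ h1]
    · rw [← avg_perm (frontPerm i) (fun j => p (Fin.succAbove 0 j)) f]
      rfl
    -- Integrability on the face opposite `p 0` is given for the standard order of its vertices; it
    -- is carried over to the order with the vertex `p i.succ` in front.
    · have hpre : permAff (frontPerm i)⁻¹ ⁻¹' stdDomain n = stdDomain n := by
        ext s
        rw [Set.mem_preimage, mem_stdDomain_iff, mem_stdDomain_iff]
        simp only [bary_permAff]
        exact ⟨fun h j => by simpa using h (frontPerm i j), fun h i => h _⟩
      have h := ((measurePreserving_permAff (frontPerm i)⁻¹).integrableOn_comp_preimage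
        (permEquiv (frontPerm i)⁻¹).measurableEmbedding).2 h0
      rw [hpre] at h
      refine h.congr (.of_forall fun t => ?_)
      simp only [Function.comp_apply]
      rw [← simplexMap_permAff (frontPerm i) (fun j => p (Fin.succAbove 0 j)), permAff_permAff,
        inv_mul_cancel, permAff_one]
  · intro t ht r hr
    have h := (hd t ht r hr).hasFDerivAt
    have h2 : HasDerivAt (fun r => simplexMap p (i.insertNth r t)) (p i.succ - p 0) r := by
      simp only [simplexMap_insertNth]
      have := ((((hasDerivAt_id r).smul_const (p i.succ - p 0)).add_const
        (∑ j, t j • (p (i.succAbove j).succ - p 0))).const_add (p 0))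
      simpa using this
    exact h.comp_hasDerivAt r h2

end Simplices

end BFCG

namespace BFCG

/-! ## Oriented simplices -/

section Combinatorics

variable {V : Type*} [DecidableEq V]

lemma mem_verts {k : ℕ} {s : Fin k → V} {v : V} : v ∈ verts s ↔ ∃ i, s i = v := by
  simp [verts]

lemma card_verts {k : ℕ} {s : Fin k → V} (hs : Function.Injective s) : (verts s).card = k := by
  simp [verts, Finset.card_image_of_injective _ hs]

lemma exists_perm_of_verts_eq {k : ℕ} {s s' : Fin k → V} 
    (hs' : Function.Injective s') (h : verts s = verts s') :
    ∃ π : Equiv.Perm (Fin k), s' = s ∘ π := by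
  have h1 : ∀ j, ∃ i, s i = s' j := fun j => mem_verts.1 (h ▸ mem_verts.2 ⟨j, rfl⟩)
  choose f hf using h1
  have hinj : Function.Injective f := fun a b hab => hs' (by rw [← hf a, ← hf b, hab])
  exact ⟨Equiv.ofBijective f (Finite.injective_iff_bijective.1 hinj), funext fun j => (hf j).symm⟩

lemma orient_comp {k : ℕ} {s : Fin k → V} (hs : Function.Injective s) (π : Equiv.Perm (Fin k)) :
    orient s (s ∘ π) = Equiv.Perm.sign π := by
  have h : (Matrix.of fun i j => if s i = (s ∘ π) j then (1 : ℤ) else 0) =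
      (1 : Matrix (Fin k) (Fin k) ℤ).submatrix id π := by
    ext i j
    simp [Matrix.one_apply, hs.eq_iff]
  rw [orient, h, Matrix.det_permute']
  simp

/-- A vertex of `s` missing from `s'` would give a zero row of the determinant. -/
lemma verts_subset_of_orient_ne_zero {k : ℕ} {s s' : Fin k → V} (h : orient s s' ≠ 0) :
    verts s ⊆ verts s' := by
  intro v hv
  obtain ⟨i, rfl⟩ := mem_verts.1 hv
  by_contra hn
  refine h (Matrix.det_eq_zero_of_row_eq_zero i fun j => ?_)
  exact if_neg fun h' => hn (mem_verts.2 ⟨j, h'.symm⟩)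

lemma verts_succAbove_subset {k : ℕ} (t : Fin (k + 1) → V) (i : Fin (k + 1)) :
    verts (fun j => t (i.succAbove j)) ⊆ verts t := by
  intro v hv
  obtain ⟨j, rfl⟩ := mem_verts.1 hv
  exact mem_verts.2 ⟨_, rfl⟩

lemma verts_subset_of_incidence_ne_zero {k : ℕ} {t : Fin (k + 1) → V} {s : Fin k → V}
    (h : incidence t s ≠ 0) : verts s ⊆ verts t := by
  obtain ⟨i, -, hi⟩ := Finset.exists_ne_zero_of_sum_ne_zero h
  exact (verts_subset_of_orient_ne_zero (right_ne_zero_of_mul hi)).trans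
    (verts_succAbove_subset t i)

/-- A function of ordered simplices that changes by the sign of a permutation of the vertices. -/
def IsCochain {F : Type*} [AddCommGroup F] [Module ℝ F] {k : ℕ} (I : (Fin k → V) → F) : Prop :=
  ∀ (s : Fin k → V) (π : Equiv.Perm (Fin k)),
    I (s ∘ π) = (((Equiv.Perm.sign π : ℤˣ) : ℤ) : ℝ) • I s

/-- Adjacent transpositions generate the symmetric group, and the sign is multiplicative. -/
lemma isCochain_of_swap {F : Type*} [AddCommGroup F] [Module ℝ F] {k : ℕ}
    {I : (Fin (k + 1) → V) → F}
    (h : ∀ (s : Fin (k + 1) → V) (i : Fin k), I (s ∘ Equiv.swap i.castSucc i.succ) = -I s) :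
    IsCochain I := by
  intro s π
  have hπ : π ∈ Submonoid.closure (Set.range fun i : Fin k => Equiv.swap i.castSucc i.succ) := by
    rw [Equiv.Perm.mclosure_swap_castSucc_succ]; trivial
  induction hπ using Submonoid.closure_induction generalizing s with
  | mem π hπ =>
    obtain ⟨i, rfl⟩ := hπ
    rw [h, Equiv.Perm.sign_swap (Fin.castSucc_lt_succ).ne]
    simp
  | one => simp
  | mul π τ _ _ h1 h2 =>
    have : s ∘ ⇑(π * τ) = (s ∘ π) ∘ τ := rfl
    rw [this, h2, h1, smul_smul, map_mul]
    push_cast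
    rw [mul_comm]

/-- Only the listed simplex with the same vertices contributes. Its orientation coefficient is the
sign of the permutation relating the two orders, the same sign by which the cochain changes. -/
theorem sum_orient_smul {F L : Type*} [AddCommGroup F] [Module ℝ F] [Fintype L] {k : ℕ}
    {I : (Fin k → V) → F} (hI : IsCochain I) {tri : L → Fin k → V}
    (hinj : ∀ l, Function.Injective (tri l))
    (hext : ∀ l l', verts (tri l) = verts (tri l') → l = l') {s : Fin k → V}
    (hs : Function.Injective s) (hmem : ∃ l, verts (tri l) = verts s) :
    ∑ l, (orient (tri l) s : ℝ) • I (tri l) = I s := by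
  obtain ⟨l, hl⟩ := hmem
  obtain ⟨π, rfl⟩ := exists_perm_of_verts_eq hs hl
  rw [Finset.sum_eq_single l, orient_comp (hinj l), hI]
  · intro l' _ hne
    have : orient (tri l') (tri l ∘ π) = 0 := by
      by_contra h0
      refine hne (hext _ _ ?_)
      rw [hl]
      exact Finset.eq_of_subset_of_card_le (verts_subset_of_orient_ne_zero h0)
        (by rw [card_verts (hinj l'), card_verts hs])
    rw [this]; simp
  · simp

/-- This passes between the alternating sum over the faces of a simplex, as produced by Stokes'
theorem, and a sum over the chosen triangles or edges with their arbitrary orientations. -/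
theorem sum_incidence_smul {F L : Type*} [AddCommGroup F] [Module ℝ F] [Fintype L] {k : ℕ}
    {I : (Fin k → V) → F} (hI : IsCochain I) {tri : L → Fin k → V}
    (hinj : ∀ l, Function.Injective (tri l))
    (hext : ∀ l l', verts (tri l) = verts (tri l') → l = l') {t : Fin (k + 1) → V}
    (ht : Function.Injective t)
    (hmem : ∀ i : Fin (k + 1), ∃ l, verts (tri l) = verts (fun j => t (i.succAbove j))) :
    ∑ l, (incidence t (tri l) : ℝ) • I (tri l) =
      ∑ i : Fin (k + 1), ((-1) ^ (i : ℕ) : ℝ) • I (fun j => t (i.succAbove j)) := by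
  simp only [incidence, Int.cast_sum, Int.cast_mul, Int.cast_pow, Int.cast_neg, Int.cast_one,
    Finset.sum_smul, mul_smul]
  rw [Finset.sum_comm]
  refine Finset.sum_congr rfl fun i _ => ?_
  rw [← Finset.smul_sum, sum_orient_smul (s := fun j => t (i.succAbove j)) hI hinj hext
    (ht.comp Fin.succAbove_right_injective) (hmem i)]

/-- The orientation of an edge relative to an ordered pair of vertices. -/
def pairOrient (e : Fin 2 → V) (a b : V) : ℝ :=
  (if e 0 = a then 1 else 0) * (if e 1 = b then 1 else 0)
    - (if e 0 = b then 1 else 0) * (if e 1 = a then 1 else 0)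

lemma pairOrient_swap (e : Fin 2 → V) (a b : V) : pairOrient e a b = -pairOrient e b a := by
  simp only [pairOrient]; ring

lemma incidence_edge (t : Fin 3 → V) (e : Fin 2 → V) : (incidence t e : ℝ) =
    pairOrient e (t 1) (t 2) - pairOrient e (t 0) (t 2) + pairOrient e (t 0) (t 1) := by
  have h : ∀ s : Fin 2 → V, (orient e s : ℝ) = pairOrient e (s 0) (s 1) := by
    intro s
    simp only [orient, Matrix.det_fin_two, Matrix.of_apply, pairOrient]
    push_cast
    rfl
  have hs : incidence t e = ∑ i : Fin 3, (-1) ^ (i : ℕ) * orient e (fun j => t (i.succAbove j)) :=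
    rfl
  simp only [hs, Fin.sum_univ_three, Int.cast_add, Int.cast_mul, h]
  simp only [Fin.val_zero, Fin.val_one, Fin.val_two, Int.cast_pow, Int.cast_neg, Int.cast_one]
  have h0 : ∀ j : Fin 2, (0 : Fin 3).succAbove j = ![1, 2] j := by decide
  have h1 : ∀ j : Fin 2, (1 : Fin 3).succAbove j = ![0, 2] j := by decide
  have h2 : ∀ j : Fin 2, (2 : Fin 3).succAbove j = ![0, 1] j := by decide
  simp only [h0, h1, h2, Matrix.cons_val_zero, Matrix.cons_val_one]
  ring

lemma isCochain_incidence (e : Fin 2 → V) :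
    IsCochain (fun t : Fin 3 → V => (incidence t e : ℝ)) := by
  refine isCochain_of_swap fun t i => ?_
  simp only [incidence_edge, Function.comp]
  have h0 : ∀ j : Fin 3, Equiv.swap (0 : Fin 2).castSucc (0 : Fin 2).succ j = ![1, 0, 2] j := by
    decide
  have h1 : ∀ j : Fin 3, Equiv.swap (1 : Fin 2).castSucc (1 : Fin 2).succ j = ![0, 2, 1] j := by
    decide
  fin_cases i
  · simp only [Fin.zero_eta, h0, Matrix.cons_val]
    rw [pairOrient_swap e (t 1) (t 0)]; ring
  · simp only [Fin.mk_one, h1, Matrix.cons_val]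
    rw [pairOrient_swap e (t 2) (t 1)]; ring

lemma succAbove_four (j : Fin 3) : (0 : Fin 4).succAbove j = ![1, 2, 3] j ∧
    (1 : Fin 4).succAbove j = ![0, 2, 3] j ∧ (2 : Fin 4).succAbove j = ![0, 1, 3] j ∧
    (3 : Fin 4).succAbove j = ![0, 1, 2] j := by
  revert j; decide

/-- Each pair of vertices of the tetrahedron lies in exactly two faces, which induce opposite
orientations on it. -/
lemma sum_incidence_face (t : Fin 4 → V) (e : Fin 2 → V) :
    ∑ i : Fin 4, ((-1) ^ (i : ℕ) : ℝ) • (incidence (fun j => t (i.succAbove j)) e : ℝ) = 0 := by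
  simp only [incidence_edge, Fin.sum_univ_four, succAbove_four, Matrix.cons_val, smul_eq_mul,
    Fin.coe_ofNat_eq_mod]
  norm_num
  ring

end Combinatorics

namespace Triangulation

variable {V C L Ed : Type*} [DecidableEq V] [DecidableEq C] [Fintype L]

/-- The boundary of a boundary vanishes. -/
theorem sum_incidence_mul (T : Triangulation V C L Ed) (c : C) (e : Ed) :
    ∑ l, (incidence (T.tet c) (T.tri l) : ℝ) * (incidence (T.tri l) (T.edge e) : ℝ) = 0 := by
  have h := sum_incidence_smul (isCochain_incidence (T.edge e)) T.tri_injective T.tri_ext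
    (T.tet_injective c) fun i => (T.face_mem c i).imp fun l hl => hl
  rw [sum_incidence_face] at h
  exact h

lemma verts_tri_subset_src (T : Triangulation V C L Ed) (l : L) :
    verts (T.tri l) ⊆ verts (T.tet (T.src l)) := by
  refine verts_subset_of_incidence_ne_zero ?_
  rw [T.incidence_eq]
  simp [(T.src_ne_tgt l).symm]

lemma verts_tri_subset_tgt (T : Triangulation V C L Ed) (l : L) :
    verts (T.tri l) ⊆ verts (T.tet (T.tgt l)) := by
  refine verts_subset_of_incidence_ne_zero ?_
  rw [T.incidence_eq]
  simp [T.src_ne_tgt l]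

end Triangulation

end BFCG

namespace BFCG

/-! ## Stokes' theorem -/

section Stokes

variable {E F : Type*} [NormedAddCommGroup E] [NormedSpace ℝ E]
  [NormedAddCommGroup F] [NormedSpace ℝ F]

/-- The exterior derivative of a `2`-form. -/
def extD2 (Ω : E → E → E → F) (x u v w : E) : F :=
  D (fun y => Ω y v w) x u + D (fun y => Ω y w u) x v + D (fun y => Ω y u v) x w

/-- The properties of alternating bilinear maps that are needed for integration. -/
structure IsAlt (B : E → E → F) : Prop where
  swap : ∀ u v, B u v = -B v u
  sub_left : ∀ u u' v, B (u - u') v = B u v - B u' v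

lemma IsAlt.sub_right {B : E → E → F} (h : IsAlt B) (u v v' : E) :
    B u (v - v') = B u v - B u v' := by
  rw [h.swap, h.sub_left, h.swap u v, h.swap u v']; abel

lemma IsAlt.self {B : E → E → F} (h : IsAlt B) (u : E) : B u u = 0 := by
  have h2 : (2 : ℝ) • B u u = 0 := by
    rw [two_smul]; nth_rewrite 1 [h.swap u u]; simp
  simpa using h2

/-- This is the area element of the face opposite the vertex 0, whose sides are differences of the
sides at that vertex. -/
lemma IsAlt.sub_sub {B : E → E → F} (h : IsAlt B) (u v w : E) :
    B (u - w) (v - w) = B u v + B v w + B w u := by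
  rw [h.sub_left, h.sub_right, h.sub_right, h.self, h.swap v w, h.swap u w]; abel

lemma continuous_simplexMap {n : ℕ} (p : Fin (n + 1) → E) : Continuous (simplexMap p) := by
  unfold simplexMap; fun_prop

lemma continuous_D {f : E → F} (hf : ContDiff ℝ 1 f) (u : E) :
    Continuous fun x => D f x u :=
  (hf.continuous_fderiv one_ne_zero).clm_apply continuous_const

lemma avg_point [CompleteSpace F] (p : Fin 1 → E) (f : E → F) : avg p f = f (p 0) := by
  have h : stdDomain 0 = Set.univ := by ext s; simp [stdDomain]
  rw [avg, h, Measure.restrict_univ, Measure.volume_pi_eq_dirac, integral_dirac]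
  simp [simplexMap]

lemma setIntegral_add_add {n : ℕ} {S : Set (Fin n → ℝ)} {f f' f'' : (Fin n → ℝ) → F}
    (h : IntegrableOn f S) (h' : IntegrableOn f' S) (h'' : IntegrableOn f'' S) :
    ∫ s in S, (f s + f' s + f'' s) = (∫ s in S, f s) + (∫ s in S, f' s) + ∫ s in S, f'' s := by
  rw [integral_add (f := fun s => f s + f' s) (h.add h') h'', integral_add h h']

variable [CompleteSpace F]

theorem simplexIntegral_D (p : Fin 2 → E) {f : E → F} (hf : ContDiff ℝ 1 f) :
    simplexIntegral p (fun x u => D f x (u 0)) = f (p 1) - f (p 0) := by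
  have h := avg_deriv p 0 (f := f) (fun _ _ _ _ => hf.differentiable one_ne_zero _)
    (integrableOn_stdDomain_of_continuous ((continuous_D hf _).comp (continuous_simplexMap p)))
    (integrableOn_stdDomain_of_continuous (hf.continuous.comp (continuous_simplexMap _)))
    (integrableOn_stdDomain_of_continuous (hf.continuous.comp (continuous_simplexMap _)))
  rw [avg_point, avg_point] at h
  exact h

/-- Each of the two partial derivatives integrates to the face opposite vertex 0 minus another face.
The two contributions of the common face combine by linearity, since its side is the difference `(p
2 - p 0) - (p 1 - p 0)`. -/
theorem simplexIntegral_extD (p : Fin 3 → E) {θ : E → E → F} (hθ : ∀ u, ContDiff ℝ 1 (θ · u))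
    (hsub : ∀ x u v, θ x (u - v) = θ x u - θ x v) :
    simplexIntegral p (fun x u => extD θ x (u 0) (u 1)) =
      ∑ i : Fin 3, ((-1) ^ (i : ℕ) : ℝ) •
        simplexIntegral (fun j => p (i.succAbove j)) (fun x u => θ x (u 0)) := by
  have hI : ∀ {n : ℕ} (q : Fin (n + 1) → E) (u : E),
      IntegrableOn (fun s => θ (simplexMap q s) u) (stdDomain n) := fun q u =>
    integrableOn_stdDomain_of_continuous ((hθ u).continuous.comp (continuous_simplexMap q))
  have hI' : ∀ u v, IntegrableOn (fun s => D (θ · u) (simplexMap p s) v) (stdDomain 2) :=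
    fun u v => integrableOn_stdDomain_of_continuous
      ((continuous_D (hθ u) v).comp (continuous_simplexMap p))
  have hA : ∀ (i : Fin 2) (u : E), avg p (fun x => D (θ · u) x (p i.succ - p 0)) =
      avg (fun j => p (Fin.succAbove 0 j)) (θ · u) -
        avg (fun j => p (i.succ.succAbove j)) (θ · u) := fun i u =>
    avg_deriv p i (fun _ _ _ _ => (hθ u).differentiable one_ne_zero _) (hI' _ _) (hI _ _) (hI _ _)
  have h0 := hA 0 (p 2 - p 0)
  have h1 := hA 1 (p 1 - p 0)
  have h2 : simplexIntegral p (fun x u => extD θ x (u 0) (u 1)) =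
      avg p (fun x => D (θ · (p 2 - p 0)) x (p 1 - p 0)) -
        avg p (fun x => D (θ · (p 1 - p 0)) x (p 2 - p 0)) := integral_sub (hI' _ _) (hI' _ _)
  have h3 : simplexIntegral (fun j => p ((0 : Fin 3).succAbove j)) (fun x u => θ x (u 0)) =
      avg (fun j => p (Fin.succAbove 0 j)) (θ · (p 2 - p 0)) -
        avg (fun j => p (Fin.succAbove 0 j)) (θ · (p 1 - p 0)) := by
    rw [avg, avg, ← integral_sub (hI _ _) (hI _ _)]
    simp only [← hsub, sub_sub_sub_cancel_right]
    rfl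
  rw [h2, Fin.sum_univ_three, h3]
  have e0 : (0 : Fin 2).succ = (1 : Fin 3) := rfl
  have e1 : (1 : Fin 2).succ = (2 : Fin 3) := rfl
  rw [e0] at h0
  rw [e1] at h1
  rw [h0, h1]
  have h4 : simplexIntegral (fun j => p ((1 : Fin 3).succAbove j)) (fun x u => θ x (u 0)) =
    avg (fun j => p ((1 : Fin 3).succAbove j)) (θ · (p 2 - p 0)) := rfl
  have h5 : simplexIntegral (fun j => p ((2 : Fin 3).succAbove j)) (fun x u => θ x (u 0)) =
    avg (fun j => p ((2 : Fin 3).succAbove j)) (θ · (p 1 - p 0)) := rfl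
  rw [h4, h5]
  simp only [Fin.val_zero, Fin.val_one, Fin.val_two, pow_zero, pow_one, one_smul, neg_smul,
    neg_sq, one_pow]
  abel

/-- The same argument with three partial derivatives; their contributions to the face opposite
vertex 0 combine by `IsAlt.sub_sub`. The points where differentiability is assumed are those of
fibres over the open triangle, which avoid the edges of the tetrahedron. -/
theorem simplexIntegral_extD2 (p : Fin 4 → E) {Ω : E → E → E → F} (hω : ∀ x, IsAlt (Ω x))
    (hd : ∀ u v, ∀ i : Fin 3, ∀ t ∈ openDomain 2, ∀ r ∈ Set.Icc 0 (1 - ∑ j, t j),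
      DifferentiableAt ℝ (fun y => Ω y u v) (simplexMap p (i.insertNth r t)))
    (hi : ∀ i j k : Fin 4, IntegrableOn (fun s => D (fun y => Ω y (p j - p 0) (p k - p 0))
      (simplexMap p s) (p i - p 0)) (stdDomain 3))
    (hf : ∀ u v, ∀ i : Fin 4,
      IntegrableOn (fun t => Ω (simplexMap (fun j => p (i.succAbove j)) t) u v) (stdDomain 2)) :
    simplexIntegral p (fun x u => extD2 Ω x (u 0) (u 1) (u 2)) =
      ∑ i : Fin 4, ((-1) ^ (i : ℕ) : ℝ) •
        simplexIntegral (fun j => p (i.succAbove j)) (fun x u => Ω x (u 0) (u 1)) := by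
  have hA : ∀ (i : Fin 3) (j k : Fin 4),
      avg p (fun x => D (fun y => Ω y (p j - p 0) (p k - p 0)) x (p i.succ - p 0)) =
      avg (fun j => p (Fin.succAbove 0 j)) (fun y => Ω y (p j - p 0) (p k - p 0)) -
        avg (fun j => p (i.succ.succAbove j)) (fun y => Ω y (p j - p 0) (p k - p 0)) :=
    fun i j k => avg_deriv p i (hd _ _ i) (hi i.succ j k) (hf _ _ _) (hf _ _ _)
  have h0 := hA 0 2 3
  have h1 := hA 1 3 1
  have h2 := hA 2 1 2
  have e0 : (0 : Fin 3).succ = (1 : Fin 4) := rfl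
  have e1 : (1 : Fin 3).succ = (2 : Fin 4) := rfl
  have e2 : (2 : Fin 3).succ = (3 : Fin 4) := rfl
  rw [e0] at h0
  rw [e1] at h1
  rw [e2] at h2
  have hs : simplexIntegral p (fun x u => extD2 Ω x (u 0) (u 1) (u 2)) =
      avg p (fun x => D (fun y => Ω y (p 2 - p 0) (p 3 - p 0)) x (p 1 - p 0)) +
      avg p (fun x => D (fun y => Ω y (p 3 - p 0) (p 1 - p 0)) x (p 2 - p 0)) +
      avg p (fun x => D (fun y => Ω y (p 1 - p 0) (p 2 - p 0)) x (p 3 - p 0)) := by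
    exact setIntegral_add_add (hi _ _ _) (hi _ _ _) (hi _ _ _)
  have h3 : simplexIntegral (fun j => p ((0 : Fin 4).succAbove j)) (fun x u => Ω x (u 0) (u 1)) =
      avg (fun j => p (Fin.succAbove 0 j)) (fun y => Ω y (p 2 - p 0) (p 3 - p 0)) +
      avg (fun j => p (Fin.succAbove 0 j)) (fun y => Ω y (p 3 - p 0) (p 1 - p 0)) +
      avg (fun j => p (Fin.succAbove 0 j)) (fun y => Ω y (p 1 - p 0) (p 2 - p 0)) := by
    refine Eq.trans ?_ (setIntegral_add_add (hf _ _ _) (hf _ _ _) (hf _ _ _))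
    refine integral_congr_ae (.of_forall fun t => ?_)
    have h := (hω (simplexMap (fun j => p (Fin.succAbove 0 j)) t)).sub_sub (p 2 - p 0) (p 3 - p 0)
      (p 1 - p 0)
    rw [sub_sub_sub_cancel_right, sub_sub_sub_cancel_right] at h
    exact h
  have h4 : simplexIntegral (fun j => p ((1 : Fin 4).succAbove j)) (fun x u => Ω x (u 0) (u 1)) =
    avg (fun j => p ((1 : Fin 4).succAbove j)) (fun y => Ω y (p 2 - p 0) (p 3 - p 0)) := rfl
  have h5 : simplexIntegral (fun j => p ((2 : Fin 4).succAbove j)) (fun x u => Ω x (u 0) (u 1)) =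
      -avg (fun j => p ((2 : Fin 4).succAbove j)) (fun y => Ω y (p 3 - p 0) (p 1 - p 0)) := by
    rw [avg, ← integral_neg]
    refine integral_congr_ae (.of_forall fun t => ?_)
    exact (hω _).swap _ _
  have h6 : simplexIntegral (fun j => p ((3 : Fin 4).succAbove j)) (fun x u => Ω x (u 0) (u 1)) =
    avg (fun j => p ((3 : Fin 4).succAbove j)) (fun y => Ω y (p 1 - p 0) (p 2 - p 0)) := rfl
  rw [hs, h0, h1, h2, Fin.sum_univ_four, h3, h4, h5, h6]
  simp only [Fin.coe_ofNat_eq_mod, Nat.zero_mod, pow_zero, one_smul, Nat.reduceMod, pow_one,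
    neg_smul, neg_sq, one_pow]
  have e3 : ((-1 : ℝ) ^ 3) = -1 := by norm_num
  rw [e3]
  simp only [neg_smul, one_smul]
  abel

end Stokes

/-! ## Simplices in the geometric realisation -/

section Cells

variable {V : Type*} [Fintype V] [DecidableEq V]

lemma simplexMap_pts_apply {n : ℕ} (s : Fin (n + 1) → V) (t : Fin n → ℝ) (v : V) :
    simplexMap (pts s) t v = ∑ i, if v = s i then bary t i else 0 := by
  rw [simplexMap_eq_sum_bary, Finset.sum_apply]
  simp [pts, Pi.single_apply]

lemma simplexMap_pts_same {n : ℕ} {s : Fin (n + 1) → V} (hs : Function.Injective s)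
    (t : Fin n → ℝ) (i : Fin (n + 1)) : simplexMap (pts s) t (s i) = bary t i := by
  rw [simplexMap_pts_apply]
  simp [hs.eq_iff]

lemma simplexMap_mem_cell {n : ℕ} (s : Fin (n + 1) → V) {t : Fin n → ℝ} (ht : t ∈ stdDomain n) :
    simplexMap (pts s) t ∈ cell s := by
  rw [mem_stdDomain_iff] at ht
  refine ⟨fun v => ?_, ?_, fun v hv => ?_⟩
  · rw [simplexMap_pts_apply]
    exact Finset.sum_nonneg fun i _ => by split_ifs <;> simp [ht i]
  · simp only [simplexMap_pts_apply]
    rw [Finset.sum_comm]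
    simp [sum_bary]
  · rw [simplexMap_pts_apply]
    exact Finset.sum_eq_zero fun i _ => if_neg fun h => hv (mem_verts.2 ⟨i, h.symm⟩)

lemma simplexMap_mem_openCell {n : ℕ} {s : Fin (n + 1) → V} (hs : Function.Injective s)
    {t : Fin n → ℝ} (ht : t ∈ openDomain n) : simplexMap (pts s) t ∈ openCell s := by
  refine ⟨simplexMap_mem_cell s (openDomain_subset n ht), fun v hv => ?_⟩
  obtain ⟨i, rfl⟩ := mem_verts.1 hv
  rw [simplexMap_pts_same hs]
  exact (mem_openDomain_iff t).1 ht i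

/-- On a fibre over an interior point, only the barycentric coordinates of the two ends of the side
can vanish, and never both at once. At least three of the four are thus nonzero. -/
lemma simplexMap_mem_regCell {s : Fin 4 → V} (hs : Function.Injective s) (i : Fin 3)
    {t : Fin 2 → ℝ} (ht : t ∈ openDomain 2) {r : ℝ} (hr : r ∈ Set.Icc 0 (1 - ∑ j, t j)) :
    simplexMap (pts s) (i.insertNth r t) ∈ regCell s := by
  have hstd := (insertNth_mem_stdDomain i r t).2 ⟨openDomain_subset 2 ht, hr⟩
  refine ⟨simplexMap_mem_cell s hstd, ?_⟩
  obtain ⟨k, hk⟩ : ∃ k : Fin 4, ∀ j ≠ k, bary (i.insertNth r t : Fin 3 → ℝ) j ≠ 0 := by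
    have hpos : ∀ j, bary (i.insertNth r t : Fin 3 → ℝ) (i.succAbove j).succ ≠ 0 := fun j => by
      simpa using (ht.1 j).ne'
    by_cases h : r = 0
    · refine ⟨i.succ, fun j hj => ?_⟩
      induction j using Fin.cases with
      | zero =>
        rw [bary_zero, sum_insertNth, h, zero_add]
        exact (sub_pos.2 ht.2).ne'
      | succ j =>
        obtain ⟨j, rfl⟩ := Fin.exists_succAbove_eq (fun h => hj (congrArg Fin.succ h) : j ≠ i)
        exact hpos j
    · refine ⟨0, fun j hj => ?_⟩
      induction j using Fin.cases with
      | zero => exact absurd rfl hj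
      | succ j =>
        by_cases hji : j = i
        · subst hji; simpa using h
        · obtain ⟨j, rfl⟩ := Fin.exists_succAbove_eq hji
          exact hpos j
  have hsub : (Finset.univ.erase k).image s ⊆
      Finset.univ.filter fun v => simplexMap (pts s) (i.insertNth r t) v ≠ 0 := by
    intro v hv
    obtain ⟨j, hj, rfl⟩ := Finset.mem_image.1 hv
    simp only [Finset.mem_filter, Finset.mem_univ, true_and]
    rw [simplexMap_pts_same hs]
    exact hk j (Finset.ne_of_mem_erase hj)
  refine le_trans ?_ (Finset.card_le_card hsub)
  rw [Finset.card_image_of_injective _ hs]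
  simp

lemma cell_mono {k k' : ℕ} {s : Fin k → V} {s' : Fin k' → V} (h : verts s ⊆ verts s') :
    cell s ⊆ cell s' :=
  fun _ hx => ⟨hx.1, hx.2.1, fun v hv => hx.2.2 v fun hv' => hv (h hv')⟩

lemma IsTangent.mono {k k' : ℕ} {s : Fin k → V} {s' : Fin k' → V} (h : verts s ⊆ verts s')
    {u : V → ℝ} (hu : IsTangent s u) : IsTangent s' u :=
  ⟨hu.1, fun v hv => hu.2 v fun hv' => hv (h hv')⟩

lemma isTangent_pts_sub {k : ℕ} (s : Fin k → V) (i j : Fin k) :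
    IsTangent s (pts s i - pts s j) := by
  refine ⟨by simp [pts], fun v hv => ?_⟩
  have h : ∀ i, pts s i v = 0 := fun i => by
    rw [pts, Pi.single_apply, if_neg fun h => hv (mem_verts.2 ⟨i, h.symm⟩)]
  simp [h]

lemma openCell_subset_regCell {k k' : ℕ} (hk : 3 ≤ k) {s : Fin k → V} {s' : Fin k' → V}
    (hs : Function.Injective s) (h : verts s ⊆ verts s') : openCell s ⊆ regCell s' := by
  intro x hx
  refine ⟨cell_mono h hx.1, hk.trans ?_⟩
  rw [← card_verts hs]
  refine Finset.card_le_card fun v hv => ?_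
  simpa using (hx.2 v hv).ne'

lemma eventually_add_smul_mem_openCell {k : ℕ} {s : Fin k → V} {x u : V → ℝ}
    (hx : x ∈ openCell s) (hu : IsTangent s u) :
    ∀ᶠ r in nhds (0 : ℝ), x + r • u ∈ openCell s := by
  have hpos : ∀ᶠ r in nhds (0 : ℝ), ∀ v ∈ verts s, 0 < (x + r • u) v := by
    rw [Filter.eventually_all_finset]
    intro v hv
    have hc : Continuous fun r : ℝ => (x + r • u) v := by
      simp only [Pi.add_apply, Pi.smul_apply]; fun_prop
    have h0 : 0 < (x + (0 : ℝ) • u) v := by simpa using hx.2 v hv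
    exact hc.continuousAt.eventually_const_lt h0
  filter_upwards [hpos] with r hr
  have hz : ∀ v ∉ verts s, (x + r • u) v = 0 := fun v hv => by
    simp [hx.1.2.2 v hv, hu.2 v hv]
  refine ⟨⟨fun v => ?_, ?_, hz⟩, hr⟩
  · by_cases hv : v ∈ verts s
    · exact (hr v hv).le
    · exact (hz v hv).ge
  · simp [Finset.sum_add_distrib, ← Finset.mul_sum, hx.1.2.1, hu.1]

variable {F : Type*} [NormedAddCommGroup F] [NormedSpace ℝ F]

/-- Functions that agree on a simplex have the same tangential derivatives. -/
theorem D_congr_of_openCell {k : ℕ} {s : Fin k → V} {x u : V → ℝ} (hx : x ∈ openCell s)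
    (hu : IsTangent s u) {f f' : (V → ℝ) → F} (hf : DifferentiableAt ℝ f x)
    (hf' : DifferentiableAt ℝ f' x) (h : ∀ y ∈ openCell s, f y = f' y) : D f x u = D f' x u := by
  have hl : HasDerivAt (fun r : ℝ => x + r • u) u 0 := by
    simpa using ((hasDerivAt_id (0 : ℝ)).smul_const u).const_add x
  have h1 : ∀ {f : (V → ℝ) → F}, DifferentiableAt ℝ f x →
      HasDerivAt (fun r : ℝ => f (x + r • u)) (D f x u) 0 := fun {f} hf => by
    have : HasFDerivAt f (fderiv ℝ f x) (x + (0 : ℝ) • u) := by simpa using hf.hasFDerivAt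
    exact this.comp_hasDerivAt 0 hl
  refine (h1 hf).unique ((h1 hf').congr_of_eventuallyEq ?_)
  filter_upwards [eventually_add_smul_mem_openCell hx hu] with r hr using h _ hr

lemma isCochain_simplexIntegral_one {θ : (V → ℝ) → (V → ℝ) → F}
    (hsub : ∀ x u v, θ x (u - v) = θ x u - θ x v) :
    IsCochain fun s : Fin 2 → V => simplexIntegral (pts s) fun x u => θ x (u 0) := by
  refine isCochain_of_swap fun s i => ?_
  have hneg : ∀ x u v, θ x (u - v) = -θ x (v - u) := fun x u v => by simp [hsub]
  obtain rfl : i = 0 := Subsingleton.elim _ _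
  have h := avg_perm (Equiv.swap (0 : Fin 2) 1) (pts s) (fun x => θ x (pts s 0 - pts s 1))
  change avg (pts (s ∘ Equiv.swap (0 : Fin 2) 1)) (fun x => θ x (pts s 0 - pts s 1)) = _ at h
  change avg (pts (s ∘ Equiv.swap (0 : Fin 2) 1)) (fun x => θ x (pts s 0 - pts s 1)) =
    -avg (pts s) (fun x => θ x (pts s 1 - pts s 0))
  rw [h, avg, avg, ← integral_neg]
  exact integral_congr_ae (.of_forall fun t => hneg _ _ _)

/-- The average over the triangle ignores the order of its vertices, so it is enough to see that an
adjacent transposition reverses the bivector of two sides. -/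
lemma isCochain_simplexIntegral_two {Ω : (V → ℝ) → (V → ℝ) → (V → ℝ) → F}
    (hω : ∀ x, IsAlt (Ω x)) :
    IsCochain fun s : Fin 3 → V => simplexIntegral (pts s) fun x u => Ω x (u 0) (u 1) := by
  refine isCochain_of_swap fun s i => ?_
  have key : ∀ (π : Equiv.Perm (Fin 3)), (∀ x, Ω x (pts s (π 1) - pts s (π 0))
      (pts s (π 2) - pts s (π 0)) = -Ω x (pts s 1 - pts s 0) (pts s 2 - pts s 0)) →
      (simplexIntegral (pts (s ∘ π)) fun x u => Ω x (u 0) (u 1)) =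
        -simplexIntegral (pts s) fun x u => Ω x (u 0) (u 1) := by
    intro π hπ
    have h := avg_perm π (pts s) (fun x => Ω x (pts s (π 1) - pts s (π 0))
      (pts s (π 2) - pts s (π 0)))
    refine Eq.trans h ?_
    rw [avg, simplexIntegral, ← integral_neg]
    exact integral_congr_ae (.of_forall fun t => hπ _)
  refine key _ fun x => ?_
  have h0 : ∀ j : Fin 3, Equiv.swap (0 : Fin 2).castSucc (0 : Fin 2).succ j = ![1, 0, 2] j := by
    decide
  have h1 : ∀ j : Fin 3, Equiv.swap (1 : Fin 2).castSucc (1 : Fin 2).succ j = ![0, 2, 1] j := by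
    decide
  fin_cases i
  · simp only [Fin.zero_eta, h0, Matrix.cons_val]
    have e1 : pts s 0 - pts s 1 = (0 : V → ℝ) - (pts s 1 - pts s 0) := by abel
    have e2 : pts s 2 - pts s 1 = (pts s 2 - pts s 0) - (pts s 1 - pts s 0) := by abel
    have hz : ∀ v, Ω x 0 v = 0 := fun v => by simpa using (hω x).sub_left 0 0 v
    rw [e1, e2, (hω x).sub_left, hz, (hω x).sub_right, (hω x).self]
    abel
  · simp only [Fin.mk_one, h1, Matrix.cons_val]
    exact (hω x).swap _ _

end Cells

/-! ### Stokes' theorem on a triangulation -/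

namespace Triangulation

variable {V C L Ed : Type*} [Fintype V] [DecidableEq V] [DecidableEq C] [Fintype L] [Fintype Ed]
  {F : Type*} [NormedAddCommGroup F] [NormedSpace ℝ F] [CompleteSpace F]

lemma edgeInt_D (T : Triangulation V C L Ed) (e : Ed) {f : (V → ℝ) → F} (hf : ContDiff ℝ 1 f) :
    T.edgeInt e (D f) = f (pts (T.edge e) 1) - f (pts (T.edge e) 0) :=
  simplexIntegral_D _ hf

theorem triInt_extD (T : Triangulation V C L Ed) (l : L) {θ : (V → ℝ) → (V → ℝ) → F}
    (hθ : ∀ u, ContDiff ℝ 1 (θ · u)) (hsub : ∀ x u v, θ x (u - v) = θ x u - θ x v) :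
    T.triInt l (extD θ) = ∑ e, eps T e l • T.edgeInt e θ := by
  refine (simplexIntegral_extD _ hθ hsub).trans ?_
  exact (sum_incidence_smul (isCochain_simplexIntegral_one hsub) T.edge_injective T.edge_ext
    (T.tri_injective l) (T.side_mem l)).symm

/-- The form need not extend to the edges: continuity on the open faces and boundedness are enough
for it to be integrable on each face. -/
theorem tetInt_extD2 (T : Triangulation V C L Ed) (c : C) {Ω : (V → ℝ) → (V → ℝ) → (V → ℝ) → F}
    (hω : ∀ x, IsAlt (Ω x))
    (hd : ∀ u v, ∀ x ∈ regCell (T.tet c), DifferentiableAt ℝ (fun y => Ω y u v) x)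
    (hi : ∀ u v w, IsTangent (T.tet c) u → IntegrableOn (fun s => D (fun y => Ω y v w)
      (simplexMap (pts (T.tet c)) s) u) (stdDomain 3))
    (hb : ∀ u v, ∃ R : ℝ, ∀ x ∈ regCell (T.tet c), ‖Ω x u v‖ ≤ R) :
    T.tetInt c (extD2 Ω) = ∑ l, (incidence (T.tet c) (T.tri l) : ℝ) • T.triInt l Ω := by
  have hinj := T.tet_injective c
  refine (simplexIntegral_extD2 (pts (T.tet c)) hω (fun u v i t ht r hr =>
    hd u v _ (simplexMap_mem_regCell hinj i ht hr))
    (fun i j k => hi _ _ _ (isTangent_pts_sub _ _ _)) fun u v i => ?_).trans ?_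
  · have hface : ∀ t ∈ openDomain 2, simplexMap (fun j => pts (T.tet c) (i.succAbove j)) t ∈
        regCell (T.tet c) := fun t ht =>
      openCell_subset_regCell le_rfl (hinj.comp Fin.succAbove_right_injective)
        (verts_succAbove_subset _ _)
        (simplexMap_mem_openCell (s := fun j => T.tet c (i.succAbove j))
          (hinj.comp Fin.succAbove_right_injective) ht)
    obtain ⟨R, hR⟩ := hb u v
    refine integrableOn_stdDomain_of_bounded (R := R) (fun t ht => ?_) fun t ht => hR _ (hface t ht)
    exact ((hd u v _ (hface t ht)).continuousAt.comp
      (continuous_simplexMap _).continuousAt).continuousWithinAt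
  · exact (sum_incidence_smul (isCochain_simplexIntegral_two hω) T.tri_injective T.tri_ext hinj
      (T.face_mem c)).symm

/-- Each triangle bounds exactly two tetrahedra, with opposite orientations, so a sum of boundary
terms over the tetrahedra is a sum of jumps across the triangles. -/
theorem sum_tetInt_eq [Fintype C] (T : Triangulation V C L Ed) (G : C → L → F) :
    ∑ c, ∑ l, (incidence (T.tet c) (T.tri l) : ℝ) • G c l =
      ∑ l, (G (T.src l) l - G (T.tgt l) l) := by
  rw [Finset.sum_comm]
  refine Finset.sum_congr rfl fun l _ => ?_
  simp only [T.incidence_eq]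
  push_cast
  simp [sub_smul, Finset.sum_sub_distrib, ite_smul]

end Triangulation

end BFCG

namespace BFCG

/-! ## Bilinear operations -/

section Bilinear

lemma brk_add_left (u u' w : R4) : brk (u + u') w = brk u w + brk u' w := by
  ext i j; simp [brk, Matrix.vecMulVec_apply]; ring

lemma brk_smul_left (a : ℝ) (u w : R4) : brk (a • u) w = a • brk u w := by
  ext i j; simp [brk, Matrix.vecMulVec_apply]; ring

lemma brk_add_right (u w w' : R4) : brk u (w + w') = brk u w + brk u w' := by
  ext i j; simp [brk, Matrix.vecMulVec_apply]; ring

lemma brk_smul_right (a : ℝ) (u w : R4) : brk u (a • w) = a • brk u w := by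
  ext i j; simp [brk, Matrix.vecMulVec_apply]; ring

lemma brk_sub_right (u w w' : R4) : brk u (w - w') = brk u w - brk u w' := by
  ext i j; simp [brk, Matrix.vecMulVec_apply]; ring

/-- `brk` as a bilinear map. -/
def brkL : R4 →ₗ[ℝ] R4 →ₗ[ℝ] Mat :=
  LinearMap.mk₂ ℝ brk brk_add_left brk_smul_left brk_add_right brk_smul_right

/-- `pairing` as a bilinear map. -/
def pairingL : Mat →ₗ[ℝ] Mat →ₗ[ℝ] ℝ :=
  LinearMap.mk₂ ℝ pairing
    (fun b b' X => by simp [pairing, Matrix.add_mul, mul_add])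
    (fun a b X => by simp [pairing]; ring)
    (fun b X X' => by simp [pairing, mul_add])
    (fun a b X => by simp [pairing]; ring)

/-- The dot product as a bilinear map. -/
def dotL : R4 →ₗ[ℝ] R4 →ₗ[ℝ] ℝ :=
  LinearMap.mk₂ ℝ (fun v w => v ⬝ᵥ w) add_dotProduct (fun a v w => smul_dotProduct a v w)
    dotProduct_add (fun a v w => dotProduct_smul a v w)

/-- The action of matrices on vectors as a bilinear map. -/
def mulVecL : Mat →ₗ[ℝ] R4 →ₗ[ℝ] R4 :=
  LinearMap.mk₂ ℝ (fun M v => M *ᵥ v) Matrix.add_mulVec (fun a M v => Matrix.smul_mulVec a M v)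
    Matrix.mulVec_add (fun a M v => Matrix.mulVec_smul M a v)

/-- Matrix multiplication as a bilinear map. -/
def mulL : Mat →ₗ[ℝ] Mat →ₗ[ℝ] Mat := LinearMap.mul ℝ Mat

/-- Transposition as a linear map. -/
def transL : Mat →ₗ[ℝ] Mat := (Matrix.transposeLinearEquiv (Fin 4) (Fin 4) ℝ ℝ).toLinearMap

@[simp] lemma brkL_apply (u w : R4) : brkL u w = brk u w := rfl
@[simp] lemma pairingL_apply (b X : Mat) : pairingL b X = pairing b X := rfl
@[simp] lemma dotL_apply (v w : R4) : dotL v w = v ⬝ᵥ w := rfl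
@[simp] lemma mulVecL_apply (M : Mat) (v : R4) : mulVecL M v = M *ᵥ v := rfl
@[simp] lemma mulL_apply (M N : Mat) : mulL M N = M * N := rfl
@[simp] lemma transL_apply (M : Mat) : transL M = Mᵀ := rfl

variable {E E₁ E₂ F : Type*} [NormedAddCommGroup E] [NormedSpace ℝ E]
  [NormedAddCommGroup E₁] [NormedSpace ℝ E₁] [FiniteDimensional ℝ E₁]
  [NormedAddCommGroup E₂] [NormedSpace ℝ E₂] [FiniteDimensional ℝ E₂]
  [NormedAddCommGroup F] [NormedSpace ℝ F]

/-- A bilinear map of finite-dimensional spaces as a continuous bilinear map. -/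
def bilinCLM (B : E₁ →ₗ[ℝ] E₂ →ₗ[ℝ] F) : E₁ →L[ℝ] E₂ →L[ℝ] F :=
  LinearMap.toContinuousLinearMap
    ((LinearMap.toContinuousLinearMap : (E₂ →ₗ[ℝ] F) ≃ₗ[ℝ] E₂ →L[ℝ] F).toLinearMap ∘ₗ B)

lemma bilinCLM_apply (B : E₁ →ₗ[ℝ] E₂ →ₗ[ℝ] F) (v : E₁) (w : E₂) : bilinCLM B v w = B v w := rfl

lemma contDiffAt_bilin {n : WithTop ℕ∞} (B : E₁ →ₗ[ℝ] E₂ →ₗ[ℝ] F) {f : E → E₁} {f' : E → E₂} {x : E}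
    (hf : ContDiffAt ℝ n f x) (hf' : ContDiffAt ℝ n f' x) :
    ContDiffAt ℝ n (fun y => B (f y) (f' y)) x :=
  ((bilinCLM B).contDiff.contDiffAt.comp x hf).clm_apply hf'

lemma contDiff_bilin {n : WithTop ℕ∞} (B : E₁ →ₗ[ℝ] E₂ →ₗ[ℝ] F) {f : E → E₁} {f' : E → E₂}
    (hf : ContDiff ℝ n f) (hf' : ContDiff ℝ n f') : ContDiff ℝ n fun y => B (f y) (f' y) :=
  ((bilinCLM B).contDiff.comp hf).clm_apply hf'

lemma differentiableAt_bilin (B : E₁ →ₗ[ℝ] E₂ →ₗ[ℝ] F) {f : E → E₁} {f' : E → E₂} {x : E}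
    (hf : DifferentiableAt ℝ f x) (hf' : DifferentiableAt ℝ f' x) :
    DifferentiableAt ℝ (fun y => B (f y) (f' y)) x :=
  ((bilinCLM B).hasFDerivAt_of_bilinear hf.hasFDerivAt hf'.hasFDerivAt).differentiableAt

/-- The product rule. -/
lemma D_bilin (B : E₁ →ₗ[ℝ] E₂ →ₗ[ℝ] F) {f : E → E₁} {f' : E → E₂} {x : E}
    (hf : DifferentiableAt ℝ f x) (hf' : DifferentiableAt ℝ f' x) (u : E) :
    D (fun y => B (f y) (f' y)) x u = B (D f x u) (f' x) + B (f x) (D f' x u) := by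
  have h := ((bilinCLM B).hasFDerivAt_of_bilinear hf.hasFDerivAt hf'.hasFDerivAt).fderiv
  have h' : D (fun y => B (f y) (f' y)) x u =
    fderiv ℝ (fun y => bilinCLM B (f y) (f' y)) x u := rfl
  rw [h', h]
  simp [D, bilinCLM_apply, add_comm]

lemma contDiffAt_linear {n : WithTop ℕ∞} (A : E₁ →ₗ[ℝ] F) {f : E → E₁} {x : E}
    (hf : ContDiffAt ℝ n f x) : ContDiffAt ℝ n (fun y => A (f y)) x :=
  (LinearMap.toContinuousLinearMap A).contDiff.contDiffAt.comp x hf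

lemma contDiff_linear {n : WithTop ℕ∞} (A : E₁ →ₗ[ℝ] F) {f : E → E₁}
    (hf : ContDiff ℝ n f) : ContDiff ℝ n fun y => A (f y) :=
  (LinearMap.toContinuousLinearMap A).contDiff.comp hf

lemma differentiableAt_linear (A : E₁ →ₗ[ℝ] F) {f : E → E₁} {x : E}
    (hf : DifferentiableAt ℝ f x) : DifferentiableAt ℝ (fun y => A (f y)) x :=
  (LinearMap.toContinuousLinearMap A).differentiableAt.comp x hf

lemma D_linear (A : E₁ →ₗ[ℝ] F) {f : E → E₁} {x : E} (hf : DifferentiableAt ℝ f x) (u : E) :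
    D (fun y => A (f y)) x u = A (D f x u) := by
  have h := ((LinearMap.toContinuousLinearMap A).hasFDerivAt.comp x hf.hasFDerivAt).fderiv
  exact congrArg (fun M : E →L[ℝ] F => M u) h

lemma vary_eq_D (f : ℝ → F) : vary f = D f 0 1 := (fderiv_apply_one_eq_deriv).symm

lemma D_add {f f' : E → F} {x : E} (hf : DifferentiableAt ℝ f x) (hf' : DifferentiableAt ℝ f' x)
    (u : E) : D (fun y => f y + f' y) x u = D f x u + D f' x u := by
  simp only [D]; rw [fderiv_fun_add hf hf']; rfl

lemma D_sub {f f' : E → F} {x : E} (hf : DifferentiableAt ℝ f x) (hf' : DifferentiableAt ℝ f' x)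
    (u : E) : D (fun y => f y - f' y) x u = D f x u - D f' x u := by
  simp only [D]; rw [fderiv_fun_sub hf hf']; rfl

lemma D_const (a : F) (x u : E) : D (fun _ => a) x u = 0 := by simp [D]

lemma D_map_sub (f : E → F) (x u v : E) : D f x (u - v) = D f x u - D f x v := map_sub _ _ _

lemma D_congr_of_eventuallyEq {f f' : E → F} {x : E} (h : f =ᶠ[nhds x] f') (u : E) :
    D f x u = D f' x u :=
  congrArg (fun M : E →L[ℝ] F => M u) h.fderiv_eq

/-- Symmetry of second derivatives. -/
lemma D_comm {f : E → F} {x : E} (hf : ContDiffAt ℝ 2 f x) (u v : E) :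
    D (fun y => D f y u) x v = D (fun y => D f y v) x u := by
  have hs : IsSymmSndFDerivAt ℝ f x := hf.isSymmSndFDerivAt (by simp)
  have hd : DifferentiableAt ℝ (fderiv ℝ f) x :=
    (hf.fderiv_right (m := 1) (by norm_num)).differentiableAt one_ne_zero
  have h : ∀ u v, D (fun y => D f y u) x v = fderiv ℝ (fderiv ℝ f) x v u := by
    intro u v
    simp only [D]
    rw [fderiv_clm_apply hd (differentiableAt_const u)]
    simp
  rw [h, h]
  exact hs.eq v u

lemma contDiffAt_D {f : E → F} {x : E} (hf : ContDiffAt ℝ ∞ f x) (u : E) :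
    ContDiffAt ℝ ∞ (fun y => D f y u) x :=
  (hf.fderiv_right (m := ∞) (by simp)).clm_apply contDiffAt_const

lemma contDiff_D {f : E → F} (hf : ContDiff ℝ ∞ f) (u : E) : ContDiff ℝ ∞ fun y => D f y u :=
  contDiff_iff_contDiffAt.2 fun _ => contDiffAt_D hf.contDiffAt u

/-! ### Smooth families -/

variable {f : ℝ → E → F} {t : ℝ} {x : E}

lemma contDiffAt_param (hf : ContDiffAt ℝ ∞ (fun q : ℝ × E => f q.1 q.2) (t, x)) :
    ContDiffAt ℝ ∞ (fun r => f r x) t :=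
  ContDiffAt.comp (g := fun q : ℝ × E => f q.1 q.2) t hf
    (contDiffAt_id.prodMk contDiffAt_const : ContDiffAt ℝ ∞ (fun r => (r, x)) t)

/-- Derivatives in the space variable are derivatives of the joint function in the directions `(0,
u)`. Likewise variations are derivatives in the direction `(1, 0)`, so questions about families
reduce to calculus on `ℝ × E`. -/
lemma eventually_D_slice (hf : ContDiffAt ℝ ∞ (fun q : ℝ × E => f q.1 q.2) (t, x)) (u : E) :
    ∀ᶠ q : ℝ × E in nhds (t, x),
      D (f q.1) q.2 u = D (fun q : ℝ × E => f q.1 q.2) q (0, u) := by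
  have h1 : ∀ᶠ q in nhds (t, x), ContDiffAt ℝ 1 (fun q : ℝ × E => f q.1 q.2) q :=
    (hf.of_le (mod_cast le_top)).eventually (by simp)
  filter_upwards [h1] with q hq
  have h2 : HasFDerivAt (fun y : E => (q.1, y)) (ContinuousLinearMap.inr ℝ ℝ E) q.2 :=
    hasFDerivAt_prodMk_right q.1 q.2
  have h3 := (hq.differentiableAt one_ne_zero).hasFDerivAt.comp q.2 h2
  have h4 := congrArg (fun M : E →L[ℝ] F => M u) h3.fderiv
  exact h4

lemma eventually_vary_slice (hf : ContDiffAt ℝ ∞ (fun q : ℝ × E => f q.1 q.2) (0, x)) :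
    ∀ᶠ y in nhds x,
      vary (fun r => f r y) = D (fun q : ℝ × E => f q.1 q.2) (0, y) (1, 0) := by
  have h1 : ∀ᶠ q in nhds ((0 : ℝ), x), ContDiffAt ℝ 1 (fun q : ℝ × E => f q.1 q.2) q :=
    (hf.of_le (mod_cast le_top)).eventually (by simp)
  have hc : Filter.Tendsto (fun y : E => ((0 : ℝ), y)) (nhds x) (nhds (0, x)) :=
    (Continuous.prodMk_right (0 : ℝ)).tendsto x
  filter_upwards [hc.eventually h1] with y hq
  have h2 : HasFDerivAt (fun r : ℝ => (r, y)) (ContinuousLinearMap.inl ℝ ℝ E) 0 :=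
    hasFDerivAt_prodMk_left 0 y
  have h3 := (hq.differentiableAt one_ne_zero).hasFDerivAt.comp (0 : ℝ) h2
  have h4 := congrArg (fun M : ℝ →L[ℝ] F => M 1) h3.fderiv
  rw [vary_eq_D]
  exact h4

lemma contDiffAt_family_D (hf : ContDiffAt ℝ ∞ (fun q : ℝ × E => f q.1 q.2) (t, x)) (u : E) :
    ContDiffAt ℝ ∞ (fun q : ℝ × E => D (f q.1) q.2 u) (t, x) :=
  (contDiffAt_D hf (0, u)).congr_of_eventuallyEq (eventually_D_slice hf u)

lemma contDiffAt_vary (hf : ContDiffAt ℝ ∞ (fun q : ℝ × E => f q.1 q.2) (0, x)) :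
    ContDiffAt ℝ ∞ (fun y => vary fun r => f r y) x :=
  (ContDiffAt.comp (g := fun q => D (fun q : ℝ × E => f q.1 q.2) q (1, 0)) x
    (contDiffAt_D hf (1, 0))
    (contDiffAt_const.prodMk contDiffAt_id : ContDiffAt ℝ ∞ (fun y => ((0 : ℝ), y)) x)
    ).congr_of_eventuallyEq (eventually_vary_slice hf)

/-- Variations commute with derivatives. -/
theorem vary_D (hf : ContDiffAt ℝ ∞ (fun q : ℝ × E => f q.1 q.2) (0, x)) (u : E) :
    vary (fun r => D (f r) x u) = D (fun y => vary fun r => f r y) x u := by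
  -- Both sides become second derivatives of the joint function in the directions `(1, 0)` and `(0,
  -- u)`, taken in the two orders.
  have h1 := (eventually_vary_slice (f := fun r y => D (f r) y u) (contDiffAt_family_D hf u)).self_of_nhds
  have h2 := D_congr_of_eventuallyEq (eventually_D_slice hf u) (1, 0)
  have h3 := D_congr_of_eventuallyEq (eventually_vary_slice hf) u
  have h4 := (eventually_D_slice (f := fun r y => D (fun q : ℝ × E => f q.1 q.2) (r, y) (1, 0))
    (contDiffAt_D hf (1, 0)) u).self_of_nhds
  have h5 := D_comm (hf.of_le (WithTop.coe_le_coe.2 le_top : ((2 : ℕ∞) : WithTop ℕ∞) ≤ ∞)) ((0 : ℝ), u) (1, 0)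
  rw [h1, h2, h3, h5]
  exact h4.symm

end Bilinear

end BFCG

namespace BFCG

/-! ## Orthogonal matrices and skew matrices -/

section Orthogonal

lemma IsSO.mul_transpose {h : Mat} (hh : IsSO h) : h * hᵀ = 1 :=
  (Matrix.mem_orthogonalGroup_iff (Fin 4) ℝ).1 (Matrix.mem_specialOrthogonalGroup_iff.1 hh).1

lemma IsSO.transpose_mul {h : Mat} (hh : IsSO h) : hᵀ * h = 1 :=
  (Matrix.mem_orthogonalGroup_iff' (Fin 4) ℝ).1 (Matrix.mem_specialOrthogonalGroup_iff.1 hh).1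

lemma dotProduct_mulVec_transpose (u v : R4) (M : Mat) : u ⬝ᵥ (M *ᵥ v) = (Mᵀ *ᵥ u) ⬝ᵥ v := by
  rw [Matrix.dotProduct_mulVec, Matrix.mulVec_transpose]

lemma conj_brk (h : Mat) (u w : R4) : h * brk u w * hᵀ = brk (h *ᵥ u) (h *ᵥ w) := by
  simp only [brk, Matrix.mul_sub, Matrix.sub_mul, Matrix.mul_vecMulVec, Matrix.vecMulVec_mul,
    Matrix.vecMul_transpose]

lemma pairing_conj (h b X : Mat) : pairing (hᵀ * b * h) X = pairing b (h * X * hᵀ) := by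
  simp only [pairing, Matrix.transpose_mul, Matrix.transpose_transpose]
  rw [Matrix.mul_assoc, Matrix.trace_mul_comm]
  simp only [Matrix.mul_assoc]

lemma isSkew_brk (u w : R4) : IsSkew (brk u w) := by
  simp [IsSkew, brk, Matrix.transpose_vecMulVec]

lemma IsSkew.add {a b : Mat} (ha : IsSkew a) (hb : IsSkew b) : IsSkew (a + b) := by
  unfold IsSkew at *; rw [Matrix.transpose_add, ha, hb]; abel

lemma IsSkew.sub {a b : Mat} (ha : IsSkew a) (hb : IsSkew b) : IsSkew (a - b) := by
  unfold IsSkew at *; rw [Matrix.transpose_sub, ha, hb]; abel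

lemma IsSkew.smul {a : Mat} (r : ℝ) (ha : IsSkew a) : IsSkew (r • a) := by
  unfold IsSkew at *; rw [Matrix.transpose_smul, ha, smul_neg]

lemma isSkew_zero : IsSkew 0 := by simp [IsSkew]

lemma isSkew_sum {ι : Type*} (s : Finset ι) {f : ι → Mat} (h : ∀ i ∈ s, IsSkew (f i)) :
    IsSkew (∑ i ∈ s, f i) :=
  Finset.sum_induction f IsSkew (fun _ _ => IsSkew.add) isSkew_zero h

/-- No integrability is needed, since the Bochner integral of a non-integrable function is zero.
Applied to `a ↦ aᵀ + a`, it shows that integrals of skew matrices are skew. -/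
lemma linear_integral_eq_zero {F F' : Type*} [NormedAddCommGroup F] [NormedSpace ℝ F]
    [FiniteDimensional ℝ F] [NormedAddCommGroup F'] [NormedSpace ℝ F'] [FiniteDimensional ℝ F']
    (A : F →ₗ[ℝ] F') {α : Type*} [MeasurableSpace α] {μ : Measure α} {f : α → F}
    (h : ∀ x, A (f x) = 0) : A (∫ x, f x ∂μ) = 0 := by
  by_cases hi : Integrable f μ
  · have h1 := (LinearMap.toContinuousLinearMap A).integral_comp_comm hi
    have h2 : A (∫ x, f x ∂μ) = ∫ x, A (f x) ∂μ := h1.symm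
    rw [h2]
    simp [h]
  · rw [integral_undef hi, map_zero]

lemma isSkew_integral {α : Type*} [MeasurableSpace α] {μ : Measure α} {f : α → Mat}
    (h : ∀ x, IsSkew (f x)) : IsSkew (∫ x, f x ∂μ) :=
  eq_neg_of_add_eq_zero_left
    (linear_integral_eq_zero (transL + LinearMap.id) fun x => add_eq_zero_iff_eq_neg.2 (h x))

lemma isSkew_D {E : Type*} [NormedAddCommGroup E] [NormedSpace ℝ E] {f : E → Mat} {x : E}
    (hd : DifferentiableAt ℝ f x) (hf : ∀ᶠ y in nhds x, IsSkew (f y)) (u : E) :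
    IsSkew (D f x u) := by
  have h1 := D_linear transL hd u
  have h2 : D (fun y => transL (f y)) x u = D (fun y => (-LinearMap.id : Mat →ₗ[ℝ] Mat) (f y)) x u :=
    D_congr_of_eventuallyEq (hf.mono fun y hy => by simpa [IsSkew] using hy) u
  rw [h1, D_linear _ hd] at h2
  simpa [IsSkew] using h2

end Orthogonal

/-! ## Paths and holonomies -/

section Paths

variable {C L : Type*} {src tgt : L → C} {ok : L → Prop}

lemma IsPathWith.append : ∀ {a : C} {p : List (L × Bool)} {b : C} {q : List (L × Bool)} {c : C},
    IsPathWith src tgt ok a p b → IsPathWith src tgt ok b q c → IsPathWith src tgt ok a (p ++ q) c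
  | _, [], _, _, _, h, h' => by cases h; exact h'
  | _, (_, true) :: _, _, _, _, h, h' => ⟨h.1, h.2.1, h.2.2.append h'⟩
  | _, (_, false) :: _, _, _, _, h, h' => ⟨h.1, h.2.1, h.2.2.append h'⟩

lemma hol_append (h : L → Mat) (p q : List (L × Bool)) : hol h (p ++ q) = hol h p * hol h q := by
  induction p with
  | nil => simp [hol]
  | cons m p ih =>
    obtain ⟨l, b⟩ := m
    cases b <;> simp [hol, ih, Matrix.mul_assoc]

lemma hol_transpose_mul {h : L → Mat} (hh : ∀ l, IsSO (h l)) (p : List (L × Bool)) :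
    (hol h p)ᵀ * hol h p = 1 := by
  induction p with
  | nil => simp [hol]
  | cons m p ih =>
    obtain ⟨l, b⟩ := m
    cases b
    · rw [hol, Matrix.transpose_mul, Matrix.transpose_transpose, Matrix.mul_assoc,
        ← Matrix.mul_assoc (h l), (hh l).mul_transpose, Matrix.one_mul, ih]
    · rw [hol, Matrix.transpose_mul, Matrix.mul_assoc,
        ← Matrix.mul_assoc (h l)ᵀ, (hh l).transpose_mul, Matrix.one_mul, ih]

lemma hol_mul_transpose {h : L → Mat} (hh : ∀ l, IsSO (h l)) (p : List (L × Bool)) :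
    hol h p * (hol h p)ᵀ = 1 :=
  mul_eq_one_comm.1 (hol_transpose_mul hh p)

end Paths

/-! ### Edge simplicity, and constancy of the face variable along the edge -/

section Config

variable {V C L Ed : Type*} [Fintype V] [DecidableEq V] [Fintype C] [DecidableEq C]
  [Fintype L] [DecidableEq L] [Fintype Ed]

namespace Triangulation

variable {F F' : Type*} [NormedAddCommGroup F] [NormedSpace ℝ F] [FiniteDimensional ℝ F]
  [NormedAddCommGroup F'] [NormedSpace ℝ F'] [FiniteDimensional ℝ F']

lemma edgeInt_congr (T : Triangulation V C L Ed) {e : Ed} {θ θ' : (V → ℝ) → (V → ℝ) → F}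
    (h : ∀ x ∈ openCell (T.edge e), θ x (T.edgeVec e) = θ' x (T.edgeVec e)) :
    T.edgeInt e θ = T.edgeInt e θ' :=
  setIntegral_stdDomain_congr fun _ ht => h _ (simplexMap_mem_openCell (T.edge_injective e) ht)

lemma triInt_congr (T : Triangulation V C L Ed) {l : L} {θ θ' : (V → ℝ) → (V → ℝ) → (V → ℝ) → F}
    (h : ∀ x ∈ openCell (T.tri l), ∀ u v, IsTangent (T.tri l) u → IsTangent (T.tri l) v →
      θ x u v = θ' x u v) :
    T.triInt l θ = T.triInt l θ' :=
  setIntegral_stdDomain_congr fun _ ht => h _ (simplexMap_mem_openCell (T.tri_injective l) ht)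
    _ _ (isTangent_pts_sub _ _ _) (isTangent_pts_sub _ _ _)

lemma edgeInt_linear (T : Triangulation V C L Ed) (e : Ed) (A : F →ₗ[ℝ] F')
    {θ : (V → ℝ) → (V → ℝ) → F} (h : ∀ u, Continuous (θ · u)) :
    T.edgeInt e (fun x u => A (θ x u)) = A (T.edgeInt e θ) :=
  (LinearMap.toContinuousLinearMap A).integral_comp_comm
    (integrableOn_stdDomain_of_continuous ((h _).comp (continuous_simplexMap _)))

lemma triInt_linear (T : Triangulation V C L Ed) (l : L) (A : F →ₗ[ℝ] F')
    {θ : (V → ℝ) → (V → ℝ) → (V → ℝ) → F} (h : ∀ u v, Continuous (θ · u v)) :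
    T.triInt l (fun x u v => A (θ x u v)) = A (T.triInt l θ) :=
  (LinearMap.toContinuousLinearMap A).integral_comp_comm
    (integrableOn_stdDomain_of_continuous ((h _ _).comp (continuous_simplexMap _)))

lemma edgeInt_add (T : Triangulation V C L Ed) (e : Ed)
    {θ θ' : (V → ℝ) → (V → ℝ) → F} (h : ∀ u, Continuous (θ · u)) (h' : ∀ u, Continuous (θ' · u)) :
    T.edgeInt e (fun x u => θ x u + θ' x u) = T.edgeInt e θ + T.edgeInt e θ' :=
  integral_add (integrableOn_stdDomain_of_continuous ((h _).comp (continuous_simplexMap _)))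
    (integrableOn_stdDomain_of_continuous ((h' _).comp (continuous_simplexMap _)))

lemma triInt_add (T : Triangulation V C L Ed) (l : L)
    {θ θ' : (V → ℝ) → (V → ℝ) → (V → ℝ) → F} (h : ∀ u v, Continuous (θ · u v))
    (h' : ∀ u v, Continuous (θ' · u v)) :
    T.triInt l (fun x u v => θ x u v + θ' x u v) = T.triInt l θ + T.triInt l θ' :=
  integral_add (integrableOn_stdDomain_of_continuous ((h _ _).comp (continuous_simplexMap _)))
    (integrableOn_stdDomain_of_continuous ((h' _ _).comp (continuous_simplexMap _)))

lemma edgeInt_sum (T : Triangulation V C L Ed) (e : Ed) {ι : Type*} (s : Finset ι)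
    {θ : ι → (V → ℝ) → (V → ℝ) → F} (h : ∀ i u, Continuous (θ i · u)) :
    T.edgeInt e (fun x u => ∑ i ∈ s, θ i x u) = ∑ i ∈ s, T.edgeInt e (θ i) :=
  integral_finsetSum s fun i _ =>
    integrableOn_stdDomain_of_continuous ((h i _).comp (continuous_simplexMap _))

lemma isTangent_edgeVec (T : Triangulation V C L Ed) (e : Ed) :
    IsTangent (T.edge e) (T.edgeVec e) := isTangent_pts_sub _ _ _

lemma around_of_eps_ne_zero {T : Triangulation V C L Ed} {e : Ed} {l : L} (h : eps T e l ≠ 0) :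
    T.Around e l :=
  verts_subset_of_incidence_ne_zero fun h0 => h (by simp [eps, h0])

lemma pts_mem_cell {k : ℕ} (s : Fin k → V) (i : Fin k) : pts s i ∈ cell s := by
  refine ⟨fun v => ?_, by simp [pts], fun v hv => ?_⟩
  · simp only [pts, Pi.single_apply]; split_ifs <;> simp
  · rw [pts, Pi.single_apply, if_neg fun h => hv (mem_verts.2 ⟨i, h.symm⟩)]

end Triangulation

open Triangulation

variable {T : Triangulation V C L Ed} {Φ : Fields V C L}

namespace IsConfig

lemma db_skew (h : IsConfig T Φ) (c : C) (x u v : V → ℝ) : IsSkew (Φ.db c x u v) := by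
  have hD : ∀ u v, IsSkew (D (fun y => Φ.b c y v) x u) := fun u v =>
    isSkew_D ((h.b_smooth c v).differentiable (by simp) x) (.of_forall fun y => h.b_skew c y v) u
  exact (hD u v).sub (hD v u)

/-- Along an edge, the fields `c` at two nodes around the edge differ by a translation and the
holonomy. -/
lemma c_path (h : IsConfig T Φ) {e : Ed} : ∀ {a : C} {p : List (L × Bool)} {b : C},
    T.IsPath e a p b →
    ∃ X, ∀ x ∈ cell (T.edge e), Φ.c b x = (hol Φ.h p)ᵀ *ᵥ (Φ.c a x + X)
  | a, [], _, hp => by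
    cases hp
    exact ⟨0, fun x _ => by simp [hol]⟩
  | a, (l, true) :: p, b, hp => by
    obtain ⟨hl, rfl, hp⟩ := hp
    obtain ⟨X, hX⟩ := c_path h hp
    refine ⟨Φ.x l + Φ.h l *ᵥ X, fun x hx => ?_⟩
    rw [hX x hx, h.c_cont l x (cell_mono hl hx), hol, Matrix.transpose_mul, ← Matrix.mulVec_mulVec]
    congr 1
    simp only [Matrix.mulVec_add, Matrix.mulVec_mulVec, (h.h_mem l).transpose_mul,
      Matrix.one_mulVec, add_assoc]
  | a, (l, false) :: p, b, hp => by
    obtain ⟨hl, rfl, hp⟩ := hp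
    obtain ⟨X, hX⟩ := c_path h hp
    refine ⟨(Φ.h l)ᵀ *ᵥ (X - Φ.x l), fun x hx => ?_⟩
    rw [hX x hx, h.c_cont l x (cell_mono hl hx), hol, Matrix.transpose_mul, ← Matrix.mulVec_mulVec]
    congr 1
    simp only [← Matrix.mulVec_add, Matrix.transpose_transpose, Matrix.mulVec_mulVec,
      (h.h_mem l).mul_transpose, Matrix.one_mulVec]
    abel

lemma D_c_path (h : IsConfig T Φ) {e : Ed} {a b : C} {p : List (L × Bool)}
    (hp : T.IsPath e a p b) {x : V → ℝ} (hx : x ∈ openCell (T.edge e)) :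
    D (Φ.c b) x (T.edgeVec e) = (hol Φ.h p)ᵀ *ᵥ D (Φ.c a) x (T.edgeVec e) := by
  obtain ⟨X, hX⟩ := h.c_path hp
  have hd : ∀ c, DifferentiableAt ℝ (Φ.c c) x := fun c => (h.c_smooth c).differentiable (by simp) x
  have hd' : DifferentiableAt ℝ (fun y => Φ.c a y + X) x := (hd a).add_const X
  rw [D_congr_of_openCell hx (T.isTangent_edgeVec e) (hd b)
    (differentiableAt_linear (mulVecL (hol Φ.h p)ᵀ) hd') (fun y hy => hX y hy.1),
    D_linear _ hd', D_add (hd a) (differentiableAt_const X), D_const, add_zero]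
  rfl

lemma ellAt_eq (h : IsConfig T Φ) (e : Ed) (c : C) :
    ellAt T Φ e c = Φ.c c (pts (T.edge e) 1) - Φ.c c (pts (T.edge e) 0) :=
  T.edgeInt_D e ((h.c_smooth c).of_le (mod_cast le_top))

/-- The translations accumulated along the path are constant on the edge and drop out of the
difference of the end values. For a closed path this is edge simplicity. -/
lemma ellAt_path (h : IsConfig T Φ) {e : Ed} {a b : C} {p : List (L × Bool)}
    (hp : T.IsPath e a p b) : ellAt T Φ e b = (hol Φ.h p)ᵀ *ᵥ ellAt T Φ e a := by
  obtain ⟨X, hX⟩ := h.c_path hp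
  rw [h.ellAt_eq, h.ellAt_eq, hX _ (pts_mem_cell _ _), hX _ (pts_mem_cell _ _),
    ← Matrix.mulVec_sub]
  congr 1
  abel

/-- Preceded by the same return path from `b` to `a`, the two paths become loops based at `b`, both
of which fix `σ`. The holonomy of the return path is then cancelled. -/
lemma σ_path_unique (h : IsConfig T Φ) (hσ : SigmaInvariant T Φ) {e : Ed} {a b : C}
    {p q : List (L × Bool)} (ha : verts (T.edge e) ⊆ verts (T.tet a))
    (hb : verts (T.edge e) ⊆ verts (T.tet b)) (hp : T.IsPath e a p b) (hq : T.IsPath e a q b)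
    {x : V → ℝ} (hx : x ∈ cell (T.edge e)) :
    hol Φ.h p *ᵥ Φ.σ b x (T.edgeVec e) = hol Φ.h q *ᵥ Φ.σ b x (T.edgeVec e) := by
  obtain ⟨r, hr⟩ := T.dual_connected e b a hb ha
  have h1 := (hσ e b _ (IsPathWith.append hr hp) x hx).trans
    (hσ e b _ (IsPathWith.append hr hq) x hx).symm
  rw [hol_append, hol_append, ← Matrix.mulVec_mulVec, ← Matrix.mulVec_mulVec] at h1
  have h2 := congrArg (fun v => (hol Φ.h r)ᵀ *ᵥ v) h1
  simpa only [Matrix.mulVec_mulVec _ (hol Φ.h r)ᵀ, hol_transpose_mul h.h_mem, ← Matrix.mul_assoc,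
    Matrix.one_mulVec, Matrix.one_mul] using h2

lemma contDiff_faceSum (h : IsConfig T Φ) (K : Choice T) (e : Ed) :
    ContDiff ℝ ∞ (faceSum T K Φ e) :=
  ContDiff.sum fun l _ =>
    contDiff_linear (eps T e l • mulVecL (hol Φ.h (K.path e l))) (h.ς_smooth l)

/-- With `S c` the value of `σ` at the node `c` transported to the base, the continuity relation
makes each transported `dς` equal to `S (tgt) - S (src)`. Regrouped by nodes, the sum vanishes
because the boundary of a boundary is zero. -/
lemma D_faceSum (h : IsConfig T Φ) (hσ : SigmaInvariant T Φ) (K : Choice T) (e : Ed) {x : V → ℝ}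
    (hx : x ∈ cell (T.edge e)) : D (faceSum T K Φ e) x (T.edgeVec e) = 0 := by
  classical
  have hd : ∀ l, DifferentiableAt ℝ (Φ.ς l) x := fun l => (h.ς_smooth l).differentiable (by simp) x
  -- One reference path from the base to every node around `e`; the empty path for other nodes is a
  -- dummy value.
  have hP : ∀ c, ∃ p, verts (T.edge e) ⊆ verts (T.tet c) → T.IsPath e (K.base e) p c := by
    intro c
    by_cases hc : verts (T.edge e) ⊆ verts (T.tet c)
    · obtain ⟨p, hp⟩ := T.dual_connected e _ c (K.base_mem e) hc
      exact ⟨p, fun _ => hp⟩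
    · exact ⟨[], fun h => absurd h hc⟩
  choose P hP using hP
  let S : C → R4 := fun c => hol Φ.h (P c) *ᵥ Φ.σ c x (T.edgeVec e)
  have key : ∀ l, eps T e l • (hol Φ.h (K.path e l) *ᵥ D (Φ.ς l) x (T.edgeVec e)) =
      -(eps T e l • S (T.src l) - eps T e l • S (T.tgt l)) := by
    intro l
    by_cases h0 : eps T e l = 0
    · simp [h0]
    have hl := around_of_eps_ne_zero h0
    have hs := hl.trans (T.verts_tri_subset_src l)
    have ht := hl.trans (T.verts_tri_subset_tgt l)
    have h1 := h.σ_cont l x (cell_mono hl hx) _ ((T.isTangent_edgeVec e).mono hl)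
    have h2 : D (Φ.ς l) x (T.edgeVec e) =
        Φ.h l *ᵥ Φ.σ (T.tgt l) x (T.edgeVec e) - Φ.σ (T.src l) x (T.edgeVec e) := by
      rw [h1, Matrix.mulVec_mulVec, (h.h_mem l).mul_transpose, Matrix.one_mulVec]
      abel
    have hpl := K.isPath e l hl
    have hpt : T.IsPath e (K.base e) (K.path e l ++ [(l, true)]) (T.tgt l) :=
      IsPathWith.append hpl ⟨hl, rfl, rfl⟩
    have h3 := h.σ_path_unique hσ (K.base_mem e) hs hpl (hP _ hs) hx
    have h4 := h.σ_path_unique hσ (K.base_mem e) ht hpt (hP _ ht) hx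
    rw [hol_append] at h4
    simp only [hol, Matrix.mul_one] at h4
    rw [h2, Matrix.mulVec_sub, Matrix.mulVec_mulVec, h3, h4, ← smul_sub, ← smul_neg, neg_sub]
  have hsum : D (faceSum T K Φ e) x (T.edgeVec e) =
      ∑ l, eps T e l • (hol Φ.h (K.path e l) *ᵥ D (Φ.ς l) x (T.edgeVec e)) := by
    have hf : faceSum T K Φ e =
        fun y => ∑ l, (eps T e l • mulVecL (hol Φ.h (K.path e l))) (Φ.ς l y) := rfl
    rw [hf]
    unfold D
    rw [fderiv_fun_sum fun l _ => differentiableAt_linear _ (hd l), sum_apply]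
    refine Finset.sum_congr rfl fun l _ => ?_
    exact D_linear (eps T e l • mulVecL (hol Φ.h (K.path e l))) (hd l) _
  rw [hsum, Finset.sum_congr rfl fun l _ => key l, Finset.sum_neg_distrib, neg_eq_zero,
    ← T.sum_tetInt_eq fun c l => eps T e l • S c]
  -- What multiplies `S c` is the coefficient of `e` in the boundary of the boundary of the
  -- tetrahedron dual to `c`.
  refine Finset.sum_eq_zero fun c _ => ?_
  simp only [smul_smul, ← Finset.sum_smul]
  rw [show ∑ l, (incidence (T.tet c) (T.tri l) : ℝ) * eps T e l = 0 from T.sum_incidence_mul c e,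
    zero_smul]

lemma faceSum_eq_faceVar (h : IsConfig T Φ) (hσ : SigmaInvariant T Φ) (K : Choice T) (e : Ed)
    {x : V → ℝ} (hx : x ∈ cell (T.edge e)) : faceSum T K Φ e x = faceVar T K Φ e := by
  have hne : T.edge e 0 ≠ T.edge e 1 := fun h => by simpa using T.edge_injective e h
  let γ : ℝ → V → ℝ := fun r => pts (T.edge e) 0 + r • T.edgeVec e
  have hγd : ∀ r, HasDerivAt γ (T.edgeVec e) r := fun r => by
    have := ((hasDerivAt_id r).smul_const (T.edgeVec e)).const_add (pts (T.edge e) 0)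
    rwa [one_smul] at this
  have hγ : ∀ r, γ r = simplexMap (pts (T.edge e)) (fun _ : Fin 1 => r) := fun r => by
    simp [γ, simplexMap, edgeVec]
  have hmem : ∀ r ∈ Set.Icc (0 : ℝ) 1, γ r ∈ cell (T.edge e) := fun r hr => by
    rw [hγ]
    exact simplexMap_mem_cell _ ⟨fun _ => hr.1, by simpa using hr.2⟩
  have hD : ∀ r, HasDerivAt (fun r => faceSum T K Φ e (γ r))
      (D (faceSum T K Φ e) (γ r) (T.edgeVec e)) r := fun r =>
    ((h.contDiff_faceSum K e).differentiable (by simp) (γ r)).hasFDerivAt.comp_hasDerivAt r (hγd r)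
  have hconst := constant_of_has_deriv_right_zero (a := 0) (b := 1)
    (f := fun r => faceSum T K Φ e (γ r)) (fun r _ => (hD r).continuousAt.continuousWithinAt)
    (fun r hr => by
      have := hD r
      rw [h.D_faceSum hσ K e (hmem r ⟨hr.1, hr.2.le⟩)] at this
      exact this.hasDerivWithinAt)
  -- The parameter of a point of the edge is its barycentric coordinate at the second vertex.
  have hxγ : x = γ (x (T.edge e 1)) := by
    have hsum : x (T.edge e 0) + x (T.edge e 1) = 1 := by
      rw [← hx.2.1, ← Finset.sum_pair hne]
      refine Finset.sum_subset (Finset.subset_univ _) fun v _ hv => hx.2.2 v fun hv' => hv ?_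
      obtain ⟨i, rfl⟩ := mem_verts.1 hv'
      fin_cases i <;> simp
    ext v
    simp only [γ, edgeVec, pts, Pi.add_apply, Pi.smul_apply, Pi.sub_apply, Pi.single_apply,
      smul_eq_mul]
    by_cases h0 : v = T.edge e 0
    · subst h0; simp [hne]; linarith
    · by_cases h1 : v = T.edge e 1
      · subst h1; simp [hne.symm]
      · simp only [h0, h1, if_false]
        have : v ∉ verts (T.edge e) := fun hv => by
          obtain ⟨i, hi⟩ := mem_verts.1 hv
          fin_cases i
          · exact h0 hi.symm
          · exact h1 hi.symm
        simpa using hx.2.2 v this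
  have hI : x (T.edge e 1) ∈ Set.Icc (0 : ℝ) 1 :=
    ⟨hx.1 _, by rw [← hx.2.1]; exact Finset.single_le_sum (fun v _ => hx.1 v) (Finset.mem_univ _)⟩
  have h2 := hconst _ hI
  rw [← hxγ] at h2
  rw [h2]
  simp [γ, faceVar]

lemma isSkew_bVar (h : IsConfig T Φ) (K : Choice T) (l : L) : IsSkew (bVar T K Φ l) := by
  have hc : ∀ (c : C) x, DifferentiableAt ℝ (Φ.c c) x := fun c =>
    (h.c_smooth c).differentiable (by simp)
  have hs : ∀ (c : C) u x, DifferentiableAt ℝ (fun y => Φ.σ c y u) x := fun c u =>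
    (h.σ_smooth c u).differentiable (by simp)
  refine IsSkew.add (isSkew_integral fun s => ?_) ?_
  · have hb : ∀ (c : C) x u v, IsSkew (D (fun y => brk (Φ.c c y) (Φ.σ c y v)) x u) :=
      fun c x u v => isSkew_D (differentiableAt_bilin brkL (hc c x) (hs c v x))
        (.of_forall fun y => isSkew_brk _ _) u
    exact ((h.db_skew _ _ _ _).sub ((hb _ _ _ _).sub (hb _ _ _ _))).sub
      ((isSkew_brk _ _).sub (isSkew_brk _ _))
  · exact isSkew_sum _ fun e _ => isSkew_sum _ fun m _ =>
      (isSkew_integral fun s => isSkew_brk _ _).smul _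

end IsConfig

end Config

end BFCG

namespace BFCG

/-! ### Behaviour of the fields across triangles -/

section Tangential

variable {V C L Ed : Type*} [Fintype V] [DecidableEq V] [Fintype C] [DecidableEq C]
  [Fintype L] [DecidableEq L] [Fintype Ed]
  {T : Triangulation V C L Ed} {Φ : Fields V C L}

/-- The action `b ↦ h⁻¹ b h` on `so(4)*`, as a linear map. -/
def conjL (h : Mat) : Mat →ₗ[ℝ] Mat := mulL hᵀ ∘ₗ mulL.flip h

@[simp] lemma conjL_apply (h b : Mat) : conjL h b = hᵀ * b * h := by
  simp [conjL, Matrix.mul_assoc]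

namespace IsConfig

lemma c_differentiable (h : IsConfig T Φ) (c : C) (x : V → ℝ) : DifferentiableAt ℝ (Φ.c c) x :=
  (h.c_smooth c).differentiable (by simp) x

lemma σ_differentiable (h : IsConfig T Φ) (c : C) (u x : V → ℝ) :
    DifferentiableAt ℝ (fun y => Φ.σ c y u) x :=
  (h.σ_smooth c u).differentiable (by simp) x

lemma b_differentiable (h : IsConfig T Φ) (c : C) (u x : V → ℝ) :
    DifferentiableAt ℝ (fun y => Φ.b c y u) x :=
  (h.b_smooth c u).differentiable (by simp) x

lemma contDiff_dσ (h : IsConfig T Φ) (c : C) (u v : V → ℝ) :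
    ContDiff ℝ ∞ (fun x => Φ.dσ c x u v) :=
  (contDiff_D (h.σ_smooth c v) u).sub (contDiff_D (h.σ_smooth c u) v)

lemma contDiff_db (h : IsConfig T Φ) (c : C) (u v : V → ℝ) :
    ContDiff ℝ ∞ (fun x => Φ.db c x u v) :=
  (contDiff_D (h.b_smooth c v) u).sub (contDiff_D (h.b_smooth c u) v)

lemma isAlt_dσ (h : IsConfig T Φ) (c : C) (x : V → ℝ) : IsAlt (Φ.dσ c x) where
  swap u v := (neg_sub _ _).symm
  sub_left u u' v := by
    simp only [Fields.dσ, extD, map_sub, D_map_sub]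
    rw [D_sub (h.σ_differentiable c u x) (h.σ_differentiable c u' x)]
    abel

lemma isAlt_db (h : IsConfig T Φ) (c : C) (x : V → ℝ) : IsAlt (Φ.db c x) where
  swap u v := (neg_sub _ _).symm
  sub_left u u' v := by
    simp only [Fields.db, extD, map_sub, D_map_sub]
    rw [D_sub (h.b_differentiable c u x) (h.b_differentiable c u' x)]
    abel

variable {l : L} {x u v : V → ℝ}

lemma D_c_tgt (h : IsConfig T Φ) (hx : x ∈ openCell (T.tri l)) (hu : IsTangent (T.tri l) u) :
    D (Φ.c (T.tgt l)) x u = (Φ.h l)ᵀ *ᵥ D (Φ.c (T.src l)) x u := by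
  have hd' : DifferentiableAt ℝ (fun y => Φ.c (T.src l) y + Φ.x l) x :=
    (h.c_differentiable _ x).add_const _
  rw [D_congr_of_openCell hx hu (h.c_differentiable _ x)
    (differentiableAt_linear (mulVecL (Φ.h l)ᵀ) hd') (fun y hy => h.c_cont l y hy.1),
    D_linear _ hd', D_add (h.c_differentiable _ x) (differentiableAt_const _), D_const, add_zero]
  rfl

/-- The term `dς` of the continuity relation is closed, so it does not contribute to `dσ`. -/
lemma dσ_tgt (h : IsConfig T Φ) (hx : x ∈ openCell (T.tri l)) (hu : IsTangent (T.tri l) u)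
    (hv : IsTangent (T.tri l) v) :
    Φ.dσ (T.tgt l) x u v = (Φ.h l)ᵀ *ᵥ Φ.dσ (T.src l) x u v := by
  have key : ∀ u v, IsTangent (T.tri l) u → IsTangent (T.tri l) v →
      D (fun y => Φ.σ (T.tgt l) y v) x u =
        mulVecL (Φ.h l)ᵀ (D (fun y => Φ.σ (T.src l) y v) x u + D (fun y => D (Φ.ς l) y v) x u) := by
    intro u v hu hv
    have h1 := h.σ_differentiable (T.src l) v x
    have h2 : DifferentiableAt ℝ (fun y => D (Φ.ς l) y v) x :=
      (contDiff_D (h.ς_smooth l) v).differentiable (by simp) x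
    rw [D_congr_of_openCell hx hu (h.σ_differentiable _ v x)
      (differentiableAt_linear (mulVecL (Φ.h l)ᵀ) (h1.add h2))
      (fun y hy => h.σ_cont l y hy.1 v hv), D_linear _ (h1.add h2)]
    exact congrArg _ (D_add h1 h2 u)
  simp only [Fields.dσ, extD]
  rw [key u v hu hv, key v u hv hu, ← map_sub,
    D_comm ((h.ς_smooth l).contDiffAt.of_le (WithTop.coe_le_coe.2 le_top)) u v, add_sub_add_right_eq_sub]
  rfl

/-- The term `dy` is closed and `x` is constant, so only the bracket of `x` with `dσ` remains. -/
lemma db_tgt (h : IsConfig T Φ) (hx : x ∈ openCell (T.tri l)) (hu : IsTangent (T.tri l) u)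
    (hv : IsTangent (T.tri l) v) :
    Φ.db (T.tgt l) x u v =
      (Φ.h l)ᵀ * (Φ.db (T.src l) x u v + brk (Φ.x l) (Φ.dσ (T.src l) x u v)) * Φ.h l := by
  have key : ∀ u v, IsTangent (T.tri l) u → IsTangent (T.tri l) v →
      D (fun y => Φ.b (T.tgt l) y v) x u = conjL (Φ.h l) (D (fun y => Φ.b (T.src l) y v) x u +
        brkL (Φ.x l) (D (fun y => Φ.σ (T.src l) y v) x u) + D (fun y => D (Φ.y l) y v) x u) := by
    intro u v hu hv
    have h1 := h.b_differentiable (T.src l) v x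
    have h2 := differentiableAt_linear (brkL (Φ.x l)) (h.σ_differentiable (T.src l) v x)
    have h3 : DifferentiableAt ℝ (fun y => D (Φ.y l) y v) x :=
      (contDiff_D (h.y_smooth l) v).differentiable (by simp) x
    rw [D_congr_of_openCell hx hu (h.b_differentiable _ v x)
      (differentiableAt_linear (conjL (Φ.h l)) ((h1.add h2).add h3))
      (fun y hy => (h.b_cont l y hy.1 v hv).trans (conjL_apply _ _).symm),
      D_linear _ ((h1.add h2).add h3)]
    refine congrArg _ ((D_add (h1.add h2) h3 u).trans (congrArg (· + _) ((D_add h1 h2 u).trans ?_)))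
    rw [D_linear _ (h.σ_differentiable (T.src l) v x)]
  simp only [Fields.db, extD]
  rw [key u v hu hv, key v u hv hu, ← map_sub,
    D_comm ((h.y_smooth l).contDiffAt.of_le (WithTop.coe_le_coe.2 le_top)) u v,
    add_sub_add_right_eq_sub, add_sub_add_comm, ← map_sub, conjL_apply]
  rfl

/-- The form `db_c - [c_c, dσ_c]` is continuous across triangles. -/
lemma db_sub_brk_tgt (h : IsConfig T Φ) (hx : x ∈ openCell (T.tri l)) (hu : IsTangent (T.tri l) u)
    (hv : IsTangent (T.tri l) v) :
    Φ.db (T.tgt l) x u v - brk (Φ.c (T.tgt l) x) (Φ.dσ (T.tgt l) x u v) =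
      (Φ.h l)ᵀ * (Φ.db (T.src l) x u v - brk (Φ.c (T.src l) x) (Φ.dσ (T.src l) x u v)) * Φ.h l := by
  have h1 := conj_brk (Φ.h l)ᵀ (Φ.c (T.src l) x + Φ.x l) (Φ.dσ (T.src l) x u v)
  rw [Matrix.transpose_transpose] at h1
  -- The bracket of `Φ.x l` with `dσ` in the jump of `db` cancels against the one produced by the
  -- translation of `c`.
  rw [h.db_tgt hx hu hv, h.dσ_tgt hx hu hv, h.c_cont l x hx.1, ← h1, ← Matrix.sub_mul,
    ← Matrix.mul_sub, brk_add_left]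
  congr 2
  abel

end IsConfig

end Tangential

/-! ## Bounded functions on simplices -/

section Bounded

variable {E E₁ E₂ F : Type*} [NormedAddCommGroup E] [NormedSpace ℝ E]
  [NormedAddCommGroup E₁] [NormedSpace ℝ E₁] [FiniteDimensional ℝ E₁]
  [NormedAddCommGroup E₂] [NormedSpace ℝ E₂] [FiniteDimensional ℝ E₂]
  [NormedAddCommGroup F] [NormedSpace ℝ F]

/-- The function is bounded on the set. -/
def BddOn (S : Set E) (f : E → F) : Prop := ∃ R : ℝ, ∀ x ∈ S, ‖f x‖ ≤ R

variable {S : Set E}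

lemma BddOn.add {f f' : E → F} (h : BddOn S f) (h' : BddOn S f') :
    BddOn S fun x => f x + f' x := by
  obtain ⟨R, hR⟩ := h
  obtain ⟨R', hR'⟩ := h'
  exact ⟨R + R', fun x hx => (norm_add_le _ _).trans (add_le_add (hR x hx) (hR' x hx))⟩

lemma BddOn.sub {f f' : E → F} (h : BddOn S f) (h' : BddOn S f') :
    BddOn S fun x => f x - f' x := by
  obtain ⟨R, hR⟩ := h
  obtain ⟨R', hR'⟩ := h'
  exact ⟨R + R', fun x hx => (norm_sub_le _ _).trans (add_le_add (hR x hx) (hR' x hx))⟩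

lemma BddOn.linear (A : E₁ →ₗ[ℝ] F) {f : E → E₁} (h : BddOn S f) : BddOn S fun x => A (f x) := by
  obtain ⟨R, hR⟩ := h
  exact ⟨‖LinearMap.toContinuousLinearMap A‖ * R, fun x hx =>
    (LinearMap.toContinuousLinearMap A).le_opNorm_of_le (hR x hx)⟩

lemma BddOn.bilin (B : E₁ →ₗ[ℝ] E₂ →ₗ[ℝ] F) {f : E → E₁} {f' : E → E₂} (h : BddOn S f)
    (h' : BddOn S f') : BddOn S fun x => B (f x) (f' x) := by
  obtain ⟨R, hR⟩ := h
  obtain ⟨R', hR'⟩ := h'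
  refine ⟨‖bilinCLM B‖ * R * R', fun x hx => ?_⟩
  exact (bilinCLM B).le_of_opNorm₂_le_of_le le_rfl (hR x hx) (hR' x hx)

/-- The points of a cell have their barycentric coordinates in `[0, 1]`, hence lie in a compact
cube. -/
lemma bddOn_regCell {V : Type*} [Fintype V] [DecidableEq V] {k : ℕ} (s : Fin k → V)
    {f : (V → ℝ) → F} (hf : Continuous f) : BddOn (regCell s) f := by
  obtain ⟨R, hR⟩ := (isCompact_Icc (a := (0 : V → ℝ)) (b := 1)).exists_bound_of_continuousOn
    hf.continuousOn
  refine ⟨R, fun x hx => hR x ⟨hx.1.1, fun v => ?_⟩⟩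
  have h := Finset.single_le_sum (fun v _ => hx.1.1 v) (Finset.mem_univ v)
  rwa [hx.1.2.1] at h

lemma pairing_eq_sum (b X : Mat) : pairing b X = ∑ j, ∑ i, 1 / 2 * b i j * X i j := by
  simp only [pairing, Matrix.trace, Matrix.diag_apply, Matrix.mul_apply, Matrix.transpose_apply,
    Finset.mul_sum, mul_assoc]

/-- The matrix norm in use is the largest absolute value of an entry, and the rows are unit vectors.
-/
lemma IsSO.norm_le {h : Mat} (hh : IsSO h) : ‖h‖ ≤ 1 :=
  (Matrix.norm_le_iff zero_le_one).2 fun i j => by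
    have h1 : ∑ k, h i k * h i k = 1 := by
      have := congrFun (congrFun hh.mul_transpose i) i
      simpa [Matrix.mul_apply] using this
    have h2 := Finset.single_le_sum (fun k _ => mul_self_nonneg (h i k)) (Finset.mem_univ j)
    rw [h1] at h2
    exact abs_le_one_iff_mul_self_le_one.2 h2

end Bounded

end BFCG

namespace BFCG

/-! ### Exactness of the integrand of the potential -/

section Variation

variable {V C L Ed : Type*} [Fintype V] [DecidableEq V] [Fintype C] [DecidableEq C]
  [Fintype L] [DecidableEq L] [Fintype Ed]
  {T : Triangulation V C L Ed} {Φ : ℝ → Fields V C L}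

/-- `Δg_c = δg_c g_c⁻¹`. -/
def Δg (Φ : ℝ → Fields V C L) (c : C) (x : V → ℝ) : Mat :=
  vary (fun t => (Φ t).g c x) * ((Φ 0).g c x)ᵀ

/-- `δσ_c`. -/
def δσ (Φ : ℝ → Fields V C L) (c : C) (x u : V → ℝ) : R4 := vary fun t => (Φ t).σ c x u

/-- `Δh_c^{c'} = δh h⁻¹`. -/
def Δh (Φ : ℝ → Fields V C L) (l : L) : Mat := vary (fun t => (Φ t).h l) * ((Φ 0).h l)ᵀ

/-- `db_c + [dσ_c, c_c]`. -/
def bareB (Φ : Fields V C L) (c : C) (x u v : V → ℝ) : Mat :=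
  Φ.db c x u v - brk (Φ.c c x) (Φ.dσ c x u v)

/-- A primitive of the integrand of the symplectic potential. -/
def primitive (Φ : ℝ → Fields V C L) (c : C) (x u v : V → ℝ) : ℝ :=
  pairing (bareB (Φ 0) c x u v) (Δg Φ c x)
    + (D ((Φ 0).c c) x u ⬝ᵥ δσ Φ c x v - D ((Φ 0).c c) x v ⬝ᵥ δσ Φ c x u)

lemma vary_bilin {E₁ E₂ F : Type*} [NormedAddCommGroup E₁] [NormedSpace ℝ E₁]
    [FiniteDimensional ℝ E₁] [NormedAddCommGroup E₂] [NormedSpace ℝ E₂] [FiniteDimensional ℝ E₂]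
    [NormedAddCommGroup F] [NormedSpace ℝ F] (B : E₁ →ₗ[ℝ] E₂ →ₗ[ℝ] F) {f : ℝ → E₁} {f' : ℝ → E₂}
    (hf : DifferentiableAt ℝ f 0) (hf' : DifferentiableAt ℝ f' 0) :
    vary (fun t => B (f t) (f' t)) = B (vary f) (f' 0) + B (f 0) (vary f') := by
  simp only [vary_eq_D]; exact D_bilin B hf hf' 1

lemma vary_linear {E₁ F : Type*} [NormedAddCommGroup E₁] [NormedSpace ℝ E₁]
    [FiniteDimensional ℝ E₁] [NormedAddCommGroup F] [NormedSpace ℝ F] (A : E₁ →ₗ[ℝ] F) {f : ℝ → E₁}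
    (hf : DifferentiableAt ℝ f 0) : vary (fun t => A (f t)) = A (vary f) := by
  simp only [vary_eq_D]; exact D_linear A hf 1

lemma vary_add {F : Type*} [NormedAddCommGroup F] [NormedSpace ℝ F] {f f' : ℝ → F}
    (hf : DifferentiableAt ℝ f 0) (hf' : DifferentiableAt ℝ f' 0) :
    vary (fun t => f t + f' t) = vary f + vary f' := by
  simp only [vary_eq_D]; exact D_add hf hf' 1

lemma vary_sub {F : Type*} [NormedAddCommGroup F] [NormedSpace ℝ F] {f f' : ℝ → F}
    (hf : DifferentiableAt ℝ f 0) (hf' : DifferentiableAt ℝ f' 0) :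
    vary (fun t => f t - f' t) = vary f - vary f' := by
  simp only [vary_eq_D]; exact D_sub hf hf' 1

/-- The velocity of a family of orthogonal matrices. -/
lemma mul_vary_transpose {h : ℝ → Mat} (hd : DifferentiableAt ℝ h 0) (hh : ∀ t, IsSO (h t)) :
    h 0 * (vary h)ᵀ = -(vary h * (h 0)ᵀ) := by
  have h1 := vary_bilin mulL hd (differentiableAt_linear transL hd)
  rw [vary_linear transL hd] at h1
  have h2 : (fun t => mulL (h t) (transL (h t))) = fun _ => 1 :=
    funext fun t => (hh t).mul_transpose
  rw [h2, vary, deriv_const] at h1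
  simp only [mulL_apply, transL_apply] at h1
  exact eq_neg_of_add_eq_zero_right h1.symm

lemma isSkew_vary_mul {h : ℝ → Mat} (hd : DifferentiableAt ℝ h 0) (hh : ∀ t, IsSO (h t)) :
    IsSkew (vary h * (h 0)ᵀ) := by
  rw [IsSkew, Matrix.transpose_mul, Matrix.transpose_transpose, mul_vary_transpose hd hh]

lemma dot_skew {X : Mat} (hX : IsSkew X) (u w : R4) : w ⬝ᵥ (X *ᵥ u) = -(u ⬝ᵥ (X *ᵥ w)) := by
  rw [dotProduct_mulVec_transpose, hX, Matrix.neg_mulVec, neg_dotProduct, dotProduct_comm]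

namespace IsVariation

variable {c : C} {x : V → ℝ}

lemma g_param (h : IsVariation T Φ) (hx : x ∈ regCell (T.tet c)) :
    DifferentiableAt ℝ (fun t => (Φ t).g c x) 0 :=
  (contDiffAt_param (f := fun t y => (Φ t).g c y) (h.g_smooth c 0 x hx)).differentiableAt (by simp)

lemma σ_param (h : IsVariation T Φ) (c : C) (x u : V → ℝ) :
    DifferentiableAt ℝ (fun t => (Φ t).σ c x u) 0 :=
  (contDiffAt_param (f := fun t y => (Φ t).σ c y u)
    (h.σ_smooth c u).contDiffAt).differentiableAt (by simp)

lemma ς_param (h : IsVariation T Φ) (l : L) (x : V → ℝ) :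
    DifferentiableAt ℝ (fun t => (Φ t).ς l x) 0 :=
  (contDiffAt_param (f := fun t y => (Φ t).ς l y)
    (h.ς_smooth l).contDiffAt).differentiableAt (by simp)

lemma h_param (h : IsVariation T Φ) (l : L) : DifferentiableAt ℝ (fun t => (Φ t).h l) 0 :=
  (h.h_smooth l).differentiable (by simp) 0

lemma contDiff_δσ (h : IsVariation T Φ) (c : C) (u : V → ℝ) : ContDiff ℝ ∞ (δσ Φ c · u) :=
  contDiff_iff_contDiffAt.2 fun _ =>
    contDiffAt_vary (f := fun t y => (Φ t).σ c y u) (h.σ_smooth c u).contDiffAt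

lemma contDiff_δς (h : IsVariation T Φ) (l : L) :
    ContDiff ℝ ∞ (fun x => vary fun t => (Φ t).ς l x) :=
  contDiff_iff_contDiffAt.2 fun _ =>
    contDiffAt_vary (f := fun t y => (Φ t).ς l y) (h.ς_smooth l).contDiffAt

lemma δσ_map_sub (h : IsVariation T Φ) (c : C) (x u v : V → ℝ) :
    δσ Φ c x (u - v) = δσ Φ c x u - δσ Φ c x v := by
  simp only [δσ, map_sub]
  exact vary_sub (h.σ_param c x u) (h.σ_param c x v)

lemma contDiffAt_Δg (h : IsVariation T Φ) (hx : x ∈ regCell (T.tet c)) :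
    ContDiffAt ℝ ∞ (Δg Φ c) x :=
  contDiffAt_bilin mulL (contDiffAt_vary (f := fun t y => (Φ t).g c y) (h.g_smooth c 0 x hx))
    (contDiffAt_linear transL ((h.config 0).g_smooth c x hx))

lemma contDiff_bareB (h : IsVariation T Φ) (c : C) (u v : V → ℝ) :
    ContDiff ℝ ∞ (bareB (Φ 0) c · u v) :=
  ((h.config 0).contDiff_db c u v).sub
    (contDiff_bilin brkL ((h.config 0).c_smooth c) ((h.config 0).contDiff_dσ c u v))

lemma isSkew_Δg (h : IsVariation T Φ) (hx : x ∈ regCell (T.tet c)) : IsSkew (Δg Φ c x) :=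
  isSkew_vary_mul (h.g_param hx) fun t => (h.config t).g_mem c x hx

lemma isSkew_Δh (h : IsVariation T Φ) (l : L) : IsSkew (Δh Φ l) :=
  isSkew_vary_mul (h.h_param l) fun t => (h.config t).h_mem l

/-- Differentiation of `g gᵀ = 1`. This identity is available only on the cell, so the direction has
to be tangent to it. -/
lemma g_D_transpose (h : IsVariation T Φ) (hx : x ∈ openCell (T.tet c)) {u : V → ℝ}
    (hu : IsTangent (T.tet c) u) : D ((Φ 0).g c) x u * ((Φ 0).g c x)ᵀ =
      -((Φ 0).g c x * (D ((Φ 0).g c) x u)ᵀ) := by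
  have hreg := openCell_subset_regCell (by norm_num) (T.tet_injective c) subset_rfl
  have hd : DifferentiableAt ℝ ((Φ 0).g c) x :=
    ((h.config 0).g_smooth c x (hreg hx)).differentiableAt (by simp)
  have hd' := differentiableAt_linear transL hd
  have h1 := D_bilin mulL hd hd' u
  have h2 := D_congr_of_openCell hx hu (differentiableAt_bilin mulL hd hd')
    (differentiableAt_const (1 : Mat))
    fun y hy => ((h.config 0).g_mem c y (hreg hy)).mul_transpose
  rw [h1, D_const, D_linear transL hd] at h2
  exact eq_neg_of_add_eq_zero_left h2

/-- `g_c δA_c g_c⁻¹ = dΔg_c`. -/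
lemma D_Δg (h : IsVariation T Φ) (hx : x ∈ openCell (T.tet c)) {u : V → ℝ}
    (hu : IsTangent (T.tet c) u) :
    D (Δg Φ c) x u = (Φ 0).g c x * δA Φ c x u * ((Φ 0).g c x)ᵀ := by
  have hreg := openCell_subset_regCell (by norm_num) (T.tet_injective c) subset_rfl hx
  have hs := h.g_smooth c 0 x hreg
  have hd : DifferentiableAt ℝ ((Φ 0).g c) x :=
    ((h.config 0).g_smooth c x hreg).differentiableAt (by simp)
  have hv := (contDiffAt_vary (f := fun t y => (Φ t).g c y) hs).differentiableAt (by simp)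
  have hp := h.g_param hreg
  have hDp : DifferentiableAt ℝ (fun t => D ((Φ t).g c) x u) 0 :=
    (contDiffAt_param (f := fun t y => D ((Φ t).g c) y u)
      (contDiffAt_family_D (f := fun t y => (Φ t).g c y) hs u)).differentiableAt (by simp)
  have hvD := vary_D (f := fun t y => (Φ t).g c y) hs u
  have h1 : D (Δg Φ c) x u = _ := D_bilin mulL hv (differentiableAt_linear transL hd) u
  have h2 : δA Φ c x u = _ := vary_bilin mulL (differentiableAt_linear transL hp) hDp
  rw [D_linear transL hd] at h1
  rw [show vary (fun t => ((Φ t).g c x)ᵀ) = _ from vary_linear transL hp, hvD] at h2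
  have h3 := h.g_D_transpose hx hu
  have h4 := mul_vary_transpose hp fun t => (h.config t).g_mem c x hreg
  have h5 := ((h.config 0).g_mem c x hreg).mul_transpose
  have h6 := ((h.config 0).g_mem c x hreg).transpose_mul
  rw [h1, h2]
  simp only [mulL_apply, transL_apply, Matrix.mul_add, Matrix.add_mul]
  generalize (Φ 0).g c x = g at *
  generalize vary (fun t => (Φ t).g c x) = g' at *
  generalize D (fun y => vary fun r => (Φ r).g c y) x u = g'' at *
  generalize D ((Φ 0).g c) x u = k at *
  -- Orthogonality gives a minus sign for the variation and another for the spatial derivative; they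
  -- cancel.
  have h7 : g * (g'ᵀ * k) * gᵀ = g' * kᵀ := by
    rw [← Matrix.mul_assoc, h4, Matrix.mul_assoc, h3, Matrix.neg_mul, Matrix.mul_neg, neg_neg,
      Matrix.mul_assoc, ← Matrix.mul_assoc gᵀ, h6, Matrix.one_mul]
  have h8 : g * (gᵀ * g'') * gᵀ = g'' * gᵀ := by
    rw [← Matrix.mul_assoc, h5, Matrix.one_mul]
  rw [h7, h8, add_comm]

/-- The product rule for `δ(gᵀ dσ)`, read after rotation by `g`: there `g (δg)ᵀ = -Δg`, and `δ`
commutes with `d`. -/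
lemma Ctr_dot_δSig (h : IsVariation T Φ) (hx : x ∈ regCell (T.tet c)) (u v w : V → ℝ) :
    (Φ 0).Ctr c x u ⬝ᵥ δSig Φ c x v w =
      D ((Φ 0).c c) x u ⬝ᵥ extD (δσ Φ c) x v w
        - D ((Φ 0).c c) x u ⬝ᵥ (Δg Φ c x *ᵥ (Φ 0).dσ c x v w) := by
  have hp := h.g_param hx
  have hsD : ∀ v w, DifferentiableAt ℝ (fun t => D (fun y => (Φ t).σ c y w) x v) 0 := fun v w =>
    (contDiffAt_param (f := fun t y => D (fun y => (Φ t).σ c y w) y v)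
      (contDiffAt_family_D (f := fun t y => (Φ t).σ c y w)
        (h.σ_smooth c w).contDiffAt v)).differentiableAt (by simp)
  have hv : ∀ v w, vary (fun t => D (fun y => (Φ t).σ c y w) x v) = D (δσ Φ c · w) x v :=
    fun v w => vary_D (f := fun t y => (Φ t).σ c y w) (h.σ_smooth c w).contDiffAt v
  have h1 : vary (fun t => (Φ t).dσ c x v w) = extD (δσ Φ c) x v w := by
    simp only [Fields.dσ, extD]
    rw [vary_sub (hsD v w) (hsD w v), hv, hv]
  have h2 : δSig Φ c x v w = _ := vary_bilin mulVecL (differentiableAt_linear transL hp)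
    ((hsD v w).sub (hsD w v) : DifferentiableAt ℝ (fun t => (Φ t).dσ c x v w) 0)
  rw [show vary (fun t => ((Φ t).g c x)ᵀ) = _ from vary_linear transL hp, h1] at h2
  have h4 := mul_vary_transpose hp fun t => (h.config t).g_mem c x hx
  have h5 := ((h.config 0).g_mem c x hx).mul_transpose
  have h3 : ∀ (u w : R4) (M : Mat), ((Φ 0).g c x)ᵀ *ᵥ u ⬝ᵥ (M *ᵥ w) =
      u ⬝ᵥ (((Φ 0).g c x * M) *ᵥ w) := fun u w M => by
    rw [← Matrix.mulVec_mulVec, dotProduct_mulVec_transpose u]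
  rw [h2, Fields.Ctr, dotProduct_add]
  simp only [mulVecL_apply, transL_apply, h3, h4, h5, Matrix.one_mulVec, Matrix.neg_mulVec,
    dotProduct_neg, Δg]
  ring

lemma D_primitive (h : IsVariation T Φ) (hx : x ∈ regCell (T.tet c)) (u v w : V → ℝ) :
    D (fun y => primitive Φ c y v w) x u =
      (pairing (D (bareB (Φ 0) c · v w) x u) (Δg Φ c x)
        + pairing (bareB (Φ 0) c x v w) (D (Δg Φ c) x u))
      + ((D (fun y => D ((Φ 0).c c) y v) x u ⬝ᵥ δσ Φ c x w
          + D ((Φ 0).c c) x v ⬝ᵥ D (δσ Φ c · w) x u)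
        - (D (fun y => D ((Φ 0).c c) y w) x u ⬝ᵥ δσ Φ c x v
          + D ((Φ 0).c c) x w ⬝ᵥ D (δσ Φ c · v) x u)) := by
  have hDc : ∀ u, DifferentiableAt ℝ (fun y => D ((Φ 0).c c) y u) x := fun u =>
    (contDiff_D ((h.config 0).c_smooth c) u).differentiable (by simp) x
  have hδ : ∀ u, DifferentiableAt ℝ (δσ Φ c · u) x := fun u =>
    (h.contDiff_δσ c u).differentiable (by simp) x
  have hβ : DifferentiableAt ℝ (bareB (Φ 0) c · v w) x :=
    (h.contDiff_bareB c v w).differentiable (by simp) x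
  have hΔ : DifferentiableAt ℝ (Δg Φ c) x := (h.contDiffAt_Δg hx).differentiableAt (by simp)
  have h1 := D_bilin pairingL hβ hΔ u
  have h2 := D_bilin dotL (hDc v) (hδ w) u
  have h3 := D_bilin dotL (hDc w) (hδ v) u
  have d1 := differentiableAt_bilin pairingL hβ hΔ
  have d2 := differentiableAt_bilin dotL (hDc v) (hδ w)
  have d3 := differentiableAt_bilin dotL (hDc w) (hδ v)
  have h4 := D_add d1 (d2.sub d3) u
  have h5 := D_sub d2 d3 u
  exact h4.trans (congrArg₂ (· + ·) h1 (h5.trans (congrArg₂ (· - ·) h2 h3)))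

/-- In the interior of a tetrahedron, the integrand of the potential is exact. -/
theorem potentialForm_eq (h : IsVariation T Φ) (hx : x ∈ openCell (T.tet c)) {u v w : V → ℝ}
    (hu : IsTangent (T.tet c) u) (hv : IsTangent (T.tet c) v) (hw : IsTangent (T.tet c) w) :
    potentialForm Φ c x u v w = extD2 (primitive Φ c) x u v w := by
  have hreg := openCell_subset_regCell (by norm_num) (T.tet_injective c) subset_rfl hx
  have hcfg := h.config 0
  -- The pairing is invariant under conjugation, so the factors `g` of `B` can be moved to `δA`,
  -- which then becomes `dΔg`.
  have hB : ∀ u v w, IsTangent (T.tet c) w → pairing ((Φ 0).B c x u v) (δA Φ c x w) =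
      pairing (bareB (Φ 0) c x u v) (D (Δg Φ c) x w) := fun u v w hw => by
    rw [h.D_Δg hx hw, ← pairing_conj]; rfl
  have hdb : ∀ u v, DifferentiableAt ℝ (fun y => (Φ 0).db c y u v) x := fun u v =>
    (hcfg.contDiff_db c u v).differentiable (by simp) x
  have hdσ : ∀ u v, DifferentiableAt ℝ (fun y => (Φ 0).dσ c y u v) x := fun u v =>
    (hcfg.contDiff_dσ c u v).differentiable (by simp) x
  have hDprim := h.D_primitive hreg
  have hDβ : ∀ u v w, D (bareB (Φ 0) c · v w) x u = D (fun y => (Φ 0).db c y v w) x u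
      - (brk (D ((Φ 0).c c) x u) ((Φ 0).dσ c x v w)
        + brk ((Φ 0).c c x) (D (fun y => (Φ 0).dσ c y v w) x u)) := by
    intro u v w
    have d1 := differentiableAt_bilin brkL (hcfg.c_differentiable c x) (hdσ v w)
    exact (D_sub (hdb v w) d1 u).trans (congrArg₂ (· - ·) rfl
      (D_bilin brkL (hcfg.c_differentiable c x) (hdσ v w) u))
  have two_le : ((2 : ℕ∞) : WithTop ℕ∞) ≤ ∞ := WithTop.coe_le_coe.2 le_top
  -- The identity `dd = 0`, to be used for both `b` and `σ`.
  have hcyc : ∀ {F : Type} [NormedAddCommGroup F] [NormedSpace ℝ F] {θ : (V → ℝ) → (V → ℝ) → F},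
      (∀ u, ContDiff ℝ ∞ (θ · u)) → D (fun y => extD θ y v w) x u + D (fun y => extD θ y w u) x v
        + D (fun y => extD θ y u v) x w = 0 := by
    intro F _ _ θ hθ
    have hd : ∀ u v, DifferentiableAt ℝ (fun y => D (θ · u) y v) x := fun u v =>
      (contDiff_D (hθ u) v).differentiable (by simp) x
    have hc : ∀ u v w, D (fun y => D (θ · u) y v) x w = D (fun y => D (θ · u) y w) x v :=
      fun u v w => D_comm ((hθ u).contDiffAt.of_le two_le) v w
    simp only [extD]
    rw [D_sub (hd w v) (hd v w), D_sub (hd u w) (hd w u), D_sub (hd v u) (hd u v),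
      hc w v u, hc v w u, hc u w v]
    abel
  have hddb := hcyc (θ := fun y u => (Φ 0).b c y u) (hcfg.b_smooth c)
  have hddσ := hcyc (θ := fun y u => (Φ 0).σ c y u) (hcfg.σ_smooth c)
  change D (fun y => (Φ 0).db c y v w) x u + D (fun y => (Φ 0).db c y w u) x v +
    D (fun y => (Φ 0).db c y u v) x w = 0 at hddb
  change D (fun y => (Φ 0).dσ c y v w) x u + D (fun y => (Φ 0).dσ c y w u) x v +
    D (fun y => (Φ 0).dσ c y u v) x w = 0 at hddσ
  have hsymm : ∀ u v, D (fun y => D ((Φ 0).c c) y u) x v = D (fun y => D ((Φ 0).c c) y v) x u :=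
    fun u v => D_comm ((hcfg.c_smooth c).contDiffAt.of_le two_le) u v
  have hskew := h.isSkew_Δg hreg
  -- Through this identity the term `[dc, dσ]` in the derivative of `bareB` reproduces the term with
  -- `Δg` that comes from `δΣ`.
  have hpb : ∀ u w : R4, pairing (brk u w) (Δg Φ c x) = -(u ⬝ᵥ (Δg Φ c x *ᵥ w)) := fun u w => by
    rw [pairing_brk _ _ _ hskew, dot_skew hskew]
  have e1 := congrArg (fun M => pairingL M (Δg Φ c x)) hddb
  have e2 := congrArg (fun M => pairingL (brkL ((Φ 0).c c x) M) (Δg Φ c x)) hddσ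
  simp only [map_add, LinearMap.add_apply, map_zero, LinearMap.zero_apply, pairingL_apply,
    brkL_apply] at e1 e2
  have hps : ∀ a b X : Mat, pairing (a - b) X = pairing a X - pairing b X := fun a b X =>
    congrArg (fun A : Mat →ₗ[ℝ] ℝ => A X) (pairingL.map_sub a b)
  have hpa : ∀ a b X : Mat, pairing (a + b) X = pairing a X + pairing b X := fun a b X =>
    congrArg (fun A : Mat →ₗ[ℝ] ℝ => A X) (pairingL.map_add a b)
  simp only [potentialForm, extD2, hDprim, hDβ, hB _ _ _ hu, hB _ _ _ hv, hB _ _ _ hw,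
    h.Ctr_dot_δSig hreg, hps, hpa, hpb (D ((Φ 0).c c) x _), extD, dotProduct_sub]
  rw [hsymm v u, hsymm w u, hsymm w v]
  -- What is left over is `ddb` and `[c, ddσ]`, paired with `Δg`.
  linear_combination e2 - e1

end IsVariation

end Variation

end BFCG

namespace BFCG

/-! ### Integrability, and the jump of the primitive across a triangle -/

section Potential

variable {V C L Ed : Type*} [Fintype V] [DecidableEq V] [Fintype C] [DecidableEq C]
  [Fintype L] [DecidableEq L] [Fintype Ed]
  {T : Triangulation V C L Ed} {Φ : ℝ → Fields V C L}

namespace IsVariation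

lemma isAlt_primitive (h : IsVariation T Φ) (c : C) (x : V → ℝ) : IsAlt (primitive Φ c x) := by
  have hσ := (h.config 0).isAlt_dσ c x
  have hb := (h.config 0).isAlt_db c x
  constructor
  · intro u v
    have h1 : bareB (Φ 0) c x u v = -bareB (Φ 0) c x v u := by
      have h2 : ∀ w w' : R4, brk w (-w') = -brk w w' := fun w w' => (brkL w).map_neg w'
      rw [bareB, bareB, hσ.swap u v, hb.swap u v, h2]; abel
    have h2 : ∀ b X : Mat, pairing (-b) X = -pairing b X := fun b X =>
      congrArg (fun A : Mat →ₗ[ℝ] ℝ => A X) (pairingL.map_neg b)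
    simp only [primitive]
    rw [h1, h2]; ring
  · intro u u' v
    have h1 : bareB (Φ 0) c x (u - u') v = bareB (Φ 0) c x u v - bareB (Φ 0) c x u' v := by
      have h2 : ∀ w w' w'' : R4, brk w (w' - w'') = brk w w' - brk w w'' := fun w w' w'' =>
        (brkL w).map_sub w' w''
      rw [bareB, bareB, bareB, hσ.sub_left, hb.sub_left, h2]; abel
    have h2 : ∀ a b X : Mat, pairing (a - b) X = pairing a X - pairing b X := fun a b X =>
      congrArg (fun A : Mat →ₗ[ℝ] ℝ => A X) (pairingL.map_sub a b)
    simp only [primitive, h.δσ_map_sub, D_map_sub, sub_dotProduct, dotProduct_sub]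
    rw [h1, h2]; ring

lemma contDiffAt_primitive (h : IsVariation T Φ) {c : C} {x : V → ℝ} (hx : x ∈ regCell (T.tet c))
    (u v : V → ℝ) : ContDiffAt ℝ ∞ (fun y => primitive Φ c y u v) x := by
  have hD : ∀ u, ContDiffAt ℝ ∞ (fun y => D ((Φ 0).c c) y u) x := fun u =>
    contDiffAt_D ((h.config 0).c_smooth c).contDiffAt u
  have hδ : ∀ u, ContDiffAt ℝ ∞ (δσ Φ c · u) x := fun u => (h.contDiff_δσ c u).contDiffAt
  exact (contDiffAt_bilin pairingL (h.contDiff_bareB c u v).contDiffAt (h.contDiffAt_Δg hx)).add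
    ((contDiffAt_bilin dotL (hD u) (hδ v)).sub (contDiffAt_bilin dotL (hD v) (hδ u)))

/-- Only `Δg` can be singular at the edges, and it is bounded by the definition of a variation; all
other factors are smooth on the closed cell. -/
lemma bddOn_primitive (h : IsVariation T Φ) (c : C) (u v : V → ℝ) :
    BddOn (regCell (T.tet c)) (fun x => primitive Φ c x u v) := by
  have hD : ∀ u, BddOn (regCell (T.tet c)) (fun y => D ((Φ 0).c c) y u) := fun u =>
    bddOn_regCell _ (contDiff_D ((h.config 0).c_smooth c) u).continuous
  have hδ : ∀ u, BddOn (regCell (T.tet c)) (δσ Φ c · u) := fun u =>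
    bddOn_regCell _ (h.contDiff_δσ c u).continuous
  have hb := bddOn_regCell (T.tet c) (h.contDiff_bareB c u v).continuous
  exact (hb.bilin pairingL (h.Δg_bounded c)).add
    (((hD u).bilin dotL (hδ v)).sub ((hD v).bilin dotL (hδ u)))

lemma integrableOn_of_bddOn {F : Type*} [NormedAddCommGroup F] [NormedSpace ℝ F] {n : ℕ}
    {s : Fin (n + 1) → V} (hs : Function.Injective s) {S : Set (V → ℝ)} (hS : openCell s ⊆ S)
    {f : (V → ℝ) → F} (hf : ∀ x ∈ S, ContinuousAt f x) (hb : BddOn S f) :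
    IntegrableOn (fun t => f (simplexMap (pts s) t)) (stdDomain n) := by
  obtain ⟨R, hR⟩ := hb
  have hmem : ∀ t ∈ openDomain n, simplexMap (pts s) t ∈ S := fun t ht =>
    hS (simplexMap_mem_openCell hs ht)
  exact integrableOn_stdDomain_of_bounded (R := R) (fun t ht =>
    ((hf _ (hmem t ht)).comp (continuous_simplexMap _).continuousAt).continuousWithinAt)
    fun t ht => hR _ (hmem t ht)

/-- The term of the integrand that contains `dΔg` is integrable. -/
lemma integrableOn_bareB_D_Δg (h : IsVariation T Φ) (c : C) (u v : V → ℝ) {w : V → ℝ}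
    (hw : IsTangent (T.tet c) w) :
    IntegrableOn (fun s => pairing (bareB (Φ 0) c (simplexMap (pts (T.tet c)) s) u v)
      (D (Δg Φ c) (simplexMap (pts (T.tet c)) s) w)) (stdDomain 3) := by
  have hinj := T.tet_injective c
  have hreg : openCell (T.tet c) ⊆ regCell (T.tet c) :=
    openCell_subset_regCell (by norm_num) hinj subset_rfl
  -- A bound on `dΔg` is not available. The term is rewritten as a pairing of `B`, which is bounded
  -- because `g` is orthogonal, with `δA`, which is integrable by assumption.
  have hB : ∀ i j, BddOn (regCell (T.tet c)) (fun x => (Φ 0).B c x u v i j) := by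
    have hg : BddOn (regCell (T.tet c)) ((Φ 0).g c) :=
      ⟨1, fun x hx => ((h.config 0).g_mem c x hx).norm_le⟩
    have h1 : BddOn (regCell (T.tet c)) ((Φ 0).B c · u v) :=
      ((hg.linear transL).bilin mulL
        (bddOn_regCell (T.tet c) (h.contDiff_bareB c u v).continuous)).bilin mulL hg
    intro i j
    obtain ⟨R, hR⟩ := h1
    exact ⟨R, fun x hx => (Matrix.norm_entry_le_entrywise_sup_norm _).trans (hR x hx)⟩
  have hBc : ∀ i j, ∀ x ∈ regCell (T.tet c), ContinuousAt (fun x => (Φ 0).B c x u v i j) x := by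
    intro i j x hx
    have hg := (h.config 0).g_smooth c x hx
    have h1 : ContDiffAt ℝ ∞ ((Φ 0).B c · u v) x :=
      contDiffAt_bilin mulL (contDiffAt_bilin mulL (contDiffAt_linear transL hg)
        (h.contDiff_bareB c u v).contDiffAt) hg
    exact (contDiffAt_linear (Matrix.entryLinearMap ℝ ℝ i j) h1).continuousAt
  have hint : ∀ i j, IntegrableOn (fun s => 1 / 2 * (Φ 0).B c (simplexMap (pts (T.tet c)) s) u v i j
      * δA Φ c (simplexMap (pts (T.tet c)) s) w i j) (stdDomain 3) := by
    intro i j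
    have hA : IntegrableOn (fun s => δA Φ c (simplexMap (pts (T.tet c)) s) w i j) (stdDomain 3) :=
      h.δA_integrable c w hw i j
    obtain ⟨R, hR⟩ := hB i j
    have hBi := integrableOn_of_bddOn hinj hreg (hBc i j) (hB i j)
    have := hA.bdd_mul (f := fun s => 1 / 2 * (Φ 0).B c (simplexMap (pts (T.tet c)) s) u v i j)
      (c := 1 / 2 * R) (hBi.aestronglyMeasurable.const_mul _) ?_
    · exact this
    · refine ae_stdDomain_of_openDomain fun s hs => ?_
      rw [norm_mul]
      have := hR _ (hreg (simplexMap_mem_openCell hinj hs))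
      norm_num
      simpa using this
  have hsum : IntegrableOn (fun s => ∑ j, ∑ i,
      1 / 2 * (Φ 0).B c (simplexMap (pts (T.tet c)) s) u v i j
      * δA Φ c (simplexMap (pts (T.tet c)) s) w i j) (stdDomain 3) :=
    integrable_finsetSum _ fun j _ => integrable_finsetSum _ fun i _ => hint i j
  refine Integrable.congr hsum (ae_stdDomain_of_openDomain fun s hs => ?_)
  have hx := simplexMap_mem_openCell hinj hs
  have h1 : pairing (bareB (Φ 0) c (simplexMap (pts (T.tet c)) s) u v)
      (D (Δg Φ c) (simplexMap (pts (T.tet c)) s) w) =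
      pairing ((Φ 0).B c (simplexMap (pts (T.tet c)) s) u v)
        (δA Φ c (simplexMap (pts (T.tet c)) s) w) := by
    rw [h.D_Δg hx hw, ← pairing_conj]; rfl
  exact (h1.trans (pairing_eq_sum _ _)).symm

/-- By the product rule, every term is bounded except the one with `dΔg`, which
`integrableOn_bareB_D_Δg` treats. -/
lemma integrableOn_D_primitive (h : IsVariation T Φ) (c : C) {u : V → ℝ} (v w : V → ℝ)
    (hu : IsTangent (T.tet c) u) :
    IntegrableOn (fun s => D (fun y => primitive Φ c y v w) (simplexMap (pts (T.tet c)) s) u)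
      (stdDomain 3) := by
  have hinj := T.tet_injective c
  have hreg : openCell (T.tet c) ⊆ regCell (T.tet c) :=
    openCell_subset_regCell (by norm_num) hinj subset_rfl
  have hDc : ∀ u, ContDiff ℝ ∞ (fun y => D ((Φ 0).c c) y u) := fun u =>
    contDiff_D ((h.config 0).c_smooth c) u
  have hδ := h.contDiff_δσ c
  have hβ := contDiff_D (h.contDiff_bareB c v w) u
  have h1 : IntegrableOn (fun s => pairing (D (bareB (Φ 0) c · v w) (simplexMap (pts (T.tet c)) s) u)
      (Δg Φ c (simplexMap (pts (T.tet c)) s))) (stdDomain 3) :=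
    integrableOn_of_bddOn hinj hreg
      (f := fun x => pairing (D (bareB (Φ 0) c · v w) x u) (Δg Φ c x))
      (fun x hx => (contDiffAt_bilin pairingL hβ.contDiffAt (h.contDiffAt_Δg hx)).continuousAt)
      ((bddOn_regCell _ hβ.continuous).bilin pairingL (h.Δg_bounded c))
  have h2 : ∀ v w, ContDiff ℝ ∞ (fun x => D (fun y => D ((Φ 0).c c) y v) x u ⬝ᵥ δσ Φ c x w
          + D ((Φ 0).c c) x v ⬝ᵥ D (δσ Φ c · w) x u) := fun v w =>
    (contDiff_bilin dotL (contDiff_D (hDc v) u) (hδ w)).add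
      (contDiff_bilin dotL (hDc v) (contDiff_D (hδ w) u))
  have h3 := integrableOn_stdDomain_of_continuous
    (((h2 v w).sub (h2 w v)).continuous.comp (continuous_simplexMap (pts (T.tet c))))
  refine Integrable.congr ((h1.add (h.integrableOn_bareB_D_Δg c v w hu)).add h3)
    (ae_stdDomain_of_openDomain fun s hs => ?_)
  exact (h.D_primitive (hreg (simplexMap_mem_openCell hinj hs)) u v w).symm

theorem integrableOn_potentialForm (h : IsVariation T Φ) (c : C) {u v w : V → ℝ}
    (hu : IsTangent (T.tet c) u) (hv : IsTangent (T.tet c) v) (hw : IsTangent (T.tet c) w) :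
    IntegrableOn (fun s => potentialForm Φ c (simplexMap (pts (T.tet c)) s) u v w)
      (stdDomain 3) := by
  refine Integrable.congr (((h.integrableOn_D_primitive c v w hu).add
    (h.integrableOn_D_primitive c w u hv)).add (h.integrableOn_D_primitive c u v hw))
    (ae_stdDomain_of_openDomain fun s hs => ?_)
  exact (h.potentialForm_eq (simplexMap_mem_openCell (T.tet_injective c) hs) hu hv hw).symm

theorem tetInt_potentialForm (h : IsVariation T Φ) (c : C) : T.tetInt c (potentialForm Φ c) =
    ∑ l, (incidence (T.tet c) (T.tri l) : ℝ) • T.triInt l (primitive Φ c) := by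
  rw [← T.tetInt_extD2 c (h.isAlt_primitive c)
    (fun u v x hx => (h.contDiffAt_primitive hx u v).differentiableAt (by simp))
    (fun u v w hu => h.integrableOn_D_primitive c v w hu) (fun u v => h.bddOn_primitive c u v)]
  exact setIntegral_stdDomain_congr fun s hs =>
    h.potentialForm_eq (simplexMap_mem_openCell (T.tet_injective c) hs)
      (isTangent_pts_sub _ _ _) (isTangent_pts_sub _ _ _) (isTangent_pts_sub _ _ _)

/-- The jump of the primitive across a triangle. -/
lemma primitive_sub (h : IsVariation T Φ) {l : L} {x u v : V → ℝ} (hx : x ∈ openCell (T.tri l))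
    (hu : IsTangent (T.tri l) u) (hv : IsTangent (T.tri l) v) :
    primitive Φ (T.src l) x u v - primitive Φ (T.tgt l) x u v =
      pairing ((Φ 0).db (T.src l) x u v
        - extD (fun y w => brk ((Φ 0).c (T.src l) y) ((Φ 0).σ (T.src l) y w)) x u v
        - (brk (D ((Φ 0).c (T.src l)) x u) (D ((Φ 0).ς l) x v)
          - brk (D ((Φ 0).c (T.src l)) x v) (D ((Φ 0).ς l) x u))) (Δh Φ l)
      + extD (fun y w => D ((Φ 0).c (T.src l)) y w ⬝ᵥ vary fun t => (Φ t).ς l y) x u v := by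
  have hcfg := h.config 0
  have hrt : x ∈ regCell (T.tet (T.tgt l)) :=
    openCell_subset_regCell le_rfl (T.tri_injective l) (T.verts_tri_subset_tgt l) hx
  have hskew := h.isSkew_Δh l
  have hh := h.h_param l
  -- the jump of `Δg`
  have hΔ : Δg Φ (T.src l) x = Δh Φ l + (Φ 0).h l * Δg Φ (T.tgt l) x * ((Φ 0).h l)ᵀ := by
    have h1 : (fun t => (Φ t).g (T.src l) x) = fun t => mulL ((Φ t).h l) ((Φ t).g (T.tgt l) x) :=
      funext fun t => (h.config t).g_cont l x hx
    have h2 := vary_bilin mulL hh (h.g_param hrt)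
    have h3 := (hcfg.g_mem _ x hrt).mul_transpose
    simp only [Δg, Δh]
    rw [h1, h2, hcfg.g_cont l x hx]
    simp only [mulL_apply, Matrix.transpose_mul, Matrix.add_mul, Matrix.mul_assoc]
    rw [← Matrix.mul_assoc ((Φ 0).g (T.tgt l) x), h3, Matrix.one_mul]
  -- the jump of `δσ`
  have hδ : ∀ v, IsTangent (T.tri l) v → δσ Φ (T.tgt l) x v =
      (vary fun t => (Φ t).h l)ᵀ *ᵥ ((Φ 0).σ (T.src l) x v + D ((Φ 0).ς l) x v) +
      ((Φ 0).h l)ᵀ *ᵥ (δσ Φ (T.src l) x v + D (fun y => vary fun t => (Φ t).ς l y) x v) := by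
    intro v hv
    have h1 : (fun t => (Φ t).σ (T.tgt l) x v) = fun t =>
        mulVecL (transL ((Φ t).h l)) ((Φ t).σ (T.src l) x v + D ((Φ t).ς l) x v) :=
      funext fun t => (h.config t).σ_cont l x hx.1 v hv
    have hς := (h.ς_smooth l).contDiffAt (x := ((0 : ℝ), x))
    have d1 := h.σ_param (T.src l) x v
    have d2 : DifferentiableAt ℝ (fun t => D ((Φ t).ς l) x v) 0 :=
      (contDiffAt_param (f := fun t y => D ((Φ t).ς l) y v)
        (contDiffAt_family_D (f := fun t y => (Φ t).ς l y) hς v)).differentiableAt (by simp)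
    have h2 := vary_bilin mulVecL (differentiableAt_linear transL hh) (d1.add d2)
    have h3 := vary_add d1 d2
    rw [show vary (fun t => D ((Φ t).ς l) x v) = _ from
      vary_D (f := fun t y => (Φ t).ς l y) hς v] at h3
    rw [vary_linear transL hh] at h2
    rw [δσ, h1]
    exact h2.trans (congrArg₂ (· + ·) rfl (congrArg _ h3))
  have hcσ : ∀ u v, D (fun y => brk ((Φ 0).c (T.src l) y) ((Φ 0).σ (T.src l) y v)) x u =
      brk (D ((Φ 0).c (T.src l)) x u) ((Φ 0).σ (T.src l) x v) +
        brk ((Φ 0).c (T.src l) x) (D (fun y => (Φ 0).σ (T.src l) y v) x u) := fun u v =>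
    D_bilin brkL (hcfg.c_differentiable _ x) (hcfg.σ_differentiable _ v x) u
  have hcς : ∀ u v, D (fun y => D ((Φ 0).c (T.src l)) y v ⬝ᵥ vary fun t => (Φ t).ς l y) x u =
      D (fun y => D ((Φ 0).c (T.src l)) y v) x u ⬝ᵥ vary (fun t => (Φ t).ς l x) +
      D ((Φ 0).c (T.src l)) x v ⬝ᵥ D (fun y => vary fun t => (Φ t).ς l y) x u := fun u v =>
    D_bilin dotL ((contDiff_D (hcfg.c_smooth _) v).differentiable (by simp) x)
      ((h.contDiff_δς l).differentiable (by simp) x) u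
  have hsymm := D_comm ((hcfg.c_smooth (T.src l)).contDiffAt (x := x).of_le
    (WithTop.coe_le_coe.2 le_top : ((2 : ℕ∞) : WithTop ℕ∞) ≤ ∞)) u v
  have hB : bareB (Φ 0) (T.tgt l) x u v =
      ((Φ 0).h l)ᵀ * bareB (Φ 0) (T.src l) x u v * (Φ 0).h l := hcfg.db_sub_brk_tgt hx hu hv
  have hpb : ∀ u w : R4, pairing (brk u w) (Δh Φ l) = -(u ⬝ᵥ (Δh Φ l *ᵥ w)) := fun u w => by
    rw [pairing_brk _ _ _ hskew, dot_skew hskew]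
  have hps : ∀ a b X : Mat, pairing (a - b) X = pairing a X - pairing b X := fun a b X =>
    congrArg (fun A : Mat →ₗ[ℝ] ℝ => A X) (pairingL.map_sub a b)
  have hpa : ∀ a b X : Mat, pairing (a + b) X = pairing a X + pairing b X := fun a b X =>
    congrArg (fun A : Mat →ₗ[ℝ] ℝ => A X) (pairingL.map_add a b)
  have hpa' : ∀ a X Y : Mat, pairing a (X + Y) = pairing a X + pairing a Y := fun a X Y =>
    (pairingL a).map_add X Y
  have hdot : ∀ (u w : R4) (M : Mat), ((Φ 0).h l)ᵀ *ᵥ u ⬝ᵥ (M *ᵥ w) =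
      u ⬝ᵥ (((Φ 0).h l * M) *ᵥ w) := fun u w M => by
    rw [← Matrix.mulVec_mulVec, dotProduct_mulVec_transpose u]
  have hneg : (Φ 0).h l * (vary fun t => (Φ t).h l)ᵀ = -Δh Φ l :=
    mul_vary_transpose hh fun t => (h.config t).h_mem l
  -- The `Δg` terms at the two nodes differ by the pairing of `bareB` with `Δh`. The jump of `dc ∧
  -- δσ` supplies the pairings of `-[dc ∧ σ]` and `-[dc ∧ dς]` with `Δh`, together with `-dc ∧ dδς`,
  -- which is the derivative of `dc · δς`.
  simp only [primitive, hB, pairing_conj, hcfg.D_c_tgt hx hu, hcfg.D_c_tgt hx hv, hδ v hv, hδ u hu,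
    dotProduct_add, hdot, hneg, (hcfg.h_mem l).mul_transpose, Matrix.one_mulVec, Matrix.neg_mulVec,
    dotProduct_neg, hΔ, hpa', extD, hcσ, hcς, hps, hpa, hpb (D ((Φ 0).c (T.src l)) x _),
    Matrix.mulVec_add]
  rw [hsymm]
  simp only [bareB, Fields.dσ, extD, hps, brk_sub_right]
  ring

end IsVariation

end Potential

end BFCG

namespace BFCG

/-! ### From jumps across triangles to the discrete potential -/

section PotentialSum

variable {V C L Ed : Type*} [Fintype V] [DecidableEq V] [Fintype C] [DecidableEq C]
  [Fintype L] [DecidableEq L] [Fintype Ed]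
  {T : Triangulation V C L Ed} {Φ : ℝ → Fields V C L}

lemma continuous_linkTerm {E : Type*} [TopologicalSpace E] (h : L → Mat) (l : L)
    (p : List (L × Bool)) {w : E → R4} (hw : Continuous w) :
    Continuous fun x => linkTerm h l p (w x) := by
  induction p with
  | nil => exact continuous_const
  | cons m p ih =>
    obtain ⟨m, b⟩ := m
    cases b <;> by_cases hm : m = l <;> simp only [linkTerm, hm, if_true, if_false, zero_add] <;>
      fun_prop

/-- The integrand of the bulk part of the triangle variable. -/
def bulkForm (Φ : Fields V C L) (l : L) (x u v : V → ℝ) : Mat :=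
  Φ.db (T.src l) x u v
    - extD (fun y w => brk (Φ.c (T.src l) y) (Φ.σ (T.src l) y w)) x u v
    - (brk (D (Φ.c (T.src l)) x u) (D (Φ.ς l) x v) - brk (D (Φ.c (T.src l)) x v) (D (Φ.ς l) x u))

lemma IsConfig.continuous_bulkForm {Φ : Fields V C L} (h : IsConfig T Φ) (l : L) (u v : V → ℝ) :
    Continuous fun x => bulkForm (T := T) Φ l x u v := by
  have h1 : ∀ u v, ContDiff ℝ ∞ fun x => D (fun y => brk (Φ.c (T.src l) y) (Φ.σ (T.src l) y v)) x u :=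
    fun u v => contDiff_D (contDiff_bilin brkL (h.c_smooth _) (h.σ_smooth _ v)) u
  have h2 : ∀ u v, ContDiff ℝ ∞ fun x => brk (D (Φ.c (T.src l)) x u) (D (Φ.ς l) x v) := fun u v =>
    contDiff_bilin brkL (contDiff_D (h.c_smooth _) u) (contDiff_D (h.ς_smooth l) v)
  exact (((h.contDiff_db _ u v).sub ((h1 u v).sub (h1 v u))).sub ((h2 u v).sub (h2 v u))).continuous

namespace IsVariation

lemma hol_param (h : IsVariation T Φ) (p : List (L × Bool)) :
    DifferentiableAt ℝ (fun t => hol (Φ t).h p) 0 := by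
  induction p with
  | nil => exact differentiableAt_const _
  | cons m p ih =>
    obtain ⟨m, b⟩ := m
    cases b
    · exact differentiableAt_bilin mulL (differentiableAt_linear transL (h.h_param m)) ih
    · exact differentiableAt_bilin mulL (h.h_param m) ih

/-- The transport terms of the triangle variables describe the variation of a holonomy. -/
lemma sum_pairing_linkTerm (h : IsVariation T Φ) {e : Ed} {x : V → ℝ}
    (hx : x ∈ openCell (T.edge e)) (w : R4) : ∀ {a : C} {p : List (L × Bool)} {b : C},
    T.IsPath e a p b →
    ∑ l, pairing (brk (D ((Φ 0).c (T.src l)) x (T.edgeVec e)) (linkTerm (Φ 0).h l p w)) (Δh Φ l) =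
      -(D ((Φ 0).c a) x (T.edgeVec e) ⬝ᵥ (vary (fun t => hol (Φ t).h p) *ᵥ w))
  | a, [], _, hp => by
    have h1 : vary (fun t => hol (Φ t).h []) = 0 := by simp only [hol, vary, deriv_const]
    have h2 : ∀ u : R4, brk u 0 = 0 := fun u => (brkL u).map_zero
    simp [h1, linkTerm, h2, pairing]
  | a, (m, s) :: p, b, hp => by
    have hadd : ∀ (l : L) (w w' : R4) (u : R4), pairing (brk u (w + w')) (Δh Φ l) =
        pairing (brk u w) (Δh Φ l) + pairing (brk u w') (Δh Φ l) := fun l w w' u => by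
      rw [brk_add_right]
      exact congrArg (fun A : Mat →ₗ[ℝ] ℝ => A (Δh Φ l)) (pairingL.map_add _ _)
    have hite : ∀ (u : L → R4) (w : R4), ∑ l, pairing (brk (u l) (if m = l then w else 0)) (Δh Φ l)
        = pairing (brk (u m) w) (Δh Φ m) := fun u w => by
      rw [Finset.sum_eq_single m]
      · simp
      · intro l _ hl
        rw [if_neg hl.symm, show brk (u l) 0 = 0 from (brkL (u l)).map_zero]
        simp [pairing]
      · simp
    have hpb : ∀ u w : R4, pairing (brk u w) (Δh Φ m) = -(u ⬝ᵥ (Δh Φ m *ᵥ w)) := fun u w => by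
      rw [pairing_brk _ _ _ (h.isSkew_Δh m), dot_skew (h.isSkew_Δh m)]
    have hm := h.h_param m
    have hsm := (h.config 0).h_mem m
    -- Induction on the path: the first link contributes its own `Δh` by the Leibniz rule, and the
    -- rest of the path contributes the variation of its holonomy.
    have hΔ : vary (fun t => (Φ t).h m) = Δh Φ m * (Φ 0).h m := by
      rw [Δh, Matrix.mul_assoc, hsm.transpose_mul, Matrix.mul_one]
    cases s
    · obtain ⟨hl, rfl, hp⟩ := hp
      have h1 : vary (fun t => hol (Φ t).h ((m, false) :: p)) = _ :=
        vary_bilin mulL (differentiableAt_linear transL hm) (h.hol_param p)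
      rw [show vary (fun t => ((Φ t).h m)ᵀ) = _ from vary_linear transL hm, hΔ] at h1
      have h2 := (h.config 0).D_c_path (p := [(m, true)]) (a := T.src m) (b := T.tgt m)
        ⟨hl, rfl, rfl⟩ hx
      simp only [hol, Matrix.mul_one] at h2
      simp only [linkTerm, hadd, Finset.sum_add_distrib]
      rw [hite (fun l => D ((Φ 0).c (T.src l)) x (T.edgeVec e)), sum_pairing_linkTerm h hx w hp, h1,
        hpb, h2]
      simp only [mulL_apply, transL_apply, Matrix.add_mulVec, dotProduct_add,
        Matrix.transpose_mul]
      -- For a link traversed backwards, `δ(hᵀ) = -hᵀ Δh`; this is the origin of the minus sign in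
      -- `linkTerm`.
      have h3 : (Δh Φ m)ᵀ = -Δh Φ m := h.isSkew_Δh m
      have h4 : ∀ (u w : R4) (M : Mat), ((Φ 0).h m)ᵀ *ᵥ u ⬝ᵥ (M *ᵥ w) =
          u ⬝ᵥ (((Φ 0).h m * M) *ᵥ w) := fun u w M => by
        rw [← Matrix.mulVec_mulVec, dotProduct_mulVec_transpose u]
      rw [h3, h4, h4]
      simp only [← Matrix.mul_assoc, hsm.mul_transpose, Matrix.one_mul, Matrix.mulVec_neg,
        dotProduct_neg, Matrix.mul_neg, Matrix.neg_mul, Matrix.neg_mulVec, Matrix.mulVec_mulVec]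
      ring
    · obtain ⟨hl, rfl, hp⟩ := hp
      have h1 : vary (fun t => hol (Φ t).h ((m, true) :: p)) = _ :=
        vary_bilin mulL hm (h.hol_param p)
      rw [hΔ] at h1
      have h2 := (h.config 0).D_c_path (p := [(m, true)]) (a := T.src m) (b := T.tgt m)
        ⟨hl, rfl, rfl⟩ hx
      simp only [hol, Matrix.mul_one] at h2
      simp only [linkTerm, hadd, Finset.sum_add_distrib]
      rw [hite (fun l => D ((Φ 0).c (T.src l)) x (T.edgeVec e)), sum_pairing_linkTerm h hx w hp, h1,
        hpb, h2]
      simp only [mulL_apply, Matrix.add_mulVec, dotProduct_add, ← Matrix.mulVec_mulVec]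
      rw [dotProduct_mulVec_transpose _ _ ((Φ 0).h m)]
      ring

/-- The sum over the sides of a dual polygon. -/
lemma sum_edgeInt (h : IsVariation T Φ) (hσ : ∀ t, SigmaInvariant T (Φ t)) (K : Choice T) (e : Ed) :
    ∑ m, eps T e m • T.edgeInt e
        (fun x u => D ((Φ 0).c (T.src m)) x u ⬝ᵥ vary fun t => (Φ t).ς m x) =
      ellVar T K (Φ 0) e ⬝ᵥ (vary fun t => faceVar T K (Φ t) e) +
      ∑ m, eps T e m • ∑ l, pairing (edgeBrk T (Φ 0) e (T.src l)
        fun x => linkTerm (Φ 0).h l (K.path e m) ((Φ 0).ς m x)) (Δh Φ l) := by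
  have hcfg := h.config 0
  have hDc : ∀ c u, Continuous fun x => D ((Φ 0).c c) x u := fun c u =>
    (contDiff_D (hcfg.c_smooth c) u).continuous
  have hf1 : ∀ m u, Continuous fun x => D ((Φ 0).c (T.src m)) x u ⬝ᵥ vary fun t => (Φ t).ς m x :=
    fun m u => (contDiff_bilin dotL (contDiff_D (hcfg.c_smooth _) u) (h.contDiff_δς m)).continuous
  have hf2 : ∀ l m u, Continuous fun x => brk (D ((Φ 0).c (T.src l)) x u)
      (linkTerm (Φ 0).h l (K.path e m) ((Φ 0).ς m x)) := fun l m u =>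
    (bilinCLM brkL).continuous₂.comp ((hDc _ u).prodMk
      (continuous_linkTerm _ _ _ (hcfg.ς_smooth m).continuous))
  have hf3 : ∀ l m u, Continuous fun x => pairing (brk (D ((Φ 0).c (T.src l)) x u)
      (linkTerm (Φ 0).h l (K.path e m) ((Φ 0).ς m x))) (Δh Φ l) := fun l m u =>
    (LinearMap.continuous_of_finiteDimensional (pairingL.flip (Δh Φ l))).comp (hf2 l m u)
  have e1 : ∀ m l, pairing (edgeBrk T (Φ 0) e (T.src l)
        fun x => linkTerm (Φ 0).h l (K.path e m) ((Φ 0).ς m x)) (Δh Φ l) =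
      T.edgeInt e fun x u => pairing (brk (D ((Φ 0).c (T.src l)) x u)
        (linkTerm (Φ 0).h l (K.path e m) ((Φ 0).ς m x))) (Δh Φ l) := fun m l =>
    (T.edgeInt_linear e (pairingL.flip (Δh Φ l)) (hf2 l m)).symm
  have e2 : ellVar T K (Φ 0) e ⬝ᵥ (vary fun t => faceVar T K (Φ t) e) =
      T.edgeInt e fun x u => D ((Φ 0).c (K.base e)) x u ⬝ᵥ (vary fun t => faceVar T K (Φ t) e) :=
    (T.edgeInt_linear e (dotL.flip (vary fun t => faceVar T K (Φ t) e)) (hDc _)).symm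
  have hf4 : ∀ u, Continuous fun x =>
      D ((Φ 0).c (K.base e)) x u ⬝ᵥ (vary fun t => faceVar T K (Φ t) e) := fun u =>
    (LinearMap.continuous_of_finiteDimensional
      (dotL.flip (vary fun t => faceVar T K (Φ t) e))).comp (hDc _ u)
  have hf5 : ∀ m u, Continuous fun x => ∑ l, pairing (brk (D ((Φ 0).c (T.src l)) x u)
      (linkTerm (Φ 0).h l (K.path e m) ((Φ 0).ς m x))) (Δh Φ l) := fun m u =>
    continuous_finsetSum _ fun l _ => hf3 l m u
  have hf6 : ∀ m u, Continuous fun x => eps T e m • ∑ l, pairing (brk (D ((Φ 0).c (T.src l)) x u)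
      (linkTerm (Φ 0).h l (K.path e m) ((Φ 0).ς m x))) (Δh Φ l) := fun m u =>
    continuous_const.mul (hf5 m u)
  have e3 : ∑ m, eps T e m • ∑ l, pairing (edgeBrk T (Φ 0) e (T.src l)
        fun x => linkTerm (Φ 0).h l (K.path e m) ((Φ 0).ς m x)) (Δh Φ l) =
      T.edgeInt e fun x u => ∑ m, eps T e m • ∑ l, pairing (brk (D ((Φ 0).c (T.src l)) x u)
        (linkTerm (Φ 0).h l (K.path e m) ((Φ 0).ς m x))) (Δh Φ l) := by
    rw [T.edgeInt_sum e Finset.univ (θ := fun m x u => eps T e m •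
      ∑ l, pairing (brk (D ((Φ 0).c (T.src l)) x u)
        (linkTerm (Φ 0).h l (K.path e m) ((Φ 0).ς m x))) (Δh Φ l)) hf6]
    refine Finset.sum_congr rfl fun m _ => ?_
    have h1 := T.edgeInt_linear e (eps T e m • LinearMap.id) (hf5 m)
    refine Eq.trans ?_ h1.symm
    rw [T.edgeInt_sum e Finset.univ (θ := fun l x u => pairing (brk (D ((Φ 0).c (T.src l)) x u)
        (linkTerm (Φ 0).h l (K.path e m) ((Φ 0).ς m x))) (Δh Φ l)) (fun l u => hf3 l m u)]
    simp only [e1]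
    rfl
  have e4 : ∑ m, eps T e m • T.edgeInt e
        (fun x u => D ((Φ 0).c (T.src m)) x u ⬝ᵥ vary fun t => (Φ t).ς m x) =
      T.edgeInt e fun x u => ∑ m, eps T e m •
        (D ((Φ 0).c (T.src m)) x u ⬝ᵥ vary fun t => (Φ t).ς m x) := by
    rw [T.edgeInt_sum e Finset.univ (θ := fun m x u => eps T e m •
        (D ((Φ 0).c (T.src m)) x u ⬝ᵥ vary fun t => (Φ t).ς m x))
        fun m u => continuous_const.mul (hf1 m u)]
    exact Finset.sum_congr rfl fun m _ =>
      (T.edgeInt_linear e (eps T e m • LinearMap.id) (hf1 m)).symm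
  rw [e4, e3, e2, ← T.edgeInt_add e hf4 fun u => continuous_finsetSum _ fun m _ => hf6 m u]
  refine T.edgeInt_congr fun x hx => ?_
  -- the variation of the face variable at the point `x`
  have hV : vary (fun t => faceVar T K (Φ t) e) = ∑ m, eps T e m •
      (vary (fun t => hol (Φ t).h (K.path e m)) *ᵥ (Φ 0).ς m x
        + hol (Φ 0).h (K.path e m) *ᵥ vary fun t => (Φ t).ς m x) := by
    -- Since every member of the family satisfies the invariance assumption, the face variable may
    -- be evaluated at the point of integration for all parameters, before varying.
    have h1 : (fun t => faceVar T K (Φ t) e) = fun t => ∑ m, eps T e m •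
        (hol (Φ t).h (K.path e m) *ᵥ (Φ t).ς m x) :=
      funext fun t => ((h.config t).faceSum_eq_faceVar (hσ t) K e hx.1).symm
    have hd : ∀ m, DifferentiableAt ℝ (fun t => hol (Φ t).h (K.path e m) *ᵥ (Φ t).ς m x) 0 :=
      fun m => differentiableAt_bilin mulVecL (h.hol_param _) (h.ς_param m x)
    have h2 := HasDerivAt.fun_sum (u := Finset.univ)
      (A := fun m t => eps T e m • (hol (Φ t).h (K.path e m) *ᵥ (Φ t).ς m x))
      fun m _ => (hd m).hasDerivAt.const_smul (eps T e m)
    rw [h1, vary, h2.deriv]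
    refine Finset.sum_congr rfl fun m _ => ?_
    exact congrArg _ (vary_bilin mulVecL (h.hol_param _) (h.ς_param m x))
  rw [hV, dotProduct_sum, ← Finset.sum_add_distrib]
  refine Finset.sum_congr rfl fun m _ => ?_
  -- For links not around `e` the chosen list need not be a path, but then the coefficient vanishes.
  by_cases h0 : eps T e m = 0
  · simp [h0]
  have hp := K.isPath e m (Triangulation.around_of_eps_ne_zero h0)
  rw [h.sum_pairing_linkTerm hx _ hp, hcfg.D_c_path hp hx, dotProduct_smul, dotProduct_add,
    dotProduct_mulVec_transpose _ _ (hol (Φ 0).h (K.path e m)), ← smul_add]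
  congr 1
  ring

/-- Stokes' theorem is used twice: from tetrahedra to triangles for the primitive, and from
triangles to edges for the exact part of its jump. The edge terms are then redistributed by
`sum_edgeInt` between `⟨ℓ, δV⟩` and the corrections contained in `bVar`. -/
theorem thetaBFCG_eq (h : IsVariation T Φ) (hσ : ∀ t, SigmaInvariant T (Φ t)) (K : Choice T) :
    ThetaBFCG T Φ = discretePotential (Φ 0).h (bVar T K (Φ 0)) (ellVar T K (Φ 0))
      (fun l => vary fun t => (Φ t).h l) (fun e => vary fun t => faceVar T K (Φ t) e) := by
  have hcfg := h.config 0
  have hint : ∀ (c : C) l, verts (T.tri l) ⊆ verts (T.tet c) → ∀ u v,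
      IntegrableOn (fun t => primitive Φ c (simplexMap (pts (T.tri l)) t) u v) (stdDomain 2) :=
    fun c l hl u v => integrableOn_of_bddOn (T.tri_injective l)
      (f := fun x => primitive Φ c x u v)
      (openCell_subset_regCell le_rfl (T.tri_injective l) hl)
      (fun x hx => (h.contDiffAt_primitive hx u v).continuousAt) (h.bddOn_primitive c u v)
  have hθ : ∀ (l : L) u, ContDiff ℝ ∞
      (fun x => D ((Φ 0).c (T.src l)) x u ⬝ᵥ vary fun t => (Φ t).ς l x) := fun l u =>
    contDiff_bilin dotL (contDiff_D (hcfg.c_smooth _) u) (h.contDiff_δς l)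
  have hjump : ∀ l, T.triInt l (primitive Φ (T.src l)) - T.triInt l (primitive Φ (T.tgt l)) =
      pairing (bulk T (Φ 0) l) (Δh Φ l) + ∑ e, eps T e l • T.edgeInt e
        (fun x u => D ((Φ 0).c (T.src l)) x u ⬝ᵥ vary fun t => (Φ t).ς l x) := by
    intro l
    have h1 : T.triInt l (primitive Φ (T.src l)) - T.triInt l (primitive Φ (T.tgt l)) =
        T.triInt l fun x u v => primitive Φ (T.src l) x u v - primitive Φ (T.tgt l) x u v :=
      (integral_sub (hint _ l (T.verts_tri_subset_src l) _ _)
        (hint _ l (T.verts_tri_subset_tgt l) _ _)).symm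
    rw [h1, T.triInt_congr fun x hx u v hu hv => h.primitive_sub hx hu hv]
    have hc1 := fun u v => (LinearMap.continuous_of_finiteDimensional
      (pairingL.flip (Δh Φ l))).comp (hcfg.continuous_bulkForm l u v)
    have hc2 : ∀ u v, Continuous fun x => extD (fun y w =>
        D ((Φ 0).c (T.src l)) y w ⬝ᵥ vary fun t => (Φ t).ς l y) x u v := fun u v =>
      ((contDiff_D (hθ l v) u).sub (contDiff_D (hθ l u) v)).continuous
    refine (T.triInt_add l hc1 hc2).trans (congrArg₂ (· + ·) ?_ ?_)
    · exact T.triInt_linear l (pairingL.flip (Δh Φ l)) (hcfg.continuous_bulkForm l)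
    · exact T.triInt_extD l (fun u => (hθ l u).of_le (mod_cast le_top)) fun x u v => by
        rw [D_map_sub, sub_dotProduct]
  have hb : ∀ l, pairing (bVar T K (Φ 0) l) (Δh Φ l) = pairing (bulk T (Φ 0) l) (Δh Φ l) +
      ∑ e, ∑ m, eps T e m • pairing (edgeBrk T (Φ 0) e (T.src l)
        fun x => linkTerm (Φ 0).h l (K.path e m) ((Φ 0).ς m x)) (Δh Φ l) := by
    intro l
    have : ∀ b, pairing b (Δh Φ l) = pairingL.flip (Δh Φ l) b := fun b => rfl
    simp only [this, bVar, map_add, map_sum, map_smul]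
  calc ThetaBFCG T Φ = ∑ c, ∑ l, (incidence (T.tet c) (T.tri l) : ℝ) • T.triInt l (primitive Φ c) :=
      Finset.sum_congr rfl fun c _ => h.tetInt_potentialForm c
    _ = ∑ l, pairing (bulk T (Φ 0) l) (Δh Φ l) + ∑ e, ∑ l, eps T e l • T.edgeInt e
        (fun x u => D ((Φ 0).c (T.src l)) x u ⬝ᵥ vary fun t => (Φ t).ς l x) := by
      rw [T.sum_tetInt_eq fun c l => T.triInt l (primitive Φ c), Finset.sum_comm (s := Finset.univ)
        (t := Finset.univ) (f := fun e l => eps T e l • T.edgeInt e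
        (fun x u => D ((Φ 0).c (T.src l)) x u ⬝ᵥ vary fun t => (Φ t).ς l x)),
        ← Finset.sum_add_distrib]
      exact Finset.sum_congr rfl fun l _ => hjump l
    _ = ∑ l, pairing (bVar T K (Φ 0) l) (Δh Φ l) +
        ∑ e, ellVar T K (Φ 0) e ⬝ᵥ vary fun t => faceVar T K (Φ t) e := by
      rw [Finset.sum_congr rfl fun e _ => h.sum_edgeInt hσ K e, Finset.sum_add_distrib,
        Finset.sum_congr rfl fun l _ => hb l, Finset.sum_add_distrib, Finset.sum_comm (γ := L)]
      have : ∀ e, ∑ m, eps T e m • ∑ l, pairing (edgeBrk T (Φ 0) e (T.src l)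
          fun x => linkTerm (Φ 0).h l (K.path e m) ((Φ 0).ς m x)) (Δh Φ l) =
          ∑ l, ∑ m, eps T e m • pairing (edgeBrk T (Φ 0) e (T.src l)
          fun x => linkTerm (Φ 0).h l (K.path e m) ((Φ 0).ς m x)) (Δh Φ l) := fun e => by
        rw [Finset.sum_comm]
        simp only [Finset.smul_sum]
      simp only [this]
      ring

end IsVariation

end PotentialSum

end BFCG

namespace BFCG

/-! ## The phase space -/

section Phase

variable {L Ed : Type*} [Fintype L] [Fintype Ed]

lemma D_linear_self {E F : Type*} [NormedAddCommGroup E] [NormedSpace ℝ E] [FiniteDimensional ℝ E]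
    [NormedAddCommGroup F] [NormedSpace ℝ F] (A : E →ₗ[ℝ] F) (x u : E) : D (fun y => A y) x u = A u :=
  (D_linear A differentiableAt_id u).trans (by simp [D])

lemma D_sum {ι E F : Type*} [NormedAddCommGroup E] [NormedSpace ℝ E] [NormedAddCommGroup F]
    [NormedSpace ℝ F] (s : Finset ι) {f : ι → E → F} {x : E}
    (hf : ∀ i ∈ s, DifferentiableAt ℝ (f i) x) (u : E) :
    D (fun y => ∑ i ∈ s, f i y) x u = ∑ i ∈ s, D (f i) x u := by
  simp only [D]
  rw [fderiv_fun_sum hf, sum_apply]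

/-- The coordinate projections of the ambient space. -/
def projH (l : L) : Ambient L Ed →ₗ[ℝ] Mat := LinearMap.proj l ∘ₗ LinearMap.fst ℝ _ _

/-- The coordinate projections of the ambient space. -/
def projB (l : L) : Ambient L Ed →ₗ[ℝ] Mat :=
  LinearMap.proj l ∘ₗ LinearMap.fst ℝ _ _ ∘ₗ LinearMap.snd ℝ _ _

/-- The coordinate projections of the ambient space. -/
def projEll (e : Ed) : Ambient L Ed →ₗ[ℝ] R4 :=
  LinearMap.proj e ∘ₗ LinearMap.fst ℝ _ _ ∘ₗ LinearMap.snd ℝ _ _ ∘ₗ LinearMap.snd ℝ _ _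

/-- The coordinate projections of the ambient space. -/
def projV (e : Ed) : Ambient L Ed →ₗ[ℝ] R4 :=
  LinearMap.proj e ∘ₗ LinearMap.snd ℝ _ _ ∘ₗ LinearMap.snd ℝ _ _ ∘ₗ LinearMap.snd ℝ _ _

variable (z w w' X : Ambient L Ed)

lemma D_hFun (l : L) (α β : Fin 4) : D (hFun l α β) z w = w.1 l α β :=
  D_linear_self (Matrix.entryLinearMap ℝ ℝ α β ∘ₗ projH (Ed := Ed) l) z w

lemma D_bFun (l : L) (σ ρ : Fin 4) : D (bFun l σ ρ) z w = pairing (w.2.1 l) (J σ ρ) :=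
  D_linear_self (pairingL.flip (J σ ρ) ∘ₗ projB (Ed := Ed) l) z w

lemma D_ellFun (e : Ed) (α : Fin 4) : D (ellFun e α) z w = w.2.2.1 e α :=
  D_linear_self ((LinearMap.proj α : R4 →ₗ[ℝ] ℝ) ∘ₗ projEll (L := L) e) z w

lemma D_VFun (e : Ed) (α : Fin 4) : D (VFun e α) z w = w.2.2.2 e α :=
  D_linear_self ((LinearMap.proj α : R4 →ₗ[ℝ] ℝ) ∘ₗ projV (L := L) e) z w

lemma D_discretePotential (v : Ambient L Ed) :
    D (fun y : Ambient L Ed => discretePotential y.1 y.2.1 y.2.2.1 v.1 v.2.2.2) z w =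
      ∑ l, (pairing (w.2.1 l) (v.1 l * (z.1 l)ᵀ) + pairing (z.2.1 l) (v.1 l * (w.1 l)ᵀ)) +
        ∑ e, w.2.2.1 e ⬝ᵥ v.2.2.2 e := by
  have hproj : ∀ {F : Type} [NormedAddCommGroup F] [NormedSpace ℝ F] (A : Ambient L Ed →ₗ[ℝ] F),
      DifferentiableAt ℝ (fun y => A y) z := fun A => differentiableAt_linear A differentiableAt_id
  let M : L → Ambient L Ed →ₗ[ℝ] Mat := fun l => mulL (v.1 l) ∘ₗ transL ∘ₗ projH l
  have d1 : ∀ l, DifferentiableAt ℝ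
      (fun y : Ambient L Ed => pairing (y.2.1 l) (v.1 l * (y.1 l)ᵀ)) z :=
    fun l => differentiableAt_bilin pairingL (hproj (projB l)) (hproj (M l))
  have d2 : ∀ e, DifferentiableAt ℝ (fun y : Ambient L Ed => y.2.2.1 e ⬝ᵥ v.2.2.2 e) z :=
    fun e => hproj (dotL.flip (v.2.2.2 e) ∘ₗ projEll e)
  simp only [discretePotential]
  rw [D_add (DifferentiableAt.fun_sum fun l _ => d1 l) (DifferentiableAt.fun_sum fun e _ => d2 e),
    D_sum _ fun l _ => d1 l, D_sum _ fun e _ => d2 e]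
  refine congrArg₂ (· + ·) (Finset.sum_congr rfl fun l _ => ?_) (Finset.sum_congr rfl fun e _ => ?_)
  · have h1 := D_bilin pairingL (hproj (projB l)) (hproj (M l)) w
    rw [D_linear_self, D_linear_self] at h1
    exact h1
  · exact D_linear_self (dotL.flip (v.2.2.2 e) ∘ₗ projEll (L := L) e) z w

lemma omega_eq : omega z w w' =
    ∑ l, (pairing (w.2.1 l) (w'.1 l * (z.1 l)ᵀ) + pairing (z.2.1 l) (w'.1 l * (w.1 l)ᵀ)
      - pairing (w'.2.1 l) (w.1 l * (z.1 l)ᵀ) - pairing (z.2.1 l) (w.1 l * (w'.1 l)ᵀ)) +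
    ∑ e, (w.2.2.1 e ⬝ᵥ w'.2.2.2 e - w'.2.2.1 e ⬝ᵥ w.2.2.2 e) := by
  rw [omega, extD, D_discretePotential, D_discretePotential]
  simp only [Finset.sum_sub_distrib, Finset.sum_add_distrib]
  ring

lemma omega_sub_left : omega z (w - w') X = omega z w X - omega z w' X := by
  have hps : ∀ a b X : Mat, pairing (a - b) X = pairing a X - pairing b X := fun a b X =>
    congrArg (fun A : Mat →ₗ[ℝ] ℝ => A X) (pairingL.map_sub a b)
  have hps' : ∀ a X Y : Mat, pairing a (X - Y) = pairing a X - pairing a Y := fun a X Y =>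
    (pairingL a).map_sub X Y
  simp only [omega_eq, Prod.fst_sub, Prod.snd_sub, Pi.sub_apply, hps, hps', Matrix.transpose_sub,
    Matrix.mul_sub, Matrix.sub_mul, sub_dotProduct, dotProduct_sub, Finset.sum_sub_distrib,
    Finset.sum_add_distrib]
  ring

lemma pairing_self (a : Mat) : pairing a a = 1 / 2 * ∑ j, ∑ i, a i j ^ 2 := by
  rw [pairing_eq_sum, Finset.mul_sum]
  refine Finset.sum_congr rfl fun j _ => ?_
  rw [Finset.mul_sum]
  exact Finset.sum_congr rfl fun i _ => by ring

lemma pairing_self_nonneg (a : Mat) : 0 ≤ pairing a a := by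
  rw [pairing_self]; positivity

lemma eq_zero_of_pairing_self {a : Mat} (h : pairing a a = 0) : a = 0 := by
  rw [pairing_self] at h
  have h1 : ∑ j, ∑ i, a i j ^ 2 = 0 := by linarith
  rw [Finset.sum_eq_zero_iff_of_nonneg fun j _ => Finset.sum_nonneg fun i _ => sq_nonneg _] at h1
  ext i j
  have h2 := h1 j (Finset.mem_univ j)
  rw [Finset.sum_eq_zero_iff_of_nonneg fun i _ => sq_nonneg _] at h2
  exact pow_eq_zero_iff two_ne_zero |>.1 (h2 i (Finset.mem_univ i))

variable {z w w' X}

lemma mul_transpose_mul {h : Mat} (hh : IsSO h) (M : Mat) : M * hᵀ * h = M := by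
  rw [Matrix.mul_assoc, hh.transpose_mul, Matrix.mul_one]

lemma mul_mul_transpose {h : Mat} (hh : IsSO h) (M : Mat) : M * h * hᵀ = M := by
  rw [Matrix.mul_assoc, hh.mul_transpose, Matrix.mul_one]

/-- The symplectic form is nondegenerate. -/
theorem omega_nondegenerate (hz : InPhase z) (hX : IsTangentPhase z X)
    (h : ∀ w, IsTangentPhase z w → omega z X w = 0) : X = 0 := by
  have hp0 : ∀ a : Mat, pairing a 0 = 0 := fun a => (pairingL a).map_zero
  -- With `b`-component `X_h hᵀ`, the test vector gives minus the squared length of `X_h hᵀ`, summed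
  -- over the links.
  have h1 := h (0, fun l => X.1 l * (z.1 l)ᵀ, 0, 0)
    ⟨fun l => by simpa using isSkew_zero, fun l => hX.1 l⟩
  simp only [omega_eq, Pi.zero_apply, Matrix.zero_mul, Matrix.transpose_zero, Matrix.mul_zero, hp0,
    zero_sub, sub_zero, dotProduct_zero, zero_dotProduct, Finset.sum_const_zero, add_zero,
    Finset.sum_neg_distrib, neg_eq_zero] at h1
  rw [Finset.sum_eq_zero_iff_of_nonneg fun l _ => pairing_self_nonneg _] at h1
  have hh : X.1 = 0 := by
    ext1 l
    rw [← mul_transpose_mul (hz.1 l) (X.1 l), eq_zero_of_pairing_self (h1 l (Finset.mem_univ l)),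
      Matrix.zero_mul]
    rfl
  -- Once the `h`-component of `X` is zero, this test vector turns `omega` into a sum of squares of
  -- the three other components. The minus sign compensates the antisymmetry in `(ℓ, V)`.
  have h2 := h (fun l => X.2.1 l * z.1 l, 0, -X.2.2.2, X.2.2.1)
    ⟨fun l => by simpa only [mul_mul_transpose (hz.1 l)] using hX.2 l,
      fun l => by simpa using isSkew_zero⟩
  simp only [omega_eq, hh, Pi.zero_apply, Matrix.zero_mul, Matrix.transpose_zero, Matrix.mul_zero,
    hp0, add_zero, sub_zero, mul_mul_transpose (hz.1 _), Pi.neg_apply, neg_dotProduct,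
    sub_neg_eq_add] at h2
  have hb0 : 0 ≤ ∑ l, pairing (X.2.1 l) (X.2.1 l) := Finset.sum_nonneg fun l _ =>
    pairing_self_nonneg _
  have hnn : ∀ v : R4, 0 ≤ v ⬝ᵥ v := fun v => Finset.sum_nonneg fun i _ => mul_self_nonneg _
  have he0 : ∀ e ∈ (Finset.univ : Finset Ed),
      0 ≤ X.2.2.1 e ⬝ᵥ X.2.2.1 e + X.2.2.2 e ⬝ᵥ X.2.2.2 e := fun e _ => add_nonneg (hnn _) (hnn _)
  obtain ⟨h3, h4⟩ := (add_eq_zero_iff_of_nonneg hb0 (Finset.sum_nonneg he0)).1 h2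
  rw [Finset.sum_eq_zero_iff_of_nonneg fun l _ => pairing_self_nonneg _] at h3
  rw [Finset.sum_eq_zero_iff_of_nonneg he0] at h4
  have h5 := fun e => (add_eq_zero_iff_of_nonneg (hnn _) (hnn _)).1 (h4 e (Finset.mem_univ e))
  refine Prod.ext hh (Prod.ext ?_ (Prod.ext ?_ ?_))
  · exact funext fun l => eq_zero_of_pairing_self (h3 l (Finset.mem_univ l))
  · exact funext fun e => dotProduct_self_eq_zero.1 (h5 e).1
  · exact funext fun e => dotProduct_self_eq_zero.1 (h5 e).2

/-- The difference of two Hamiltonian vectors of the same function is in the kernel of `omega`, so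
exhibiting one such vector determines the bracket. -/
lemma IsHamiltonian.hasPoisson (hz : InPhase z) {f f' : Ambient L Ed → ℝ}
    (hX : IsHamiltonian z f X) {r : ℝ} (hr : D f' z X = r) : HasPoisson z f f' r := by
  refine ⟨X, hX, fun X' hX' => ?_, hr⟩
  have hT : IsTangentPhase z (X' - X) :=
    ⟨fun l => by
      simpa only [Prod.fst_sub, Pi.sub_apply, Matrix.sub_mul] using (hX'.1.1 l).sub (hX.1.1 l),
      fun l => (hX'.1.2 l).sub (hX.1.2 l)⟩
  refine sub_eq_zero.1 (omega_nondegenerate hz hT fun w hw => ?_)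
  rw [omega_sub_left, hX.2 w hw, hX'.2 w hw, sub_self]

variable [DecidableEq L] [DecidableEq Ed]

lemma isHamiltonian_ellFun (z : Ambient L Ed) (e : Ed) (α : Fin 4) :
    IsHamiltonian z (ellFun e α) (0, 0, 0, Pi.single e (-Pi.single α 1)) := by
  refine ⟨⟨fun l => by simpa using isSkew_zero, fun l => by simpa using isSkew_zero⟩, fun w _ => ?_⟩
  rw [D_ellFun, omega_eq]
  simp [pairing, Pi.single_apply, apply_ite, Finset.sum_ite_eq']

lemma isHamiltonian_VFun (z : Ambient L Ed) (e : Ed) (α : Fin 4) :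
    IsHamiltonian z (VFun e α) (0, 0, Pi.single e (Pi.single α 1), 0) := by
  refine ⟨⟨fun l => by simpa using isSkew_zero, fun l => by simpa using isSkew_zero⟩, fun w _ => ?_⟩
  rw [D_VFun, omega_eq]
  rw [Finset.sum_eq_single e (fun e' _ he => by simp [Pi.single_eq_of_ne he]) (by simp)]
  simp [pairing]

/-- For a tangent vector written as `a h` with `a` skew, the derivative of the coordinate is `e_α ·
a h_β`, where `h_β` is a column of `h`. This is the pairing of `[h_β, e_α]` with `a`. -/
lemma isHamiltonian_hFun (hz : InPhase z) (l : L) (α β : Fin 4) :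
    IsHamiltonian z (hFun l α β)
      (0, Pi.single l (brk (fun k => z.1 l k β) (Pi.single α 1)), 0, 0) := by
  refine ⟨⟨fun l => by simpa using isSkew_zero, fun l' => ?_⟩, fun w hw => ?_⟩
  · simp only [Pi.single_apply]
    split_ifs
    · exact isSkew_brk _ _
    · exact isSkew_zero
  · rw [D_hFun, omega_eq, Finset.sum_eq_single l]
    · have h1 := pairing_brk (fun k => z.1 l k β) (Pi.single α 1) _ (hw.1 l)
      have h2 : (w.1 l * (z.1 l)ᵀ) *ᵥ (fun k => z.1 l k β) = fun k => w.1 l k β := by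
        ext i
        exact congrFun (congrFun (mul_transpose_mul (hz.1 l) (w.1 l)) i) β
      rw [h2, single_one_dotProduct] at h1
      simpa [pairing] using h1
    · intro l' _ hl
      simp [pairing, hl]
    · simp

lemma isSkew_J (σ ρ : Fin 4) : IsSkew (J σ ρ) := by
  simp [IsSkew, J, Matrix.transpose_single]

/-- The vector generates the left rotation of `h` and the conjugation of `b` by `exp(-tJ)`. The
potential is invariant under this flow and takes the value `-⟨b, J⟩` on the vector, so by Cartan's
formula the contraction with `omega` is the differential of `⟨b, J⟩`. The proof checks this with
traces. -/
lemma isHamiltonian_bFun (hz : InPhase z) (l : L) (σ ρ : Fin 4) :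
    IsHamiltonian z (bFun l σ ρ) (Pi.single l (-(J σ ρ * z.1 l)),
      Pi.single l (z.2.1 l * J σ ρ - J σ ρ * z.2.1 l), 0, 0) := by
  have hJ : (J σ ρ)ᵀ = -J σ ρ := isSkew_J σ ρ
  refine ⟨⟨fun l' => ?_, fun l' => ?_⟩, fun w hw => ?_⟩
  · by_cases h : l' = l
    · subst h
      simp only [Pi.single_eq_same, Matrix.neg_mul, mul_mul_transpose (hz.1 l')]
      rw [IsSkew, Matrix.transpose_neg, hJ]
    · simpa [h] using isSkew_zero
  · by_cases h : l' = l
    · subst h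
      have hb : (z.2.1 l')ᵀ = -z.2.1 l' := hz.2 l'
      simp only [Pi.single_eq_same, IsSkew, Matrix.transpose_sub, Matrix.transpose_mul, hJ, hb]
      simp
    · simpa [h] using isSkew_zero
  · rw [D_bFun, omega_eq, Finset.sum_eq_single l]
    -- Right trivialisation: the `h`-component of a tangent vector is `a h` with `a` skew.
    · set a := w.1 l * (z.1 l)ᵀ with ha
      have hw1 : w.1 l = a * z.1 l := (mul_transpose_mul (hz.1 l) _).symm
      have haT : aᵀ = -a := hw.1 l
      have e1 : w.1 l * (-(J σ ρ * z.1 l))ᵀ = a * J σ ρ := by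
        rw [Matrix.transpose_neg, Matrix.transpose_mul, hJ, hw1, Matrix.mul_neg, Matrix.mul_neg,
          Matrix.mul_neg, neg_neg, ← Matrix.mul_assoc, mul_mul_transpose (hz.1 l)]
      have e2 : -(J σ ρ * z.1 l) * (w.1 l)ᵀ = J σ ρ * a := by
        rw [hw1, Matrix.transpose_mul, haT, Matrix.neg_mul, Matrix.mul_neg, Matrix.mul_neg, neg_neg,
          ← Matrix.mul_assoc, mul_mul_transpose (hz.1 l)]
      have e3 : -(J σ ρ * z.1 l) * (z.1 l)ᵀ = -J σ ρ := by
        rw [Matrix.neg_mul, mul_mul_transpose (hz.1 l)]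
      simp only [Pi.single_eq_same, e1, e2, e3, Pi.zero_apply, zero_dotProduct,
        dotProduct_zero, sub_zero, Finset.sum_const_zero, add_zero]
      simp only [pairing, Matrix.transpose_sub, Matrix.transpose_mul, hJ, Matrix.sub_mul,
        Matrix.neg_mul, Matrix.mul_neg, Matrix.trace_neg, Matrix.trace_sub]
      have t1 : ((z.2.1 l)ᵀ * (a * J σ ρ)).trace = (J σ ρ * (z.2.1 l)ᵀ * a).trace := by
        rw [← Matrix.mul_assoc, Matrix.trace_mul_comm, Matrix.mul_assoc]
      have t2 : ((z.2.1 l)ᵀ * (J σ ρ * a)).trace = ((z.2.1 l)ᵀ * J σ ρ * a).trace := by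
        rw [← Matrix.mul_assoc]
      rw [t1, t2]
      ring
    · intro l' _ hl
      simp [pairing, hl]
    · simp

lemma pairing_J {b : Mat} (hb : IsSkew b) (σ ρ : Fin 4) : pairing b (J σ ρ) = b ρ σ := by
  have h1 : b σ ρ = -b ρ σ := congrFun (congrFun hb ρ) σ
  have h2 : ∀ i j, (bᵀ * Matrix.single i j (1 : ℝ)).trace = b i j := fun i j => by
    rw [Matrix.trace_mul_single]; simp
  rw [pairing, J, Matrix.mul_sub, Matrix.trace_sub, h2, h2, h1]
  ring

/-- A commutator of skew matrices is skew, and pairing a skew matrix with `J α β` reads off its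
entry `(β, α)`. The four terms are the four products with elementary matrices. -/
lemma pairing_commutator_J {b : Mat} (hb : IsSkew b) (σ ρ α β : Fin 4) :
    pairing (b * J σ ρ - J σ ρ * b) (J α β) =
      (if σ = α then pairing b (J ρ β) else 0) + (if ρ = β then pairing b (J σ α) else 0)
        - (if σ = β then pairing b (J ρ α) else 0) - (if ρ = α then pairing b (J σ β) else 0) := by
  have hJ : (J σ ρ)ᵀ = -J σ ρ := isSkew_J σ ρ
  have hs : IsSkew (b * J σ ρ - J σ ρ * b) := by
    have hb' : bᵀ = -b := hb
    simp only [IsSkew, Matrix.transpose_sub, Matrix.transpose_mul, hJ, hb']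
    simp
  have hanti : ∀ i j, b i j = -b j i := fun i j => congrFun (congrFun hb j) i
  simp only [pairing_J hb]
  rw [pairing_J hs]
  simp only [J, Matrix.mul_sub, Matrix.sub_mul, Matrix.sub_apply]
  have h1 : ∀ i j, (b * Matrix.single i j (1 : ℝ)) β α = if j = α then b β i else 0 := fun i j => by
    simp [Matrix.mul_apply, Matrix.single_apply, ite_and]
  have h2 : ∀ i j, (Matrix.single i j (1 : ℝ) * b) β α = if i = β then b j α else 0 := fun i j => by
    simp [Matrix.mul_apply, Matrix.single_apply, ite_and]
  rw [h1, h1, h2, h2, hanti α σ, hanti α ρ]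
  split_ifs <;> ring

/-- The Poisson brackets of the phase space of `G`-networks. -/
theorem phase_brackets (hz : InPhase z) :
    (∀ X, IsTangentPhase z X → (∀ w, IsTangentPhase z w → omega z X w = 0) → X = 0) ∧
    (∀ e e' α β, HasPoisson z (ellFun e α) (VFun e' β) (if e = e' ∧ α = β then -1 else 0)) ∧
    (∀ l l' α β σ ρ, HasPoisson z (hFun l α β) (bFun l' σ ρ)
      (if l = l' then (J σ ρ * z.1 l) α β else 0)) ∧
    (∀ l l' σ ρ α β, HasPoisson z (bFun l σ ρ) (bFun l' α β)
      (if l = l' then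
        (if σ = α then bFun l ρ β z else 0) + (if ρ = β then bFun l σ α z else 0)
          - (if σ = β then bFun l ρ α z else 0) - (if ρ = α then bFun l σ β z else 0)
      else 0)) ∧
    (∀ l l' α β γ κ, HasPoisson z (hFun l α β) (hFun l' γ κ) 0) ∧
    (∀ e e' α β, HasPoisson z (ellFun e α) (ellFun e' β) 0) ∧
    (∀ e e' α β, HasPoisson z (VFun e α) (VFun e' β) 0) ∧
    (∀ l e α β γ, HasPoisson z (hFun l α β) (ellFun e γ) 0) ∧
    (∀ l e α β γ, HasPoisson z (hFun l α β) (VFun e γ) 0) ∧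
    (∀ l e σ ρ γ, HasPoisson z (bFun l σ ρ) (ellFun e γ) 0) ∧
    (∀ l e σ ρ γ, HasPoisson z (bFun l σ ρ) (VFun e γ) 0) := by
  have hp0 : ∀ a : Mat, pairing 0 a = 0 := fun a =>
    congrArg (fun A : Mat →ₗ[ℝ] ℝ => A a) pairingL.map_zero
  refine ⟨fun X hX h => omega_nondegenerate hz hX h,
    fun e e' α β => (isHamiltonian_ellFun z e α).hasPoisson hz ?_,
    fun l l' α β σ ρ => (isHamiltonian_hFun hz l α β).hasPoisson hz ?_,
    fun l l' σ ρ α β => (isHamiltonian_bFun hz l σ ρ).hasPoisson hz ?_,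
    fun l l' α β γ κ => (isHamiltonian_hFun hz l α β).hasPoisson hz ?_,
    fun e e' α β => (isHamiltonian_ellFun z e α).hasPoisson hz ?_,
    fun e e' α β => (isHamiltonian_VFun z e α).hasPoisson hz ?_,
    fun l e α β γ => (isHamiltonian_hFun hz l α β).hasPoisson hz ?_,
    fun l e α β γ => (isHamiltonian_hFun hz l α β).hasPoisson hz ?_,
    fun l e σ ρ γ => (isHamiltonian_bFun hz l σ ρ).hasPoisson hz ?_,
    fun l e σ ρ γ => (isHamiltonian_bFun hz l σ ρ).hasPoisson hz ?_⟩
  · rw [D_VFun]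
    by_cases h : e = e' <;> by_cases h' : α = β <;> simp [h, h', eq_comm]
  · rw [D_bFun]
    by_cases h : l = l'
    · subst h
      simp only [Pi.single_eq_same, if_true]
      rw [pairing_brk _ _ _ (isSkew_J σ ρ), single_one_dotProduct]
      rfl
    · simp [h, hp0, Ne.symm h]
  · rw [D_bFun]
    by_cases h : l = l'
    · subst h
      simp only [Pi.single_eq_same, if_true]
      exact pairing_commutator_J (hz.2 l) σ ρ α β
    · simp [h, hp0, Ne.symm h]
  · rw [D_hFun]; rfl
  · rw [D_ellFun]; rfl
  · rw [D_VFun]; rfl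
  · rw [D_ellFun]; rfl
  · rw [D_VFun]; rfl
  · rw [D_ellFun]; rfl
  · rw [D_VFun]; rfl

end Phase

end BFCG

namespace BFCG

/-! ### The modified 1-Gauss constraint -/

section OneGauss

variable {V C L Ed : Type*} [Fintype V] [DecidableEq V] [Fintype C] [DecidableEq C]
  [Fintype L] [DecidableEq L] [Fintype Ed]
  {T : Triangulation V C L Ed} {Φ : Fields V C L}

/-- The contribution of a variable of the link `l` to the `1`-Gauss constraint of the tetrahedron
dual to `c`. -/
def nodeMap (T : Triangulation V C L Ed) (Φ : Fields V C L) (c : C) (l : L) : Mat →ₗ[ℝ] Mat :=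
  (if T.src l = c then LinearMap.id else 0) - if T.tgt l = c then conjL (Φ.h l) else 0

lemma nodeMap_apply (c : C) (l : L) (B : Mat) : nodeMap T Φ c l B =
    (if T.src l = c then B else 0) - if T.tgt l = c then (Φ.h l)ᵀ * B * Φ.h l else 0 := by
  rw [nodeMap, LinearMap.sub_apply]
  split_ifs <;> simp

/-- Conjugation by the link holonomy carries `dc` at the source to `dc` at the target. Every
contribution to the node `c` is thus expressed by the same `dc`, so that contributions of
neighbouring links can cancel. -/
lemma nodeMap_brk (h : IsConfig T Φ) {e : Ed} {m : L} (hm : T.Around e m) {x : V → ℝ}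
    (hx : x ∈ openCell (T.edge e)) (c : C) (z : R4) :
    nodeMap T Φ c m (brk (D (Φ.c (T.src m)) x (T.edgeVec e)) z) =
      (if T.src m = c then brk (D (Φ.c c) x (T.edgeVec e)) z else 0) -
        if T.tgt m = c then brk (D (Φ.c c) x (T.edgeVec e)) ((Φ.h m)ᵀ *ᵥ z) else 0 := by
  have h1 := h.D_c_path (p := [(m, true)]) (a := T.src m) (b := T.tgt m) ⟨hm, rfl, rfl⟩ hx
  simp only [hol, Matrix.mul_one] at h1
  have h2 := conj_brk (Φ.h m)ᵀ (D (Φ.c (T.src m)) x (T.edgeVec e)) z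
  rw [Matrix.transpose_transpose, ← h1] at h2
  rw [nodeMap_apply, h2]
  congr 1 <;> split_ifs with hc <;> simp [hc]

/-- The transport of a vector along a path contributes to the `1`-Gauss constraint only at the ends
of the path. -/
lemma sum_nodeMap_linkTerm (h : IsConfig T Φ) {e : Ed} {x : V → ℝ} (hx : x ∈ openCell (T.edge e))
    (c : C) (w : R4) : ∀ {a : C} {p : List (L × Bool)} {b : C}, T.IsPath e a p b →
    ∑ l, nodeMap T Φ c l (brk (D (Φ.c (T.src l)) x (T.edgeVec e)) (linkTerm Φ.h l p w)) =
      (if a = c then brk (D (Φ.c c) x (T.edgeVec e)) (hol Φ.h p *ᵥ w) else 0) -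
        if b = c then brk (D (Φ.c c) x (T.edgeVec e)) w else 0
  | a, [], _, hp => by
    cases hp
    have h0 : ∀ u : R4, brk u 0 = 0 := fun u => (brkL u).map_zero
    simp [linkTerm, h0, hol]
  | a, (m, s) :: p, b, hp => by
    have hite : ∀ z : R4, ∑ l, nodeMap T Φ c l (brk (D (Φ.c (T.src l)) x (T.edgeVec e))
        (if m = l then z else 0)) =
          nodeMap T Φ c m (brk (D (Φ.c (T.src m)) x (T.edgeVec e)) z) := fun z => by
      rw [Finset.sum_eq_single m]
      · simp
      · intro l _ hl
        rw [if_neg hl.symm, show ∀ u, brk u 0 = 0 from fun u => (brkL u).map_zero, map_zero]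
      · simp
    cases s
    · obtain ⟨hl, rfl, hp⟩ := hp
      -- The arrival term of the first link cancels against the starting term of the rest of the
      -- path.
      simp only [linkTerm, brk_add_right, map_add, Finset.sum_add_distrib]
      rw [hite, sum_nodeMap_linkTerm h hx c w hp, nodeMap_brk h hl hx]
      have hn : ∀ u v : R4, brk u (-v) = -brk u v := fun u v => (brkL u).map_neg v
      simp only [hol, Matrix.mulVec_neg, hn, ← Matrix.mulVec_mulVec]
      split_ifs <;> abel
    · obtain ⟨hl, rfl, hp⟩ := hp
      simp only [linkTerm, brk_add_right, map_add, Finset.sum_add_distrib]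
      rw [hite, sum_nodeMap_linkTerm h hx c w hp, nodeMap_brk h hl hx]
      simp only [hol, Matrix.mulVec_mulVec, ← Matrix.mul_assoc, (h.h_mem m).transpose_mul,
        Matrix.one_mul]
      abel

/-- The `1`-form `b_c - [c_c, σ_c]`. -/
def shiftedB (Φ : Fields V C L) (c : C) (x u : V → ℝ) : Mat :=
  Φ.b c x u - brk (Φ.c c x) (Φ.σ c x u)

namespace IsConfig

lemma contDiff_shiftedB (h : IsConfig T Φ) (c : C) (u : V → ℝ) :
    ContDiff ℝ ∞ fun x => shiftedB Φ c x u :=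
  (h.b_smooth c u).sub (contDiff_bilin brkL (h.c_smooth c) (h.σ_smooth c u))

lemma extD_shiftedB (h : IsConfig T Φ) (c : C) (x u v : V → ℝ) : extD (shiftedB Φ c) x u v =
    Φ.db c x u v - extD (fun y w => brk (Φ.c c y) (Φ.σ c y w)) x u v := by
  have h1 : ∀ u v, D (fun y => shiftedB Φ c y v) x u =
      D (fun y => Φ.b c y v) x u - D (fun y => brk (Φ.c c y) (Φ.σ c y v)) x u := fun u v =>
    D_sub (h.b_differentiable c v x) (differentiableAt_bilin brkL (h.c_differentiable c x)
      (h.σ_differentiable c v x)) u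
  simp only [extD, Fields.db, h1]
  abel

lemma extD_brk_σ (h : IsConfig T Φ) (c : C) (x u v : V → ℝ) :
    extD (fun y w => brk (Φ.c c y) (Φ.σ c y w)) x u v =
      brk (Φ.c c x) (Φ.dσ c x u v) + (brk (D (Φ.c c) x u) (Φ.σ c x v)
        - brk (D (Φ.c c) x v) (Φ.σ c x u)) := by
  have h1 : ∀ u v, D (fun y => brk (Φ.c c y) (Φ.σ c y v)) x u = _ := fun u v =>
    D_bilin brkL (h.c_differentiable c x) (h.σ_differentiable c v x) u
  simp only [extD, h1, Fields.dσ, brkL_apply, brk_sub_right]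
  abel

lemma extD_brk_ς (h : IsConfig T Φ) (c : C) (l : L) (x u v : V → ℝ) :
    extD (fun y w => brk (D (Φ.c c) y w) (Φ.ς l y)) x u v =
      -(brk (D (Φ.c c) x u) (D (Φ.ς l) x v) - brk (D (Φ.c c) x v) (D (Φ.ς l) x u)) := by
  have hς : DifferentiableAt ℝ (Φ.ς l) x := (h.ς_smooth l).differentiable (by simp) x
  have h1 : ∀ u v, D (fun y => brk (D (Φ.c c) y v) (Φ.ς l y)) x u = _ := fun u v =>
    D_bilin brkL ((contDiff_D (h.c_smooth c) v).differentiable (by simp) x) hς u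
  simp only [extD, h1, brkL_apply]
  rw [D_comm ((h.c_smooth c).contDiffAt.of_le (WithTop.coe_le_coe.2 le_top)) u v]
  abel

/-- Since `ddc = 0`, the form `-[dc ∧ dς]` is the derivative of `[dc, ς]`, and its integral moves to
the edges. -/
lemma bulk_eq (h : IsConfig T Φ) (l : L) : bulk T Φ l =
    T.triInt l (extD (shiftedB Φ (T.src l))) + ∑ e, eps T e l • edgeBrk T Φ e (T.src l) (Φ.ς l) := by
  have hc : ∀ u, ContDiff ℝ ∞ fun x => brk (D (Φ.c (T.src l)) x u) (Φ.ς l x) := fun u =>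
    contDiff_bilin brkL (contDiff_D (h.c_smooth _) u) (h.ς_smooth l)
  have hextD : ∀ {θ : (V → ℝ) → (V → ℝ) → Mat}, (∀ u, ContDiff ℝ ∞ (θ · u)) → ∀ u v,
      Continuous fun x => extD θ x u v := fun hθ u v =>
    ((contDiff_D (hθ v) u).sub (contDiff_D (hθ u) v)).continuous
  rw [show (∑ e, eps T e l • edgeBrk T Φ e (T.src l) (Φ.ς l)) =
      T.triInt l (extD fun y w => brk (D (Φ.c (T.src l)) y w) (Φ.ς l y)) from
    (T.triInt_extD l (fun u => (hc u).of_le (mod_cast le_top)) fun x u v => by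
      rw [D_map_sub]; exact LinearMap.map_sub₂ brkL _ _ _).symm,
    ← T.triInt_add l (hextD (h.contDiff_shiftedB _)) (hextD hc)]
  refine T.triInt_congr fun x _ u v _ _ => ?_
  rw [h.extD_shiftedB, h.extD_brk_ς, sub_eq_add_neg]

/-- Seen from the target, `ς` disappears: `σ + dς` is rotated into `σ` at the target. The asymmetry
between this and `bulk_eq` is the source of the term `[ℓ, V]` in the constraint. -/
lemma conj_bulk (h : IsConfig T Φ) (l : L) : (Φ.h l)ᵀ * bulk T Φ l * Φ.h l =
    T.triInt l (extD (shiftedB Φ (T.tgt l))) := by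
  rw [← conjL_apply]
  refine (T.triInt_linear l (conjL (Φ.h l)) (h.continuous_bulkForm l)).symm.trans
    (T.triInt_congr fun x hx u v hu hv => ?_)
  have hb := h.db_sub_brk_tgt hx hu hv
  have hbr : ∀ u v, IsTangent (T.tri l) u → IsTangent (T.tri l) v →
      brk (D (Φ.c (T.tgt l)) x u) (Φ.σ (T.tgt l) x v) = conjL (Φ.h l)
        (brk (D (Φ.c (T.src l)) x u) (Φ.σ (T.src l) x v + D (Φ.ς l) x v)) := fun u v hu hv => by
    rw [h.D_c_tgt hx hu, h.σ_cont l x hx.1 v hv, ← conj_brk, Matrix.transpose_transpose, conjL_apply]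
  rw [h.extD_shiftedB, h.extD_brk_σ, ← sub_sub, hb, hbr u v hu hv, hbr v u hv hu, ← conjL_apply,
    ← map_sub, ← map_sub, bulkForm, h.extD_brk_σ]
  congr 1
  simp only [brk_add_right]
  abel

/-- The integrals of `d(b - [c, σ])` over the closed surface of the tetrahedron cancel, since the
boundary of a boundary is zero. There remain the edge terms of the links whose source is `c`. -/
lemma sum_nodeMap_bulk (h : IsConfig T Φ) (c : C) : ∑ l, nodeMap T Φ c l (bulk T Φ l) =
    ∑ e, ∑ l, eps T e l • if T.src l = c then edgeBrk T Φ e c (Φ.ς l) else 0 := by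
  have h1 : ∀ l, nodeMap T Φ c l (bulk T Φ l) =
      (incidence (T.tet c) (T.tri l) : ℝ) • T.triInt l (extD (shiftedB Φ c)) +
        ∑ e, eps T e l • if T.src l = c then edgeBrk T Φ e c (Φ.ς l) else 0 := by
    intro l
    rw [nodeMap_apply, h.conj_bulk, h.bulk_eq, T.incidence_eq]
    by_cases hs : T.src l = c <;> by_cases ht : T.tgt l = c <;> simp [hs, ht]
  have h2 : ∀ l, T.triInt l (extD (shiftedB Φ c)) = ∑ e, eps T e l • T.edgeInt e (shiftedB Φ c) :=
    fun l => T.triInt_extD l (fun u => (h.contDiff_shiftedB c u).of_le (mod_cast le_top))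
      fun x u v => by
        have h3 : brk (Φ.c c x) (Φ.σ c x u - Φ.σ c x v) = _ := brk_sub_right _ _ _
        simp only [shiftedB, map_sub, h3]
        abel
  simp only [h1, Finset.sum_add_distrib, h2, Finset.smul_sum, smul_smul]
  rw [Finset.sum_comm, Finset.sum_eq_zero fun e _ => ?_, zero_add, Finset.sum_comm]
  rw [← Finset.sum_smul]
  rw [show ∑ l, (incidence (T.tet c) (T.tri l) : ℝ) * eps T e l = 0 from T.sum_incidence_mul c e,
    zero_smul]

lemma continuous_brk_D (h : IsConfig T Φ) (c : C) {w : (V → ℝ) → R4} (hw : Continuous w)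
    (u : V → ℝ) : Continuous fun x => brk (D (Φ.c c) x u) (w x) :=
  (bilinCLM brkL).continuous₂.comp ((contDiff_D (h.c_smooth c) u).continuous.prodMk hw)

lemma sum_nodeMap_edgeBrk (h : IsConfig T Φ) (c : C) {e : Ed} {a b : C} {p : List (L × Bool)}
    (hp : T.IsPath e a p b) {w : (V → ℝ) → R4} (hw : Continuous w) :
    ∑ l, nodeMap T Φ c l (edgeBrk T Φ e (T.src l) fun x => linkTerm Φ.h l p (w x)) =
      (if a = c then edgeBrk T Φ e c fun x => hol Φ.h p *ᵥ w x else 0) -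
        if b = c then edgeBrk T Φ e c w else 0 := by
  have hc : ∀ l u, Continuous fun x =>
      brk (D (Φ.c (T.src l)) x u) (linkTerm Φ.h l p (w x)) := fun l =>
    h.continuous_brk_D _ (continuous_linkTerm _ _ _ hw)
  have hc1 := h.continuous_brk_D c (w := fun x => hol Φ.h p *ᵥ w x)
    ((LinearMap.continuous_of_finiteDimensional (mulVecL (hol Φ.h p))).comp hw)
  have h1 : ∀ l, nodeMap T Φ c l (edgeBrk T Φ e (T.src l) fun x => linkTerm Φ.h l p (w x)) =
      T.edgeInt e fun x u => nodeMap T Φ c l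
        (brk (D (Φ.c (T.src l)) x u) (linkTerm Φ.h l p (w x))) := fun l =>
    (T.edgeInt_linear e _ (hc l)).symm
  -- The case distinction is packaged as a linear map so that it can be moved through the integral.
  let A : C → Mat →ₗ[ℝ] Mat := fun a => if a = c then LinearMap.id else 0
  have hA : ∀ a B, A a B = if a = c then B else 0 := fun a B => by
    simp only [A]; split_ifs <;> rfl
  have h2 : ∀ l u, Continuous fun x => nodeMap T Φ c l
      (brk (D (Φ.c (T.src l)) x u) (linkTerm Φ.h l p (w x))) := fun l u =>
    (LinearMap.continuous_of_finiteDimensional (nodeMap T Φ c l)).comp (hc l u)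
  have h3 : ∀ a u, Continuous fun x => A a (brk (D (Φ.c c) x u) (hol Φ.h p *ᵥ w x)) := fun a u =>
    (LinearMap.continuous_of_finiteDimensional (A a)).comp (hc1 u)
  have h4 : ∀ a u, Continuous fun x => (-A a) (brk (D (Φ.c c) x u) (w x)) := fun a u =>
    (LinearMap.continuous_of_finiteDimensional (-A a)).comp (h.continuous_brk_D c hw u)
  rw [Finset.sum_congr rfl fun l _ => h1 l, ← T.edgeInt_sum e Finset.univ h2, ← hA, ← hA,
    sub_eq_add_neg, ← LinearMap.neg_apply, edgeBrk, edgeBrk, ← T.edgeInt_linear e (A a) hc1,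
    ← T.edgeInt_linear e (-A b) (h.continuous_brk_D c hw), ← T.edgeInt_add e (h3 a) (h4 b)]
  refine T.edgeInt_congr fun x hx => ?_
  rw [sum_nodeMap_linkTerm h hx c (w x) hp, LinearMap.neg_apply, hA, hA, sub_eq_add_neg]

/-- At each point of the edge the transported `ς`'s add up to the constant face variable, which can
be taken out of the integral. -/
lemma sum_edgeBrk_hol (h : IsConfig T Φ) (hσ : SigmaInvariant T Φ) (K : Choice T) (e : Ed) :
    ∑ m, eps T e m • (edgeBrk T Φ e (K.base e) fun x => hol Φ.h (K.path e m) *ᵥ Φ.ς m x) =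
      brk (ellVar T K Φ e) (faceVar T K Φ e) := by
  have hc : ∀ m u, Continuous fun x =>
      brk (D (Φ.c (K.base e)) x u) (hol Φ.h (K.path e m) *ᵥ Φ.ς m x) := fun m =>
    h.continuous_brk_D _ ((LinearMap.continuous_of_finiteDimensional
      (mulVecL (hol Φ.h (K.path e m)))).comp (h.ς_smooth m).continuous)
  have h1 : brk (ellVar T K Φ e) (faceVar T K Φ e) =
      T.edgeInt e fun x u => brk (D (Φ.c (K.base e)) x u) (faceVar T K Φ e) :=
    (T.edgeInt_linear e (brkL.flip (faceVar T K Φ e)) fun u =>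
      (contDiff_D (h.c_smooth (K.base e)) u).continuous).symm
  have h2 : ∀ m, eps T e m • (edgeBrk T Φ e (K.base e) fun x => hol Φ.h (K.path e m) *ᵥ Φ.ς m x) =
      T.edgeInt e fun x u => (eps T e m • LinearMap.id : Mat →ₗ[ℝ] Mat)
        (brk (D (Φ.c (K.base e)) x u) (hol Φ.h (K.path e m) *ᵥ Φ.ς m x)) := fun m =>
    (T.edgeInt_linear e (eps T e m • LinearMap.id) (hc m)).symm
  have h3 : ∀ m u, Continuous fun x => (eps T e m • LinearMap.id : Mat →ₗ[ℝ] Mat)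
      (brk (D (Φ.c (K.base e)) x u) (hol Φ.h (K.path e m) *ᵥ Φ.ς m x)) := fun m u =>
    (LinearMap.continuous_of_finiteDimensional (eps T e m • LinearMap.id : Mat →ₗ[ℝ] Mat)).comp
      (hc m u)
  rw [Finset.sum_congr rfl fun m _ => h2 m, ← T.edgeInt_sum e Finset.univ h3, h1]
  refine T.edgeInt_congr fun x hx => ?_
  rw [← h.faceSum_eq_faceVar hσ K e hx.1, faceSum, ← brkL_apply, map_sum]
  simp only [map_smul]
  rfl

/-- The modified `1`-Gauss constraint. -/
theorem sum_nodeMap_bVar (h : IsConfig T Φ) (hσ : SigmaInvariant T Φ) (K : Choice T) (c : C) :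
    ∑ l, nodeMap T Φ c l (bVar T K Φ l) =
      ∑ e, if K.base e = c then brk (ellVar T K Φ e) (faceVar T K Φ e) else 0 := by
  simp only [bVar, map_add, Finset.sum_add_distrib, h.sum_nodeMap_bulk, map_sum, map_smul]
  rw [Finset.sum_comm (s := (Finset.univ : Finset L)), ← Finset.sum_add_distrib]
  refine Finset.sum_congr rfl fun e _ => ?_
  rw [Finset.sum_comm, ← Finset.sum_add_distrib]
  -- The bulk contribution at the source of `m` cancels against the end of the transport path,
  -- leaving only its start at the base node.
  have h1 : ∀ m, eps T e m • (if T.src m = c then edgeBrk T Φ e c (Φ.ς m) else 0) +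
      ∑ l, eps T e m • nodeMap T Φ c l (edgeBrk T Φ e (T.src l) fun x =>
        linkTerm Φ.h l (K.path e m) (Φ.ς m x)) =
      if K.base e = c then
        eps T e m • (edgeBrk T Φ e (K.base e) fun x => hol Φ.h (K.path e m) *ᵥ Φ.ς m x) else 0 := by
    intro m
    by_cases h0 : eps T e m = 0
    · simp [h0]
    rw [← Finset.smul_sum, h.sum_nodeMap_edgeBrk c
      (K.isPath e m (Triangulation.around_of_eps_ne_zero h0)) (h.ς_smooth m).continuous, ← smul_add,
      add_sub_cancel]
    split_ifs with hb
    · rw [hb]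
    · rw [smul_zero]
  rw [Finset.sum_congr rfl fun m _ => h1 m]
  split_ifs
  · exact h.sum_edgeBrk_hol hσ K e
  · exact Finset.sum_const_zero

end IsConfig

end OneGauss

end BFCG

namespace BFCG

/-! ### Explicit variables and constraints on the boundary of the 4-simplex -/

namespace Arc

lemma sum_univ {M : Type*} [AddCommMonoid M] (f : Arc → M) : ∑ a, f a =
    f a12 + f a23 + f a34 + f a45 + f a51 + f a14 + f a42 + f a25 + f a53 + f a31 := by
  rw [show (Finset.univ : Finset Arc) = {a12, a23, a34, a45, a51, a14, a42, a25, a53, a31} from rfl]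
  repeat rw [Finset.sum_insert (by decide)]
  rw [Finset.sum_singleton]
  simp only [add_assoc]

/-- The coefficient of the edge `e` in the boundary of the triangle dual to `l`, as a closed
formula. -/
def side (e l : Arc) : ℤ :=
  let o (a b : Fin 5) : ℤ := (if e.fst = a ∧ e.snd = b then 1 else 0) -
    (if e.fst = b ∧ e.snd = a then 1 else 0)
  o (l.tri 1) (l.tri 2) - o (l.tri 0) (l.tri 2) + o (l.tri 0) (l.tri 1)

lemma eps_eq_side (e l : Arc) : eps simplexBdry e l = side e l := by
  have h : ∀ a b : Fin 5, pairOrient (simplexBdry.edge e) a b =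
      (((if e.fst = a ∧ e.snd = b then 1 else 0) - (if e.fst = b ∧ e.snd = a then 1 else 0) : ℤ) : ℝ) := by
    intro a b
    change (if e.fst = a then (1 : ℝ) else 0) * (if e.snd = b then 1 else 0) -
      (if e.fst = b then 1 else 0) * (if e.snd = a then 1 else 0) = _
    push_cast
    simp only [ite_and]
    split_ifs <;> simp
  rw [eps, incidence_edge, h, h, h, side]
  push_cast
  rfl

end Arc

namespace Simplex

open Arc

variable {Φ : Conf}

/-- Any two distinct nodes around `e`, that is, nodes whose labels are not end points of `e`, are
joined by a link that is again around `e`. Finitely many cases are decided. -/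
lemma isPath_direct : ∀ (e : Arc) (i j : Fin 5), i ≠ e.fst ∧ i ≠ e.snd → j ≠ e.fst ∧ j ≠ e.snd →
    simplexBdry.IsPath e i (direct i j) j := by
  have h : ∀ (e : Arc) (i j : Fin 5), i ≠ e.fst ∧ i ≠ e.snd → j ≠ e.fst ∧ j ≠ e.snd →
      IsPathWith Arc.fst Arc.snd (fun l => verts ![e.fst, e.snd] ⊆ verts (Arc.tri l)) i
        (Arc.direct i j) j := by
    decide
  exact h

lemma H_self (i : Fin 5) : H Φ i i = 1 := by
  have h : ∀ i, direct i i = [] := by decide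
  rw [H, h, hol]

lemma H_forward (l : Arc) : H Φ l.fst l.snd = Φ.h l := by
  have h : ∀ l : Arc, direct l.fst l.snd = [(l, true)] := by decide
  rw [H, h, hol, hol, Matrix.mul_one]

lemma H_backward (l : Arc) : H Φ l.snd l.fst = (Φ.h l)ᵀ := by
  have h : ∀ l : Arc, direct l.snd l.fst = [(l, false)] := by decide
  rw [H, h, hol, hol, Matrix.mul_one]

lemma H_transpose (i j : Fin 5) : (H Φ i j)ᵀ = H Φ j i := by
  have h : ∀ i j : Fin 5, i = j ∨ (∃ l : Arc, l.fst = i ∧ l.snd = j) ∨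
      ∃ l : Arc, l.fst = j ∧ l.snd = i := by decide
  rcases h i j with rfl | ⟨l, rfl, rfl⟩ | ⟨l, rfl, rfl⟩
  · rw [H_self, Matrix.transpose_one]
  · rw [H_forward, H_backward]
  · rw [H_forward, H_backward, Matrix.transpose_transpose]

/-- A direct path has at most one link, so it runs through `l` at most once; traversed backwards, it
leaves `w` at the source of `l` and only changes its sign. -/
lemma linkTerm_direct (l : Arc) (i j : Fin 5) (w : R4) : linkTerm Φ.h l (direct i j) w =
    if l.fst = i ∧ l.snd = j then H Φ i j *ᵥ w else if l.snd = i ∧ l.fst = j then -w else 0 := by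
  have h : ∀ (l : Arc) (i j : Fin 5),
      if l.fst = i ∧ l.snd = j then direct i j = [(l, true)] else
        if l.snd = i ∧ l.fst = j then direct i j = [(l, false)] else
          direct i j = [] ∨ ∃ m, m ≠ l ∧ (direct i j = [(m, true)] ∨ direct i j = [(m, false)]) := by
    decide
  have := h l i j
  split_ifs at this ⊢ with h1 h2
  · simp [this, linkTerm, H, hol]
  · simp [this, linkTerm, hol]
  · rcases this with h | ⟨m, hm, h | h⟩ <;> simp [linkTerm, *]

lemma faceFormulas (h : IsConfig simplexBdry Φ) (hσ : SigmaInvariant simplexBdry Φ) :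
    FaceFormulas Φ := by
  have key : ∀ e, ∀ x ∈ cell (simplexBdry.edge e),
      Vf Φ e = ∑ l, (side e l : ℝ) • (H Φ e.base l.fst *ᵥ Φ.ς l x) := fun e x hx => by
    rw [Vf, ← h.faceSum_eq_faceVar hσ simplexChoice e hx, faceSum]
    simp only [eps_eq_side]
    rfl
  constructor <;> intro x hx <;> rw [key _ x hx, Arc.sum_univ] <;>
    simp [side, Arc.fst, Arc.snd, Arc.tri, Arc.base, H_self] <;> abel

lemma edgeBrk_zero (e : Arc) (c : Fin 5) : edgeBrk simplexBdry Φ e c (fun _ => 0) = 0 := by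
  have h : ∀ u : R4, brk u 0 = 0 := fun u => (brkL u).map_zero
  simp [edgeBrk, Triangulation.edgeInt, simplexIntegral, h]

lemma edgeBrk_neg (e : Arc) (c : Fin 5) (w : (Fin 5 → ℝ) → R4) :
    edgeBrk simplexBdry Φ e c (fun x => -w x) = -edgeBrk simplexBdry Φ e c w := by
  have h : ∀ u w : R4, brk u (-w) = -brk u w := fun u w => (brkL u).map_neg w
  simp only [edgeBrk, Triangulation.edgeInt, simplexIntegral, h]
  exact integral_neg _

lemma bt_eq (l : Arc) : bt Φ l = bulk simplexBdry Φ l + ∑ e, ∑ m, (side e m : ℝ) •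
    if l.fst = e.base ∧ l.snd = m.fst then eInt Φ e l.fst (fun x => H Φ e.base m.fst *ᵥ Φ.ς m x)
    else if l.snd = e.base ∧ l.fst = m.fst then -eInt Φ e l.fst (Φ.ς m) else 0 := by
  rw [bt, bVar]
  congr 1
  refine Finset.sum_congr rfl fun e _ => Finset.sum_congr rfl fun m _ => ?_
  rw [eps_eq_side]
  congr 1
  have h : (fun x => linkTerm Φ.h l (simplexChoice.path e m) (Φ.ς m x)) = _ :=
    funext fun x => linkTerm_direct l e.base m.fst (Φ.ς m x)
  rw [h]
  split_ifs
  · rfl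
  · exact edgeBrk_neg _ _ _
  · exact edgeBrk_zero _ _

lemma triangleFormulas (Φ : Conf) : TriangleFormulas Φ := by
  constructor <;> rw [bt_eq] <;> simp only [Arc.sum_univ] <;>
    simp [side, Arc.fst, Arc.snd, Arc.tri, Arc.base] <;> abel

/-- Transported to a common node `j`, every edge variable is the difference of the one function
`c_j` at the two end vertices. The closure of a triangle is then a telescoping sum. -/
lemma H_ell (h : IsConfig simplexBdry Φ) (e : Arc) (j b : Fin 5) (hb : e.base = b)
    (hj : j ≠ e.fst ∧ j ≠ e.snd) :
    H Φ j b *ᵥ ell Φ e = Φ.c j (Pi.single e.snd 1) - Φ.c j (Pi.single e.fst 1) := by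
  subst hb
  have hb : ∀ e : Arc, e.base ≠ e.fst ∧ e.base ≠ e.snd := by decide
  have h1 := h.ellAt_path (isPath_direct e j e.base hj (hb e))
  rw [show ell Φ e = ellAt simplexBdry Φ e e.base from rfl, h1, Matrix.mulVec_mulVec, H,
    hol_mul_transpose h.h_mem, Matrix.one_mulVec, h.ellAt_eq]
  rfl

lemma ell_eq (h : IsConfig simplexBdry Φ) (e : Arc) (b : Fin 5) (hb : e.base = b) :
    ell Φ e = Φ.c b (Pi.single e.snd 1) - Φ.c b (Pi.single e.fst 1) := by
  have hj : ∀ e : Arc, e.base ≠ e.fst ∧ e.base ≠ e.snd := by decide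
  subst hb
  have := H_ell h e e.base e.base rfl (hj e)
  rwa [H_self, Matrix.one_mulVec] at this

lemma twoGauss (h : IsConfig simplexBdry Φ) : TwoGauss Φ := by
  constructor
  · rw [H_ell h a12 4 3 rfl (by decide),
      H_ell h a23 4 1 rfl (by decide),
      H_ell h a31 4 2 rfl (by decide)]
    simp only [Arc.fst, Arc.snd]
    abel
  · rw [H_ell h a12 5 3 rfl (by decide),
      H_ell h a42 5 3 rfl (by decide),
      H_ell h a14 5 2 rfl (by decide)]
    simp only [Arc.fst, Arc.snd]
    abel
  · rw [H_ell h a25 3 1 rfl (by decide),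
      H_ell h a51 3 2 rfl (by decide),
      ell_eq h a12 3 rfl]
    simp only [Arc.fst, Arc.snd]
    abel
  · rw [H_ell h a34 2 1 rfl (by decide),
      ell_eq h a31 2 rfl,
      ell_eq h a14 2 rfl]
    simp only [Arc.fst, Arc.snd]
    abel
  · rw [H_ell h a31 4 2 rfl (by decide),
      H_ell h a53 4 1 rfl (by decide),
      H_ell h a51 4 2 rfl (by decide)]
    simp only [Arc.fst, Arc.snd]
    abel
  · rw [H_ell h a45 2 1 rfl (by decide),
      ell_eq h a14 2 rfl,
      ell_eq h a51 2 rfl]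
    simp only [Arc.fst, Arc.snd]
    abel
  · rw [H_ell h a23 5 1 rfl (by decide),
      H_ell h a42 5 3 rfl (by decide),
      H_ell h a34 5 1 rfl (by decide)]
    simp only [Arc.fst, Arc.snd]
    abel
  · rw [ell_eq h a23 1 rfl,
      ell_eq h a53 1 rfl,
      ell_eq h a25 1 rfl]
    simp only [Arc.fst, Arc.snd]
    abel
  · rw [H_ell h a25 3 1 rfl (by decide),
      H_ell h a45 3 1 rfl (by decide),
      ell_eq h a42 3 rfl]
    simp only [Arc.fst, Arc.snd]
    abel
  · rw [ell_eq h a34 1 rfl,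
      ell_eq h a45 1 rfl,
      ell_eq h a53 1 rfl]
    simp only [Arc.fst, Arc.snd]
    abel

/-- The triangle of direct links through `i`, `j`, `k` is a loop around `e`, whose holonomy is
trivial by flatness. -/
lemma H_mul (h : IsConfig simplexBdry Φ) {e : Arc} (he : Flat Φ e) (i j k : Fin 5)
    (hi : i ≠ e.fst ∧ i ≠ e.snd) (hj : j ≠ e.fst ∧ j ≠ e.snd) (hk : k ≠ e.fst ∧ k ≠ e.snd) :
    H Φ i j * H Φ j k = H Φ i k := by
  have h1 := he i (direct i j ++ (direct j k ++ direct k i))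
    ((isPath_direct e i j hi hj).append ((isPath_direct e j k hj hk).append
      (isPath_direct e k i hk hi)))
  rw [hol_append, hol_append] at h1
  have h2 := congrArg (· * H Φ i k) h1
  have h3 : hol Φ.h (direct k i) * H Φ i k = 1 := by
    have := hol_transpose_mul h.h_mem (direct i k)
    rwa [show (hol Φ.h (direct i k))ᵀ = hol Φ.h (direct k i) from H_transpose i k] at this
  simp only [Matrix.mul_assoc, h3, Matrix.mul_one, Matrix.one_mul] at h2
  exact h2

/-- The face variables are constant along their edges, so all four can be evaluated at the common
vertex `v`. There each `ς` occurs in two of the faces, with opposite signs once the holonomies have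
been composed by flatness. -/
lemma twoFlatness (h : IsConfig simplexBdry Φ) (hF : FaceFormulas Φ) : TwoFlatness Φ := by
  have hx : ∀ (e : Arc) (v : Fin 5), v = e.fst ∨ v = e.snd →
      Pi.single v 1 ∈ cell (simplexBdry.edge e) := by
    rintro e v (rfl | rfl)
    · exact Triangulation.pts_mem_cell (simplexBdry.edge e) 0
    · exact Triangulation.pts_mem_cell (simplexBdry.edge e) 1
  constructor <;> intro hf
  · rw [hF.V12 (Pi.single 1 1) (hx _ _ (by decide)), hF.V14 (Pi.single 1 1) (hx _ _ (by decide)),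
      hF.V31 (Pi.single 1 1) (hx _ _ (by decide)), hF.V51 (Pi.single 1 1) (hx _ _ (by decide))]
    simp only [Matrix.mulVec_add, Matrix.mulVec_mulVec,
      H_mul h (hf a51 (by decide)) 2 3 4 (by decide) (by decide) (by decide),
      H_mul h (hf a14 (by decide)) 2 3 5 (by decide) (by decide) (by decide)]
    abel
  · rw [hF.V23 (Pi.single 2 1) (hx _ _ (by decide)), hF.V25 (Pi.single 2 1) (hx _ _ (by decide)),
      hF.V12 (Pi.single 2 1) (hx _ _ (by decide)), hF.V42 (Pi.single 2 1) (hx _ _ (by decide))]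
    simp only [Matrix.mulVec_add, Matrix.mulVec_sub, Matrix.mulVec_neg, Matrix.mulVec_mulVec,
      H_mul h (hf a25 (by decide)) 1 3 4 (by decide) (by decide) (by decide),
      H_mul h (hf a42 (by decide)) 1 3 5 (by decide) (by decide) (by decide)]
    abel
  · rw [hF.V31 (Pi.single 3 1) (hx _ _ (by decide)), hF.V34 (Pi.single 3 1) (hx _ _ (by decide)),
      hF.V53 (Pi.single 3 1) (hx _ _ (by decide)), hF.V23 (Pi.single 3 1) (hx _ _ (by decide))]
    simp only [Matrix.mulVec_add, Matrix.mulVec_sub, Matrix.mulVec_neg, Matrix.mulVec_mulVec,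
      H_mul h (hf a53 (by decide)) 1 2 4 (by decide) (by decide) (by decide)]
    abel
  · rw [hF.V45 (Pi.single 4 1) (hx _ _ (by decide)), hF.V42 (Pi.single 4 1) (hx _ _ (by decide)),
      hF.V14 (Pi.single 4 1) (hx _ _ (by decide)), hF.V34 (Pi.single 4 1) (hx _ _ (by decide))]
    simp only [Matrix.mulVec_add, Matrix.mulVec_sub, Matrix.mulVec_neg, Matrix.mulVec_mulVec,
      H_mul h (hf a42 (by decide)) 1 3 5 (by decide) (by decide) (by decide),
      H_mul h (hf a34 (by decide)) 1 2 5 (by decide) (by decide) (by decide)]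
    abel
  · rw [hF.V53 (Pi.single 5 1) (hx _ _ (by decide)), hF.V51 (Pi.single 5 1) (hx _ _ (by decide)),
      hF.V45 (Pi.single 5 1) (hx _ _ (by decide)), hF.V25 (Pi.single 5 1) (hx _ _ (by decide))]
    simp only [Matrix.mulVec_add, Matrix.mulVec_mulVec,
      H_mul h (hf a53 (by decide)) 1 2 4 (by decide) (by decide) (by decide),
      H_mul h (hf a45 (by decide)) 1 2 3 (by decide) (by decide) (by decide)]
    abel

/-- This is `sum_nodeMap_bVar` at each of the five nodes; the transposed link holonomy there is `H`
from the target to the source. -/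
lemma oneGauss (h : IsConfig simplexBdry Φ) (hσ : SigmaInvariant simplexBdry Φ) : OneGauss Φ := by
  have key : ∀ c, ∑ l, ((if l.fst = c then bt Φ l else 0) -
      if l.snd = c then conj Φ l.snd l.fst (bt Φ l) else 0) -
        ∑ e : Arc, (if e.base = c then brk (ell Φ e) (Vf Φ e) else 0) = 0 := fun c => by
    refine sub_eq_zero.2 (Eq.trans ?_ (h.sum_nodeMap_bVar hσ simplexChoice c))
    refine Finset.sum_congr rfl fun l _ => ?_
    rw [nodeMap_apply, conj, H_backward, Matrix.transpose_transpose]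
    rfl
  simp only [Arc.sum_univ] at key
  constructor
  · have := key 1
    simp [Arc.fst, Arc.snd, Arc.base] at this
    refine Eq.trans ?_ this
    rw [show (5 : Fin 5) = 0 from rfl]
    abel
  · have := key 2
    simp [Arc.fst, Arc.snd, Arc.base] at this
    refine Eq.trans ?_ this
    abel
  · have := key 3
    simp [Arc.fst, Arc.snd, Arc.base] at this
    refine Eq.trans ?_ this
    rw [show (5 : Fin 5) = 0 from rfl]
    abel
  · have := key 4
    simp [Arc.fst, Arc.snd, Arc.base] at this
    refine Eq.trans ?_ this
    abel
  · have := key 5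
    simp [Arc.fst, Arc.snd, Arc.base] at this
    refine Eq.trans ?_ this
    abel

end Simplex

end BFCG

/-! ### Dependence of the triangle variable on the fields -/

namespace BFCG

lemma volume_stdDomain_ne_zero (n : ℕ) : volume.real (stdDomain n) ≠ 0 := by
  have hne : (openDomain n).Nonempty :=
    closure_nonempty_iff.1 ⟨0, stdDomain_subset_closure n ⟨fun _ => le_rfl, by simp⟩⟩
  have h := ((isOpen_openDomain n).measure_pos volume hne).trans_le
    (measure_mono (openDomain_subset n))
  exact (ENNReal.toReal_pos h.ne' (volume_stdDomain_lt_top n).ne).ne'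

lemma J_ne_zero : J 0 1 ≠ 0 := fun h => by
  simpa [J, Matrix.single_apply] using congrFun (congrFun h 1) 0

namespace Simplex

open Arc

/-- The `1`-form `x₃ dx₄` with a constant coefficient. -/
def coordForm {F : Type*} [AddCommGroup F] [Module ℝ F] (a : F) (x : Fin 5 → ℝ) :
    (Fin 5 → ℝ) →ₗ[ℝ] F :=
  x 3 • (LinearMap.proj 4).smulRight a

/-- A configuration with trivial transition data, up to constant `ς`'s. -/
def trivialConf (c : (Fin 5 → ℝ) → R4) (s : R4) (B : Mat) (w : Arc → R4) : Conf where
  g _ _ := 1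
  c _ := c
  σ _ := coordForm s
  b _ := coordForm B
  h _ := 1
  x _ := 0
  ς l _ := w l
  y _ _ := 0

lemma hol_one {L : Type*} (p : List (L × Bool)) : hol (fun _ : L => (1 : Mat)) p = 1 := by
  induction p with
  | nil => rfl
  | cons m p ih =>
    obtain ⟨m, b⟩ := m
    cases b <;> simp [hol, ih]

variable {c : (Fin 5 → ℝ) → R4} {s : R4} {B : Mat} {w : Arc → R4}

lemma isConfig_trivialConf (hc : ContDiff ℝ ∞ c) (hB : IsSkew B) :
    IsConfig simplexBdry (trivialConf c s B w) ∧ SigmaInvariant simplexBdry (trivialConf c s B w) := by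
  have h0 : ∀ u : R4, brk 0 u = 0 := fun u => brkL.map_zero₂ u
  have hx : ContDiff ℝ ∞ fun x : Fin 5 → ℝ => x 3 := contDiff_apply _ _ _
  have hD : ∀ (l : Arc) (x u : Fin 5 → ℝ), D ((trivialConf c s B w).ς l) x u = 0 := fun l x u =>
    D_const _ _ _
  have hD' : ∀ (l : Arc) (x u : Fin 5 → ℝ), D ((trivialConf c s B w).y l) x u = 0 := fun l x u =>
    D_const _ _ _
  refine ⟨⟨fun _ _ _ => one_mem _, fun _ => one_mem _, fun _ x u => (hB.smul _).smul _,
    fun _ _ => isSkew_zero, fun _ _ _ => contDiffAt_const, fun _ => hc,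
    fun _ u => hx.smul contDiff_const, fun _ u => hx.smul contDiff_const,
    fun _ => contDiff_const, fun _ => contDiff_const, fun _ _ _ => (one_mul _).symm,
    fun _ x _ => ?_, fun l x _ u _ => ?_, fun l x _ u _ => ?_⟩, fun e a p _ x _ => ?_⟩
  · simp [trivialConf]
  · rw [hD]; simp [trivialConf]
  · rw [hD']; simp [trivialConf, h0]
  · rw [show (trivialConf c s B w).h = fun _ => 1 from rfl, hol_one, Matrix.one_mulVec]

lemma edgeBrk_const (hc : ContDiff ℝ ∞ c) (e : Arc) (i : Fin 5) (v : R4) :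
    edgeBrk simplexBdry (trivialConf c s B w) e i (fun _ => v) =
      brk (c (pts (simplexBdry.edge e) 1) - c (pts (simplexBdry.edge e) 0)) v := by
  rw [← simplexBdry.edgeInt_D e (hc.of_le (mod_cast le_top))]
  exact simplexBdry.edgeInt_linear e (brkL.flip v) fun u => (contDiff_D hc u).continuous

/-- When `B - [c, s]` is a constant `A`, the form `b - [c, σ]` is `A x₃ dx₄`, whose exterior
derivative has constant coefficients. -/
lemma bulk_trivialConf (hc : ContDiff ℝ ∞ c) (hB : IsSkew B) (hw : w a12 = 0) {A : Mat}
    (hA : ∀ x, B - brk (c x) s = A) :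
    bulk simplexBdry (trivialConf c s B w) a12 = volume.real (stdDomain 2) • A := by
  have hz : ∀ e i, edgeBrk simplexBdry (trivialConf c s B w) e i
      ((trivialConf c s B w).ς a12) = 0 := fun e i => by
    rw [show (trivialConf c s B w).ς a12 = fun _ => 0 from funext fun _ => hw]
    exact edgeBrk_zero e i
  rw [(isConfig_trivialConf hc hB).1.bulk_eq]
  simp only [hz, smul_zero, Finset.sum_const_zero, add_zero]
  have hθ : ∀ i, shiftedB (trivialConf c s B w) i = fun x u => x 3 • u 4 • A := fun i => by
    funext x u
    have h1 : brk (c x) (x 3 • u 4 • s) = x 3 • u 4 • brk (c x) s := by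
      rw [brk_smul_right, brk_smul_right]
    rw [← hA x, smul_sub, smul_sub, ← h1]
    rfl
  have hD : ∀ x u v : Fin 5 → ℝ, D (fun y : Fin 5 → ℝ => y 3 • v 4 • A) x u = u 3 • v 4 • A :=
    fun x u v => congrArg (fun M : (Fin 5 → ℝ) →L[ℝ] Mat => M u)
      ((ContinuousLinearMap.proj 3).smulRight (v 4 • A) : (Fin 5 → ℝ) →L[ℝ] Mat).fderiv
  rw [hθ, Triangulation.triInt, simplexIntegral]
  simp only [extD, hD]
  rw [setIntegral_const]
  congr 1
  -- On the sides from vertex 3 to vertices 4 and 5 of the triangle, `dx₃ ∧ dx₄` takes the value 1.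
  simp [pts, simplexBdry, Arc.tri]

/-- The only nonzero `ς` is the constant `v` on the link `a23`, which enters the variable of `a12`
through the integral over the edge `a45`. -/
lemma bt_trivialConf (hc : ContDiff ℝ ∞ c) (hB : IsSkew B) (v : R4) {A : Mat}
    (hA : ∀ x, B - brk (c x) s = A) :
    bt (trivialConf c s B (Pi.single a23 v)) a12 =
      volume.real (stdDomain 2) • A + brk (c (Pi.single 5 1) - c (Pi.single 4 1)) v := by
  have h1 : ∀ e i j k l, eInt (trivialConf c s B (Pi.single a23 v)) e i
      (fun x => H (trivialConf c s B (Pi.single a23 v)) j k *ᵥ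
        (trivialConf c s B (Pi.single a23 v)).ς l x) =
      brk (c (pts (simplexBdry.edge e) 1) - c (pts (simplexBdry.edge e) 0))
        ((Pi.single a23 v : Arc → R4) l) := fun e i j k l => by
    rw [← edgeBrk_const (s := s) (B := B) (w := Pi.single a23 v) hc e i, eInt]
    congr 1
    funext x
    rw [H, show (trivialConf c s B (Pi.single a23 v)).h = fun _ => 1 from rfl, hol_one,
      Matrix.one_mulVec]
    rfl
  have h0 : ∀ u : R4, brk u 0 = 0 := fun u => (brkL u).map_zero
  rw [(triangleFormulas _).b12, bulk_trivialConf hc hB (by simp) hA, h1, h1, Pi.single_eq_same,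
    Pi.single_eq_of_ne (by decide), h0, add_zero]
  rfl

lemma volume_smul_J_ne_zero : volume.real (stdDomain 2) • J 0 1 ≠ 0 :=
  smul_ne_zero (volume_stdDomain_ne_zero 2) J_ne_zero

/-- Configurations that differ only in `b`. -/
lemma bt_depends_on_b : ∃ (Φ : Conf) (b' : _), let Φ' := { Φ with b := b' }
    (IsConfig simplexBdry Φ ∧ SigmaInvariant simplexBdry Φ) ∧
      (IsConfig simplexBdry Φ' ∧ SigmaInvariant simplexBdry Φ') ∧ bt Φ a12 ≠ bt Φ' a12 := by
  have h0 : ∀ u : R4, brk 0 u = 0 := fun u => brkL.map_zero₂ u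
  have e1 := bt_trivialConf (c := fun _ => 0) (s := 0) contDiff_const isSkew_zero 0 (A := 0)
    fun _ => by simp [h0]
  have e2 := bt_trivialConf (c := fun _ => 0) (s := 0) contDiff_const (isSkew_J 0 1) 0 (A := J 0 1)
    fun _ => by simp [h0]
  refine ⟨trivialConf (fun _ => 0) 0 0 (Pi.single a23 0), fun _ => coordForm (J 0 1),
    isConfig_trivialConf contDiff_const isSkew_zero,
    isConfig_trivialConf contDiff_const (isSkew_J 0 1), fun h => ?_⟩
  have h := e1.symm.trans (h.trans e2)
  rw [sub_self, h0, smul_zero, add_zero, add_zero] at h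
  exact volume_smul_J_ne_zero h.symm

/-- Configurations that differ only in `c`. -/
lemma bt_depends_on_c : ∃ (Φ : Conf) (c' : _), let Φ' := { Φ with c := c' }
    (IsConfig simplexBdry Φ ∧ SigmaInvariant simplexBdry Φ) ∧
      (IsConfig simplexBdry Φ' ∧ SigmaInvariant simplexBdry Φ') ∧ bt Φ a12 ≠ bt Φ' a12 := by
  have h0 : ∀ u : R4, brk 0 u = 0 := fun u => brkL.map_zero₂ u
  have e1 := bt_trivialConf (c := fun _ => 0) (s := Pi.single 1 1) contDiff_const isSkew_zero 0
    (A := 0) fun _ => by simp [h0]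
  -- The values `e₀` for `c` and `e₁` for the coefficient of `σ` are chosen so that their bracket is
  -- `J 0 1`.
  have e2 := bt_trivialConf (c := fun _ => Pi.single 0 1) (s := Pi.single 1 1) contDiff_const
    isSkew_zero 0 (A := -J 0 1) fun _ => by rw [brk_single, zero_sub]
  refine ⟨trivialConf (fun _ => 0) (Pi.single 1 1) 0 (Pi.single a23 0), fun _ _ => Pi.single 0 1,
    isConfig_trivialConf contDiff_const isSkew_zero,
    isConfig_trivialConf contDiff_const isSkew_zero, fun h => ?_⟩
  have h := e1.symm.trans (h.trans e2)
  rw [sub_self, sub_self, h0, smul_zero, add_zero, add_zero, smul_neg] at h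
  exact volume_smul_J_ne_zero (neg_eq_zero.1 h.symm)

/-- Configurations that differ only in `σ`. -/
lemma bt_depends_on_σ : ∃ (Φ : Conf) (σ' : _), let Φ' := { Φ with σ := σ' }
    (IsConfig simplexBdry Φ ∧ SigmaInvariant simplexBdry Φ) ∧
      (IsConfig simplexBdry Φ' ∧ SigmaInvariant simplexBdry Φ') ∧ bt Φ a12 ≠ bt Φ' a12 := by
  have h0 : ∀ u : R4, brk 0 u = 0 := fun u => brkL.map_zero₂ u
  have h0' : ∀ u : R4, brk u 0 = 0 := fun u => (brkL u).map_zero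
  have e1 := bt_trivialConf (c := fun _ => Pi.single 0 1) (s := 0) contDiff_const isSkew_zero 0
    (A := 0) fun _ => by rw [h0', sub_zero]
  have e2 := bt_trivialConf (c := fun _ => Pi.single 0 1) (s := Pi.single 1 1) contDiff_const
    isSkew_zero 0 (A := -J 0 1) fun _ => by rw [brk_single, zero_sub]
  refine ⟨trivialConf (fun _ => Pi.single 0 1) 0 0 (Pi.single a23 0), fun _ => coordForm (Pi.single 1 1),
    isConfig_trivialConf contDiff_const isSkew_zero,
    isConfig_trivialConf contDiff_const isSkew_zero, fun h => ?_⟩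
  have h := e1.symm.trans (h.trans e2)
  rw [sub_self, h0, smul_zero, add_zero, add_zero, smul_neg] at h
  exact volume_smul_J_ne_zero (neg_eq_zero.1 h.symm)

/-- Configurations that differ only in `ς`. -/
lemma bt_depends_on_ς : ∃ (Φ : Conf) (ς' : _), let Φ' := { Φ with ς := ς' }
    (IsConfig simplexBdry Φ ∧ SigmaInvariant simplexBdry Φ) ∧
      (IsConfig simplexBdry Φ' ∧ SigmaInvariant simplexBdry Φ') ∧ bt Φ a12 ≠ bt Φ' a12 := by
  have h0' : ∀ u : R4, brk u 0 = 0 := fun u => (brkL u).map_zero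
  -- With `c = x₅ e₀`, the difference of `c` between the ends of the edge `a45` is `e₀`. Taking `σ =
  -- 0` removes the bulk term, so only `[e₀, v]` remains.
  have hc : ContDiff ℝ ∞ fun x : Fin 5 → ℝ => x 5 • (Pi.single 0 1 : R4) :=
    (contDiff_apply ℝ ℝ (5 : Fin 5)).smul contDiff_const
  have e := fun v => bt_trivialConf (s := 0) hc isSkew_zero v (A := 0) fun _ => by
    rw [h0', sub_zero]
  have hne : (4 : Fin 5) ≠ 5 := by decide
  simp only [Pi.single_eq_same, Pi.single_eq_of_ne hne.symm, zero_smul, one_smul, sub_zero,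
    smul_zero, zero_add] at e
  refine ⟨trivialConf (fun x => x 5 • Pi.single 0 1) 0 0 (Pi.single a23 0),
    fun l _ => (Pi.single a23 (Pi.single 1 1) : Arc → R4) l,
    isConfig_trivialConf hc isSkew_zero, isConfig_trivialConf hc isSkew_zero, fun h => ?_⟩
  have h := (e 0).symm.trans (h.trans (e (Pi.single 1 1)))
  rw [h0', brk_single] at h
  exact J_ne_zero h.symm

end Simplex

end BFCG

theorem mainTheorem3 {V C L Ed : Type*} [Fintype V] [DecidableEq V] [Fintype C] [DecidableEq C]
    [Fintype L] [DecidableEq L] [Fintype Ed] [DecidableEq Ed]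
    (T : BFCG.Triangulation V C L Ed) (K : BFCG.Choice T) :
    -- discrete variables: `V` is constant on the edge, all variables live in the phase space of
    -- `G`-networks, and `ℓ` obeys edge simplicity
    (∀ Φ : BFCG.Fields V C L, BFCG.IsConfig T Φ → BFCG.SigmaInvariant T Φ →
      (∀ e, ∀ x ∈ BFCG.cell (T.edge e), BFCG.faceSum T K Φ e x = BFCG.faceVar T K Φ e) ∧
      BFCG.InPhase (Φ.h, BFCG.bVar T K Φ, BFCG.ellVar T K Φ, BFCG.faceVar T K Φ) ∧
      (∀ e c p, T.IsPath e c p c →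
        BFCG.ellAt T Φ e c - (BFCG.hol Φ.h p)ᵀ *ᵥ BFCG.ellAt T Φ e c = 0)) ∧
    -- the symplectic potential becomes the discrete potential
    (∀ Φ : ℝ → BFCG.Fields V C L, BFCG.IsVariation T Φ → (∀ t, BFCG.SigmaInvariant T (Φ t)) →
      (∀ c, IntegrableOn (fun s => BFCG.potentialForm Φ c
          (BFCG.simplexMap (BFCG.pts (T.tet c)) s)
          (BFCG.pts (T.tet c) 1 - BFCG.pts (T.tet c) 0)
          (BFCG.pts (T.tet c) 2 - BFCG.pts (T.tet c) 0)
          (BFCG.pts (T.tet c) 3 - BFCG.pts (T.tet c) 0)) (BFCG.stdDomain 3)) ∧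
      BFCG.ThetaBFCG T Φ =
        BFCG.discretePotential (Φ 0).h (BFCG.bVar T K (Φ 0)) (BFCG.ellVar T K (Φ 0))
          (fun l => BFCG.vary fun t => (Φ t).h l)
          (fun e => BFCG.vary fun t => BFCG.faceVar T K (Φ t) e)) ∧
    -- the discrete potential defines the phase space of `G`-networks: the form is nondegenerate, and
    -- the Poisson brackets are those of `T*SO(4)` on links and of `T*ℝ⁴` on edges
    (∀ z : BFCG.Ambient L Ed, BFCG.InPhase z →
      (∀ X, BFCG.IsTangentPhase z X →
        (∀ w, BFCG.IsTangentPhase z w → BFCG.omega z X w = 0) → X = 0) ∧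
      (∀ e e' α β, BFCG.HasPoisson z (BFCG.ellFun e α) (BFCG.VFun e' β)
        (if e = e' ∧ α = β then -1 else 0)) ∧
      (∀ l l' α β σ ρ, BFCG.HasPoisson z (BFCG.hFun l α β) (BFCG.bFun l' σ ρ)
        (if l = l' then (BFCG.J σ ρ * z.1 l) α β else 0)) ∧
      (∀ l l' σ ρ α β, BFCG.HasPoisson z (BFCG.bFun l σ ρ) (BFCG.bFun l' α β)
        (if l = l' then
          (if σ = α then BFCG.bFun l ρ β z else 0) + (if ρ = β then BFCG.bFun l σ α z else 0)
            - (if σ = β then BFCG.bFun l ρ α z else 0) - (if ρ = α then BFCG.bFun l σ β z else 0)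
        else 0)) ∧
      (∀ l l' α β γ κ, BFCG.HasPoisson z (BFCG.hFun l α β) (BFCG.hFun l' γ κ) 0) ∧
      (∀ e e' α β, BFCG.HasPoisson z (BFCG.ellFun e α) (BFCG.ellFun e' β) 0) ∧
      (∀ e e' α β, BFCG.HasPoisson z (BFCG.VFun e α) (BFCG.VFun e' β) 0) ∧
      (∀ l e α β γ, BFCG.HasPoisson z (BFCG.hFun l α β) (BFCG.ellFun e γ) 0) ∧
      (∀ l e α β γ, BFCG.HasPoisson z (BFCG.hFun l α β) (BFCG.VFun e γ) 0) ∧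
      (∀ l e σ ρ γ, BFCG.HasPoisson z (BFCG.bFun l σ ρ) (BFCG.ellFun e γ) 0) ∧
      (∀ l e σ ρ γ, BFCG.HasPoisson z (BFCG.bFun l σ ρ) (BFCG.VFun e γ) 0)) ∧
    -- explicit variables and constraints for the boundary of the `4`-simplex
    (∀ Φ : BFCG.Simplex.Conf, BFCG.IsConfig BFCG.simplexBdry Φ →
      BFCG.SigmaInvariant BFCG.simplexBdry Φ →
      BFCG.Simplex.FaceFormulas Φ ∧ BFCG.Simplex.TriangleFormulas Φ ∧
      BFCG.Simplex.TwoGauss Φ ∧ BFCG.Simplex.TwoFlatness Φ ∧ BFCG.Simplex.OneGauss Φ) ∧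
    -- the triangle variable depends on each of the fields `b`, `c`, `σ`, `ς`: two configurations
    -- that differ in one of these fields only can have different triangle variables
    (∃ (Φ : BFCG.Simplex.Conf) (b' : _), let Φ' := { Φ with b := b' }
      (BFCG.IsConfig BFCG.simplexBdry Φ ∧ BFCG.SigmaInvariant BFCG.simplexBdry Φ) ∧
      (BFCG.IsConfig BFCG.simplexBdry Φ' ∧ BFCG.SigmaInvariant BFCG.simplexBdry Φ') ∧
      BFCG.Simplex.bt Φ .a12 ≠ BFCG.Simplex.bt Φ' .a12) ∧
    (∃ (Φ : BFCG.Simplex.Conf) (c' : _), let Φ' := { Φ with c := c' }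
      (BFCG.IsConfig BFCG.simplexBdry Φ ∧ BFCG.SigmaInvariant BFCG.simplexBdry Φ) ∧
      (BFCG.IsConfig BFCG.simplexBdry Φ' ∧ BFCG.SigmaInvariant BFCG.simplexBdry Φ') ∧
      BFCG.Simplex.bt Φ .a12 ≠ BFCG.Simplex.bt Φ' .a12) ∧
    (∃ (Φ : BFCG.Simplex.Conf) (σ' : _), let Φ' := { Φ with σ := σ' }
      (BFCG.IsConfig BFCG.simplexBdry Φ ∧ BFCG.SigmaInvariant BFCG.simplexBdry Φ) ∧
      (BFCG.IsConfig BFCG.simplexBdry Φ' ∧ BFCG.SigmaInvariant BFCG.simplexBdry Φ') ∧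
      BFCG.Simplex.bt Φ .a12 ≠ BFCG.Simplex.bt Φ' .a12) ∧
    (∃ (Φ : BFCG.Simplex.Conf) (ς' : _), let Φ' := { Φ with ς := ς' }
      (BFCG.IsConfig BFCG.simplexBdry Φ ∧ BFCG.SigmaInvariant BFCG.simplexBdry Φ) ∧
      (BFCG.IsConfig BFCG.simplexBdry Φ' ∧ BFCG.SigmaInvariant BFCG.simplexBdry Φ') ∧
      BFCG.Simplex.bt Φ .a12 ≠ BFCG.Simplex.bt Φ' .a12) := by
  refine ⟨fun Φ h hσ => ⟨fun e x hx => h.faceSum_eq_faceVar hσ K e hx,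
    ⟨h.h_mem, h.isSkew_bVar K⟩, fun e c p hp => sub_eq_zero.2 (h.ellAt_path hp)⟩,
    fun Φ h hσ => ⟨fun c => h.integrableOn_potentialForm c (BFCG.isTangent_pts_sub _ _ _)
      (BFCG.isTangent_pts_sub _ _ _) (BFCG.isTangent_pts_sub _ _ _), h.thetaBFCG_eq hσ K⟩,
    fun z hz => BFCG.phase_brackets hz, fun Φ h hσ => ?_, BFCG.Simplex.bt_depends_on_b,
    BFCG.Simplex.bt_depends_on_c, BFCG.Simplex.bt_depends_on_σ, BFCG.Simplex.bt_depends_on_ς⟩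
  have hF := BFCG.Simplex.faceFormulas h hσ
  exact ⟨hF, BFCG.Simplex.triangleFormulas Φ, BFCG.Simplex.twoGauss h,
    BFCG.Simplex.twoFlatness h hF, BFCG.Simplex.oneGauss h hσ⟩
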